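/- For $i\in\{-1,0,1\}$ let $\Lambda_i=\{v\in\mathbb Z^3 : v_1+v_2+v_3=i\}$. The Necker cube surface $\mathbf N\subset\mathbb R^3$ is the union of all unit squares (its faces) whose vertices lie in $\Lambda_{-1}\cup\Lambda_0\cup\Lambda_1$; its singularities are the vertices of these squares. A nonsingular geodesic is a unit-speed curve $\gamma:\mathbb R\to\mathbf N$ that never meets a singularity, is a straight segment inside each face, and continues straight across each edge when the two adjacent faces are unfolded into a plane. It is closed (periodic) if there is $\ell\neq 0$ with $\gamma(\ell+t)=\gamma(t)$ for all $t\in\mathbb R$; its length is then its least positive period. It is drift-periodic if there are $\ell\ne0$ and a nonzero $x\in\mathbb R^3$ with $\gamma(\ell+t)=x+\gamma(t)$ for all $t\in\mathbb R$. When $\gamma$ passes through the interior of a face with velocity $(x_0,y_0,z_0)$, its slope there is $y_0/x_0$, $z_0/y_0$ or $x_0/z_0$ in $\mathbb R\cup\{\infty\}$, according to whether the face is parallel to the $xy$-, $yz$- or $zx$-plane. **Theorem 1.1.** Let $m\in\mathbb R\cup\{\infty\}$ be the slope of a nonsingular geodesic $\gamma$ on $\mathbf N$ as it passes through the interior of a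 face. 1. $\gamma$ is closed if and only if $m=p/q$ for two odd integers $p$ and $q$. In that case, if $p$ and $q$ are moreover chosen relatively prime, the length of $\gamma$ is $6\sqrt{p^2+q^2}$. 2. $\gamma$ is drift-periodic if and only if $m=\infty$ or $m=p/q$ for two relatively prime integers $p$ and $q\neq0$, one of which is even. -/

import Mathlib

noncomputable section

namespace Necker

open Filter Topology

/-- Euclidean three-space, in which the surface lives. -/
abbrev E3 := EuclideanSpace ℝ (Fin 3)

/-- The Euclidean plane, in which pieces of the surface are unfolded. -/
abbrev E2 := EuclideanSpace ℝ (Fin 2)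

/-- The union of the three layers of integer points whose coordinate sum is `-1`, `0` or `1`. -/
def layers : Set (Fin 3 → ℤ) :=
  {n | n 0 + n 1 + n 2 = -1 ∨ n 0 + n 1 + n 2 = 0 ∨ n 0 + n 1 + n 2 = 1}

/-- A unit square in three-space with integer vertices. It is parallel to the plane of the
coordinate axes `axis` and `axis + 1` (indices mod 3, so the three possible planes are those of
the coordinates `(0,1)`, `(1,2)`, `(2,0)`), and `corner` is its vertex with smallest
coordinates. -/
structure UnitSquare where
  corner : Fin 3 → ℤ
  axis : Fin 3

namespace UnitSquare

/-- The four vertices. -/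
def vertices (S : UnitSquare) : Set (Fin 3 → ℤ) :=
  {S.corner,
   S.corner + Pi.single S.axis 1,
   S.corner + Pi.single (S.axis + 1) 1,
   S.corner + Pi.single S.axis 1 + Pi.single (S.axis + 1) 1}

/-- The closed square as a set of points. -/
def carrier (S : UnitSquare) : Set E3 :=
  {p | p S.axis ∈ Set.Icc (S.corner S.axis : ℝ) (S.corner S.axis + 1) ∧
    p (S.axis + 1) ∈ Set.Icc (S.corner (S.axis + 1) : ℝ) (S.corner (S.axis + 1) + 1) ∧
    p (S.axis + 2) = S.corner (S.axis + 2)}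

/-- The interior of the square, relative to its plane. -/
def inside (S : UnitSquare) : Set E3 :=
  {p | p S.axis ∈ Set.Ioo (S.corner S.axis : ℝ) (S.corner S.axis + 1) ∧
    p (S.axis + 1) ∈ Set.Ioo (S.corner (S.axis + 1) : ℝ) (S.corner (S.axis + 1) + 1) ∧
    p (S.axis + 2) = S.corner (S.axis + 2)}

/-- The constituent squares of the surface, also called its faces: the unit squares all of whose
vertices lie in the three layers. -/
def IsConstituent (S : UnitSquare) : Prop :=
  S.vertices ⊆ layers

end UnitSquare

/-- The Necker cube surface: the union of all constituent squares. -/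
def surface : Set E3 :=
  {p | ∃ S : UnitSquare, S.IsConstituent ∧ p ∈ S.carrier}

/-- The cone singularities of the surface: the vertices of the constituent squares, at each of
which three or six squares meet. -/
def singularities : Set E3 :=
  {p | ∃ S : UnitSquare, S.IsConstituent ∧ ∃ n ∈ S.vertices, ∀ i, p i = (n i : ℝ)}

/-- The union of the constituent squares that contain `p`: one square if `p` is interior to a
face, two squares if `p` is interior to an edge. -/
def star (p : E3) : Set E3 :=
  {x | ∃ S : UnitSquare, S.IsConstituent ∧ p ∈ S.carrier ∧ x ∈ S.carrier}

/-- `φ` unfolds the squares around `p` into the plane: it is isometric on each constituent square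
containing `p` and does not overlap the images of different squares. Near a nonsingular point `p`
these maps are exactly the (orientation-preserving or -reversing) flat charts of the surface;
the values of `φ` off `star p` play no role. -/
def IsUnfoldingAt (φ : E3 → E2) (p : E3) : Prop :=
  (∀ S : UnitSquare, S.IsConstituent → p ∈ S.carrier →
    ∀ x ∈ S.carrier, ∀ y ∈ S.carrier, dist (φ x) (φ y) = dist x y) ∧
  Set.InjOn φ (star p)

/-- A nonsingular geodesic, parametrized by arc length: a curve defined for all times that stays
on the surface, never meets a singularity, and moves with unit speed along a straight line in
the flat charts. (Continuity follows.) -/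
def IsNonsingularGeodesic (γ : ℝ → E3) : Prop :=
  ∀ s : ℝ, γ s ∈ surface ∧ γ s ∉ singularities ∧
    ∃ φ : E3 → E2, IsUnfoldingAt φ (γ s) ∧
      ∃ u : E2, ‖u‖ = 1 ∧
        ∀ᶠ t in 𝓝 s, γ t ∈ star (γ s) ∧ φ (γ t) = φ (γ s) + (t - s) • u

/-- Periodic (closed) curves. -/
def IsPeriodic (γ : ℝ → E3) : Prop :=
  ∃ l : ℝ, l ≠ 0 ∧ ∀ t, γ (l + t) = γ t

/-- Drift-periodic curves. -/
def IsDriftPeriodic (γ : ℝ → E3) : Prop :=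
  ∃ l : ℝ, l ≠ 0 ∧ ∃ x : E3, x ≠ 0 ∧ ∀ t, γ (l + t) = x + γ t

/-- The closed geodesic `γ`, parametrized by arc length, has length `L`: its least positive
period exists and equals `L`. -/
def HasLength (γ : ℝ → E3) (L : ℝ) : Prop :=
  IsLeast {l : ℝ | 0 < l ∧ ∀ t, γ (l + t) = γ t} L

/-- The slope `b / a` of the planar vector `(a, b)`, as an element of `ℝ ∪ {∞}`. -/
def planarSlope (a b : ℝ) : OnePoint ℝ :=
  open Classical in if a = 0 then OnePoint.infty else ((b / a : ℝ) : OnePoint ℝ)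

/-- At time `t`, the curve `γ` passes through the interior of a face with slope `m`. With
velocity `(x, y, z)` the slope is `y / x`, `z / y` or `x / z` when the face is parallel to the
plane of the first two, of the last two, or of the last and the first coordinate. -/
def HasSlopeAt (γ : ℝ → E3) (t : ℝ) (m : OnePoint ℝ) : Prop :=
  ∃ S : UnitSquare, S.IsConstituent ∧ γ t ∈ S.inside ∧
    ∃ v : E3, HasDerivAt γ v t ∧ m = planarSlope (v S.axis) (v (S.axis + 1))

end Necker

end

/-!
The surface is tiled by unit squares, so a geodesic unfolds to a line in the plane with its square
tiling, avoiding the lattice points. The unfolding is recorded by a state: the face met at a given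
time and the frame, one of twelve, in which the unfolded directions appear on it. Crossing a
vertical or a horizontal grid line changes the state by one of two permutations, `crossA` and
`crossB`, which commute with all translations and with a symmetry of order six of the surface
(`exists_itinerary`). After a normalization by quarter turns the direction `(u₁, u₂)` of the line lies
in the first quadrant; the slope is then `u₂ / u₁` or `-u₁ / u₂` (`exists_development`).

A geodesic that is invariant under a time shift up to a translation has, with the velocity, the
same frame at corresponding times. Since the frame changes at crossings only, and differently for
the two kinds of crossings, the shift maps grid points of the line to grid points of the same kind,
and the direction is rational (`exists_int_of_translate`).

Conversely, suppose that the direction is proportional to a primitive vector `(q, p)`. Shearing the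
tiling according to the Euclidean algorithm changes the pair `(x, y)` of permutations into
`(x, y * x)` or `(x * y, y)`, until the line runs along one row of tiles and the itinerary consists
of powers of a single permutation `w` (`Itinerary.exists_monodromy`). On frames the crossings
generate a dihedral group, which shows what `w` does there. If `q` and `p` are both odd, it is a
rotation by two of the twelve steps, so that `w` is, up to translations, the symmetry of order six:
`w ^ 6 = 1` and no smaller power fixes a frame. This gives closed geodesics of length six times that
of `(q, p)`. Otherwise `w` acts on frames as a reflection, `w ^ 2` is a translation on each kind of
frame, and it remains to see that `w ^ 2 ≠ 1`. The moves above do not change the commutator of the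
pair, which describes the unfolding around a vertex; an involution `w` would conjugate this
commutator to its inverse while exchanging the two kinds of vertices, which are distinguished by a
linear functional modulo three (`sq_ne_one_of_conj`). So the geodesic drifts, and in particular it
is unbounded and not closed.
-/

namespace Necker

open Filter Topology

local notation "⟪" x ", " y "⟫" => inner ℝ x y

/-! ### Faces with frames, and the crossings of edges -/

theorem perm_apply_inv {α : Type*} (g : Equiv.Perm α) (a : α) : g (g⁻¹ a) = a :=
  g.apply_symm_apply a

theorem perm_inv_apply {α : Type*} (g : Equiv.Perm α) (a : α) : g⁻¹ (g a) = a :=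
  g.symm_apply_apply a

/-- First vector of the `j`-th frame. The twelve indices encode a coordinate plane together with one
of the four quarter turns of a planar frame: modulo `3`, the index `j` is the axis of the plane
(in the numbering of `UnitSquare`), and modulo `4` it is the number of quarter turns by which the
unfolding direction has been rotated. The pair `(frameA j, frameB j)` spells out, in space, the
two unit vectors of the plane into which the face has been unfolded. -/
def frameA (j : ZMod 12) : Fin 3 → ℤ :=
  (![![1, 0, 0], ![0, 0, -1], ![0, 0, -1], ![0, 1, 0], ![0, 1, 0], ![-1, 0, 0],
    ![-1, 0, 0], ![0, 0, 1], ![0, 0, 1], ![0, -1, 0], ![0, -1, 0], ![1, 0, 0]] :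
    Fin 12 → Fin 3 → ℤ) j

/-- Second vector of the `j`-th frame; see `frameA`. -/
def frameB (j : ZMod 12) : Fin 3 → ℤ :=
  (![![0, 1, 0], ![0, 1, 0], ![-1, 0, 0], ![-1, 0, 0], ![0, 0, 1], ![0, 0, 1],
    ![0, -1, 0], ![0, -1, 0], ![1, 0, 0], ![1, 0, 0], ![0, 0, -1], ![0, 0, -1]] :
    Fin 12 → Fin 3 → ℤ) j

/-- The sign `(-1) ^ j`, with values in `ZMod 12`. -/
def altSign (j : ZMod 12) : ZMod 12 := if j.val % 2 = 0 then 1 else -1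

/-- A face of the surface together with a frame in it. The first component is twice the centre of
the face, so that it is integral; the second is the index of the frame. Only the pairs satisfying
`IsFace` below come from a face, but the crossings act on all pairs. -/
abbrev State := (Fin 3 → ℤ) × ZMod 12

theorem altSign_add_altSign_mul (j d : ZMod 12) :
    altSign (j + altSign j * d) = altSign j * altSign d := by
  revert j d; decide

theorem frameA_sub (j : ZMod 12) : frameA (j + altSign j * -1) = frameA j := by
  revert j; decide

theorem frameB_add (j : ZMod 12) : frameB (j + altSign j * 1) = frameB j := by
  revert j; decide

/-- Crossing the edge towards which the vector `frameA` of the unfolded face points. Folding along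
an edge keeps `frameB`, the direction of the edge, and turns the index by one step, up or down
according to its parity. -/
def crossA : Equiv.Perm State where
  toFun σ := (σ.1 + frameA σ.2 + frameA (σ.2 + altSign σ.2 * 1), σ.2 + altSign σ.2 * 1)
  invFun σ := (σ.1 - frameA σ.2 - frameA (σ.2 + altSign σ.2 * 1), σ.2 + altSign σ.2 * 1)
  left_inv σ := by
    have h : σ.2 + altSign σ.2 * 1 + altSign (σ.2 + altSign σ.2 * 1) * 1 = σ.2 := by
      generalize σ.2 = j; revert j; decide
    ext1
    · simp only [h]; abel
    · simp only [h]
  right_inv σ := by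
    have h : σ.2 + altSign σ.2 * 1 + altSign (σ.2 + altSign σ.2 * 1) * 1 = σ.2 := by
      generalize σ.2 = j; revert j; decide
    ext1
    · simp only [h]; abel
    · simp only [h]

/-- Crossing the edge towards which the vector `frameB` of the unfolded face points. The index
turns by one step, in the direction opposite to that of `crossA`. -/
def crossB : Equiv.Perm State where
  toFun σ := (σ.1 + frameB σ.2 + frameB (σ.2 + altSign σ.2 * -1), σ.2 + altSign σ.2 * -1)
  invFun σ := (σ.1 - frameB σ.2 - frameB (σ.2 + altSign σ.2 * -1), σ.2 + altSign σ.2 * -1)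
  left_inv σ := by
    have h : σ.2 + altSign σ.2 * -1 + altSign (σ.2 + altSign σ.2 * -1) * -1 = σ.2 := by
      generalize σ.2 = j; revert j; decide
    ext1
    · simp only [h]; abel
    · simp only [h]
  right_inv σ := by
    have h : σ.2 + altSign σ.2 * -1 + altSign (σ.2 + altSign σ.2 * -1) * -1 = σ.2 := by
      generalize σ.2 = j; revert j; decide
    ext1
    · simp only [h]; abel
    · simp only [h]

theorem crossA_apply (σ : State) : crossA σ =
    (σ.1 + frameA σ.2 + frameA (σ.2 + altSign σ.2 * 1), σ.2 + altSign σ.2 * 1) := rfl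

theorem crossB_apply (σ : State) : crossB σ =
    (σ.1 + frameB σ.2 + frameB (σ.2 + altSign σ.2 * -1), σ.2 + altSign σ.2 * -1) := rfl

/-! ### Symmetries of the set of states -/

/-- The symmetry `x ↦ (-x₁, -x₂, -x₀)` of order six of the surface. -/
def turn (n : Fin 3 → ℤ) : Fin 3 → ℤ := ![-n 1, -n 2, -n 0]

theorem turn_add (m n : Fin 3 → ℤ) : turn (m + n) = turn m + turn n := by
  ext i; fin_cases i <;> simp [turn] <;> ring

theorem turn_frameA (j : ZMod 12) : turn (frameA j) = frameA (j + 2) := by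
  revert j; decide

theorem turn_frameB (j : ZMod 12) : turn (frameB j) = frameB (j + 2) := by
  revert j; decide

/-- Translation of the doubled centre by `d`, hence of the face by `d / 2`. -/
def translate (d : Fin 3 → ℤ) : Equiv.Perm State where
  toFun σ := (d + σ.1, σ.2)
  invFun σ := (-d + σ.1, σ.2)
  left_inv σ := by ext1 <;> simp
  right_inv σ := by ext1 <;> simp

/-- The action of `turn` on faces with frames. -/
def rotate : Equiv.Perm State where
  toFun σ := (turn σ.1, σ.2 + 2)
  invFun σ := (![-σ.1 2, -σ.1 0, -σ.1 1], σ.2 - 2)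
  left_inv σ := by
    ext i
    · fin_cases i <;> simp [turn]
    · simp
  right_inv σ := by
    ext i
    · fin_cases i <;> simp [turn]
    · simp

theorem translate_apply (d : Fin 3 → ℤ) (σ : State) : translate d σ = (d + σ.1, σ.2) := rfl

theorem rotate_apply (σ : State) : rotate σ = (turn σ.1, σ.2 + 2) := rfl

/-- `g` moves even indices by `δ` and odd indices by `-δ`. -/
def HasTwist (g : Equiv.Perm State) (δ : ZMod 12) : Prop :=
  ∀ σ : State, (g σ).2 = σ.2 + altSign σ.2 * δ

theorem HasTwist.mul {g h : Equiv.Perm State} {a b : ZMod 12} (hg : HasTwist g a)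
    (hh : HasTwist h b) : HasTwist (g * h) (b + altSign b * a) := by
  intro σ
  rw [Equiv.Perm.mul_apply, hg, hh, altSign_add_altSign_mul]
  ring

theorem HasTwist.inv {g : Equiv.Perm State} {a : ZMod 12} (hg : HasTwist g a) :
    HasTwist g⁻¹ (-(altSign a * a)) := by
  intro σ
  have h := hg (g⁻¹ σ)
  rw [perm_apply_inv] at h
  rw [h]
  generalize (g⁻¹ σ).2 = j
  clear hg h
  revert j a
  decide

/-- The permutations of states that commute with the translations and with `rotate`, preserve the
sum of the coordinates, and have a twist. All words in the two crossings are of this kind. -/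
def symmetric : Subgroup (Equiv.Perm State) where
  carrier := {g | (∀ d σ, g (translate d σ) = translate d (g σ)) ∧
    (∀ σ, g (rotate σ) = rotate (g σ)) ∧ (∀ σ, ∑ i, (g σ).1 i = ∑ i, σ.1 i) ∧
    ∃ δ, HasTwist g δ}
  mul_mem' := by
    rintro g h ⟨g1, g2, g3, a, g4⟩ ⟨h1, h2, h3, b, h4⟩
    refine ⟨fun d σ => ?_, fun σ => ?_, fun σ => ?_, _, g4.mul h4⟩
    · simp only [Equiv.Perm.mul_apply, h1, g1]
    · simp only [Equiv.Perm.mul_apply, h2, g2]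
    · simp only [Equiv.Perm.mul_apply, h3, g3]
  one_mem' := ⟨fun _ _ => rfl, fun _ => rfl, fun _ => rfl, 0, fun σ => by simp⟩
  inv_mem' := by
    rintro g ⟨g1, g2, g3, a, g4⟩
    refine ⟨fun d σ => ?_, fun σ => ?_, fun σ => ?_, _, g4.inv⟩
    · rw [Equiv.Perm.inv_eq_iff_eq, g1, perm_apply_inv]
    · rw [Equiv.Perm.inv_eq_iff_eq, g2, perm_apply_inv]
    · rw [← g3, perm_apply_inv]

theorem hasTwist_crossA : HasTwist crossA 1 := fun _ => rfl

theorem hasTwist_crossB : HasTwist crossB (-1) := fun _ => rfl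

theorem crossA_mem : crossA ∈ symmetric := by
  refine ⟨fun d σ => ?_, fun σ => ?_, fun σ => ?_, _, hasTwist_crossA⟩
  · simp only [crossA_apply, translate_apply, add_assoc]
  · have h : σ.2 + 2 + altSign (σ.2 + 2) * 1 = σ.2 + altSign σ.2 * 1 + 2 := by
      generalize σ.2 = j; revert j; decide
    simp only [crossA_apply, rotate_apply, h, turn_add, turn_frameA]
  · have h : ∀ j : ZMod 12, ∑ i, (frameA j + frameA (j + altSign j * 1)) i = 0 := by decide
    have := h σ.2
    simp only [crossA_apply, Pi.add_apply, Finset.sum_add_distrib] at this ⊢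
    linarith

theorem crossB_mem : crossB ∈ symmetric := by
  refine ⟨fun d σ => ?_, fun σ => ?_, fun σ => ?_, _, hasTwist_crossB⟩
  · simp only [crossB_apply, translate_apply, add_assoc]
  · have h : σ.2 + 2 + altSign (σ.2 + 2) * -1 = σ.2 + altSign σ.2 * -1 + 2 := by
      generalize σ.2 = j; revert j; decide
    simp only [crossB_apply, rotate_apply, h, turn_add, turn_frameB]
  · have h : ∀ j : ZMod 12, ∑ i, (frameB j + frameB (j + altSign j * -1)) i = 0 := by decide
    have := h σ.2
    simp only [crossB_apply, Pi.add_apply, Finset.sum_add_distrib] at this ⊢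
    linarith

/-! ### Generating pairs -/

/-- The twist `d` is odd: permutations with this twist exchange even and odd indices. -/
def IsOdd (d : ZMod 12) : Prop := altSign d = -1

instance : DecidablePred IsOdd := fun d => inferInstanceAs (Decidable (altSign d = -1))

/-- The pairs of twists that pairs of generators of the group of crossings can have. On indices this
group is an infinite dihedral group (modulo `12`), in which two elements generate only if they are
a reflection and a rotation by `±2`, or two reflections whose product is such a rotation. -/
def TwistPair (a b : ZMod 12) : Prop :=
  (¬ IsOdd a → (a = 2 ∨ a = -2) ∧ IsOdd b) ∧ (¬ IsOdd b → (b = 2 ∨ b = -2) ∧ IsOdd a) ∧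
    (IsOdd a → IsOdd b → a - b = 2 ∨ a - b = -2)

instance : DecidableRel TwistPair := fun a b => by unfold TwistPair; infer_instance

/-- The properties that `(crossA, crossB)` shares with every pair obtained from it by the moves
`(x, y) ↦ (x, y * x)` and `(x, y) ↦ (x * y, y)`. The commutator is not changed at all by these
moves. -/
structure GeneratingPair (x y : Equiv.Perm State) : Prop where
  left_mem : x ∈ symmetric
  right_mem : y ∈ symmetric
  twist : ∃ a b, HasTwist x a ∧ HasTwist y b ∧ TwistPair a b
  comm : x * y * x⁻¹ * y⁻¹ = crossA * crossB * crossA⁻¹ * crossB⁻¹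

theorem generatingPair_cross : GeneratingPair crossA crossB :=
  ⟨crossA_mem, crossB_mem, ⟨1, -1, hasTwist_crossA, hasTwist_crossB, by decide⟩, rfl⟩

theorem TwistPair.right {a b : ZMod 12} (h : TwistPair a b) : TwistPair a (a + altSign a * b) := by
  revert a b; decide

theorem TwistPair.left {a b : ZMod 12} (h : TwistPair a b) : TwistPair (b + altSign b * a) b := by
  revert a b; decide

theorem GeneratingPair.mul_right {x y : Equiv.Perm State} (h : GeneratingPair x y) :
    GeneratingPair x (y * x) := by
  obtain ⟨a, b, ha, hb, hab⟩ := h.twist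
  refine ⟨h.left_mem, mul_mem h.right_mem h.left_mem, ⟨a, _, ha, hb.mul ha, hab.right⟩, ?_⟩
  rw [← h.comm]; group

theorem GeneratingPair.mul_left {x y : Equiv.Perm State} (h : GeneratingPair x y) :
    GeneratingPair (x * y) y := by
  obtain ⟨a, b, ha, hb, hab⟩ := h.twist
  refine ⟨mul_mem h.left_mem h.right_mem, h.right_mem, ⟨_, b, ha.mul hb, hb, hab.left⟩, ?_⟩
  rw [← h.comm]; group

theorem eq_translate (σ : State) : σ = translate σ.1 (0, σ.2) := by
  ext1 <;> simp [translate_apply]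

theorem translate_rotate_pow_six (d : Fin 3 → ℤ) : (translate d * rotate) ^ 6 = 1 := by
  have h12 : (12 : ZMod 12) = 0 := rfl
  ext σ i
  · simp only [pow_succ, pow_zero, one_mul, Equiv.Perm.mul_apply, translate_apply, rotate_apply,
      Equiv.Perm.one_apply]
    fin_cases i <;> simp [turn] <;> ring
  · simp only [pow_succ, pow_zero, one_mul, Equiv.Perm.mul_apply, translate_apply, rotate_apply,
      Equiv.Perm.one_apply]
    have : σ.2 + 2 + 2 + 2 + 2 + 2 + 2 = σ.2 := by
      calc _ = σ.2 + 12 := by ring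
        _ = _ := by rw [h12, add_zero]
    rw [this]

theorem altSign_eq (j : ZMod 12) : altSign j = 1 ∨ altSign j = -1 := by
  revert j; decide

/-- On the states `(n, j)` with `j` fixed, `h` agrees with `translate d * rotate ^ (±1)` up to
translation, and the latter has order six because the six rotations of `d` cancel. -/
theorem pow_six_apply {h : Equiv.Perm State} (hh : h ∈ symmetric) {δ : ZMod 12}
    (ht : HasTwist h δ) (hδ : δ = 2 ∨ δ = -2) (σ : State) : (h ^ 6) σ = σ := by
  obtain ⟨h1, h2, -, -⟩ := hh
  -- it suffices to find `M` of order six that commutes with `h` and agrees with it at `(0, j)`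
  have key : ∀ M : Equiv.Perm State, (∀ τ, h (M τ) = M (h τ)) → M ^ 6 = 1 →
      h (0, σ.2) = M (0, σ.2) → (h ^ 6) σ = σ := by
    intro M hM hM6 h0
    have hk : ∀ k : ℕ, (h ^ k) (0, σ.2) = (M ^ k) (0, σ.2) := by
      have hMk : ∀ (k : ℕ) τ, h ((M ^ k) τ) = (M ^ k) (h τ) := by
        intro k
        induction k with
        | zero => intro τ; simp
        | succ k ih => intro τ; rw [pow_succ', Equiv.Perm.mul_apply, hM, ih, Equiv.Perm.mul_apply]
      intro k
      induction k with
      | zero => simp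
      | succ k ih =>
        rw [pow_succ', Equiv.Perm.mul_apply, ih, hMk, h0, pow_succ, Equiv.Perm.mul_apply]
    have hT : ∀ (k : ℕ) d τ, (h ^ k) (translate d τ) = translate d ((h ^ k) τ) := by
      intro k
      induction k with
      | zero => intro d τ; simp
      | succ k ih => intro d τ; rw [pow_succ, Equiv.Perm.mul_apply, h1, ih, Equiv.Perm.mul_apply]
    rw [eq_translate σ, hT]
    simp only [hk, translate_apply, hM6]
    simp
  have hd : altSign σ.2 * δ = 2 ∨ altSign σ.2 * δ = -2 := by
    rcases altSign_eq σ.2 with e | e <;> rcases hδ with e' | e' <;> rw [e, e'] <;> decide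
  rcases hd with hd | hd
  · refine key (translate (h (0, σ.2)).1 * rotate) (fun τ => ?_) (translate_rotate_pow_six _) ?_
    · simp only [Equiv.Perm.mul_apply, h1, h2]
    · ext i
      · have : turn 0 = 0 := by decide
        simp [translate_apply, rotate_apply, this]
      · rw [ht (0, σ.2), hd]; rfl
  · set d := (h (0, σ.2)).1 with hdd
    have hr : ∀ τ, h (rotate⁻¹ τ) = rotate⁻¹ (h τ) := fun τ => by
      rw [Equiv.Perm.eq_inv_iff_eq, ← h2, perm_apply_inv]
    refine key (translate d * rotate⁻¹) (fun τ => ?_) ?_ ?_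
    · simp only [Equiv.Perm.mul_apply, h1, hr]
    · have e : translate d * rotate⁻¹ = (translate (turn (-d)) * rotate)⁻¹ := by
        rw [eq_inv_iff_mul_eq_one]
        ext τ i
        · simp only [Equiv.Perm.mul_apply, translate_apply, rotate_apply, ← turn_add]
          have : (turn (-d + τ.1), τ.2 + 2) = rotate (-d + τ.1, τ.2) := rfl
          rw [this, perm_inv_apply]
          simp
        · simp only [Equiv.Perm.mul_apply, translate_apply, rotate_apply, ← turn_add]
          have : (turn (-d + τ.1), τ.2 + 2) = rotate (-d + τ.1, τ.2) := rfl
          rw [this, perm_inv_apply]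
          simp
      rw [e, inv_pow, translate_rotate_pow_six, inv_one]
    · ext i
      · have : rotate⁻¹ (0, σ.2) = (0, σ.2 - 2) := by
          rw [Equiv.Perm.inv_eq_iff_eq]
          have : turn 0 = 0 := by decide
          simp [rotate_apply, this]
        simp [Equiv.Perm.mul_apply, translate_apply, this, hdd]
      · rw [ht (0, σ.2), hd]
        have : rotate⁻¹ (0, σ.2) = (0, σ.2 - 2) := by
          rw [Equiv.Perm.inv_eq_iff_eq]
          have : turn 0 = 0 := by decide
          simp [rotate_apply, this]
        simp [Equiv.Perm.mul_apply, translate_apply, this, sub_eq_add_neg]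

theorem HasTwist.pow_apply {h : Equiv.Perm State} {δ : ZMod 12} (ht : HasTwist h δ)
    (hδ : δ = 2 ∨ δ = -2) (σ : State) (k : ℕ) :
    ((h ^ k) σ).2 = σ.2 + altSign σ.2 * ((k : ZMod 12) * δ) := by
  have hs : ∀ j : ZMod 12, altSign (j + altSign σ.2 * δ) = altSign j := by
    have : ∀ i j d : ZMod 12, d = 2 ∨ d = -2 → altSign (j + altSign i * d) = altSign j := by
      intro i j d hd
      rcases altSign_eq i with e | e <;> rcases hd with rfl | rfl <;> rw [e] <;> revert j <;> decide
    intro j; exact this _ _ _ hδ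
  have : ((h ^ k) σ).2 = σ.2 + altSign σ.2 * ((k : ZMod 12) * δ) ∧
      altSign ((h ^ k) σ).2 = altSign σ.2 := by
    induction k with
    | zero => simp
    | succ k ih =>
      rw [pow_succ', Equiv.Perm.mul_apply, ht, ih.2, hs, ih.2, ih.1]
      refine ⟨?_, rfl⟩
      push_cast; ring
  exact this.1

theorem six_dvd_of_pow_apply_eq {h : Equiv.Perm State} {δ : ZMod 12} (ht : HasTwist h δ)
    (hδ : δ = 2 ∨ δ = -2) (σ : State) (k : ℕ) (hk : (h ^ k) σ = σ) : 6 ∣ k := by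
  have h1 := ht.pow_apply hδ σ k
  rw [hk] at h1
  have h2 : ((2 * k : ℕ) : ZMod 12) = 0 := by
    have h3 : altSign σ.2 * ((k : ZMod 12) * δ) = 0 := by simpa using h1.symm
    push_cast
    rcases altSign_eq σ.2 with e | e <;> rcases hδ with rfl | rfl <;> rw [e] at h3
    · linear_combination h3
    · linear_combination -h3
    · linear_combination -h3
    · linear_combination h3
  rw [ZMod.natCast_eq_zero_iff] at h2
  omega

/-! ### Reflections have nontrivial squares -/

/-- The effect of unfolding once around a lattice point of the plane. -/
def vertexLoop : Equiv.Perm State := crossA * crossB * crossA⁻¹ * crossB⁻¹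

theorem vertexLoop_mem : vertexLoop ∈ symmetric :=
  mul_mem (mul_mem (mul_mem crossA_mem crossB_mem) (inv_mem crossA_mem)) (inv_mem crossB_mem)

/-- The functional `n ↦ n₁ + 2 n₂` modulo `3` distinguishes the two kinds of vertices of the surface:
a loop that starts at an odd index does not change it, one that starts at `(0, 0)` does. -/
theorem vertexLoop_odd : ∀ j : ZMod 12, IsOdd j →
    ((vertexLoop (0, j)).1 1 + 2 * (vertexLoop (0, j)).1 2) % 3 = 0 ∧
      (vertexLoop (0, j)).2 = j + 4 := by
  decide

theorem vertexLoop_inv_zero :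
    ((vertexLoop⁻¹ (0, 0)).1 1 + 2 * (vertexLoop⁻¹ (0, 0)).1 2) % 3 ≠ 0 := by
  decide

/-- An involution that exchanges even and odd indices and inverts `vertexLoop` by conjugation would
carry the loops at odd indices to those at even indices, although only the former are trivial
modulo the kernel of the functional of `vertexLoop_odd`. -/
theorem sq_ne_one_of_conj {w : Equiv.Perm State} (hw : w ∈ symmetric) {a : ZMod 12}
    (ha : HasTwist w a) (hodd : IsOdd a) (hc : w * vertexLoop * w⁻¹ = vertexLoop⁻¹) :
    w * w ≠ 1 := by
  intro h2
  have hinv : w⁻¹ = w := inv_eq_of_mul_eq_one_left h2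
  have hww : ∀ τ, w (w τ) = τ := fun τ => by rw [← Equiv.Perm.mul_apply, h2]; rfl
  obtain ⟨w1, w2, w3, -⟩ := hw
  obtain ⟨c1, -, -, -⟩ := vertexLoop_mem
  set e := (w (0, 0)).1 with he
  have hs : ∑ i, e i = 0 := by rw [he, w3]; simp
  have hws : w (0, 0) = (e, a) := by
    ext1
    · rfl
    · rw [ha]
      have : altSign 0 = 1 := by decide
      simp [this]
  obtain ⟨hd, hj⟩ := vertexLoop_odd a hodd
  set d := (vertexLoop (0, a)).1 with hdd
  have h3 : vertexLoop (e, a) =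
      translate (e + d) (rotate (rotate (translate (-e) (w (0, 0))))) := by
    rw [eq_translate (e, a), c1, hws]
    have h0 : turn (turn 0) = 0 := by decide
    have h4 : a + 2 + 2 = a + 4 := by ring
    simp [translate_apply, rotate_apply, ← hdd, hj, h0, h4]
  have h4 : (vertexLoop⁻¹ (0, 0)).1 = e + d + turn (turn (-e)) := by
    rw [← hc, Equiv.Perm.mul_apply, Equiv.Perm.mul_apply, hinv, hws, h3, w1, w2, w2, w1, hww]
    simp [translate_apply, rotate_apply]
  have h5 := vertexLoop_inv_zero
  rw [h4] at h5
  simp only [turn, Pi.add_apply, Pi.neg_apply, Fin.sum_univ_three] at h5 hs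
  simp at h5
  omega

/-- `w` is one of the two elements of a generating pair. -/
def IsPrimitive (w : Equiv.Perm State) : Prop := ∃ y, GeneratingPair w y ∨ GeneratingPair y w

theorem IsPrimitive.mem {w : Equiv.Perm State} (hw : IsPrimitive w) : w ∈ symmetric := by
  obtain ⟨y, h | h⟩ := hw
  exacts [h.left_mem, h.right_mem]

/-- If `w` is an involution, then it conjugates the commutator of the pair, which is `vertexLoop`, to
its inverse. -/
theorem IsPrimitive.sq_ne_one {w : Equiv.Perm State} (hw : IsPrimitive w) {a : ZMod 12}
    (ha : HasTwist w a) (hodd : IsOdd a) : w * w ≠ 1 := by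
  intro h2
  have hinv : w⁻¹ = w := inv_eq_of_mul_eq_one_left h2
  refine sq_ne_one_of_conj hw.mem ha hodd ?_ h2
  obtain ⟨y, h | h⟩ := hw
  · rw [vertexLoop, ← h.comm]
    simp only [mul_inv_rev, inv_inv, hinv, ← mul_assoc, h2, one_mul]
  · rw [vertexLoop, ← h.comm]
    simp only [mul_inv_rev, inv_inv, hinv, mul_assoc, h2, mul_one]

theorem HasTwist.unique {w : Equiv.Perm State} {a b : ZMod 12} (ha : HasTwist w a)
    (hb : HasTwist w b) : a = b := by
  have h := (ha (0, 0)).symm.trans (hb (0, 0))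
  have : altSign 0 = 1 := by decide
  simpa [this] using h

theorem IsPrimitive.even_twist {w : Equiv.Perm State} (hw : IsPrimitive w) {a : ZMod 12}
    (ha : HasTwist w a) (heven : ¬ IsOdd a) : a = 2 ∨ a = -2 := by
  obtain ⟨y, h | h⟩ := hw <;> obtain ⟨b, c, hb, hc, hbc⟩ := h.twist
  · obtain rfl := ha.unique hb
    exact (hbc.1 heven).1
  · obtain rfl := ha.unique hc
    exact (hbc.2.1 heven).1

/-- `h` is conjugate to a primitive element of twist `a`, by a symmetric permutation. -/
def IsMonodromy (h : Equiv.Perm State) (a : ZMod 12) : Prop :=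
  ∃ w g, IsPrimitive w ∧ HasTwist w a ∧ g ∈ symmetric ∧ h = g⁻¹ * w * g

theorem IsMonodromy.conj {h : Equiv.Perm State} {a : ZMod 12} (hh : IsMonodromy h a)
    {k : Equiv.Perm State} (hk : k ∈ symmetric) : IsMonodromy (k⁻¹ * h * k) a := by
  obtain ⟨w, g, hw, ha, hg, rfl⟩ := hh
  exact ⟨w, g * k, hw, ha, mul_mem hg hk, by group⟩

theorem IsMonodromy.mem {h : Equiv.Perm State} {a : ZMod 12} (hh : IsMonodromy h a) :
    h ∈ symmetric := by
  obtain ⟨w, g, hw, ha, hg, rfl⟩ := hh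
  exact mul_mem (mul_mem (inv_mem hg) hw.mem) hg

theorem IsMonodromy.hasTwist {h : Equiv.Perm State} {a : ZMod 12} (hh : IsMonodromy h a)
    (heven : ¬ IsOdd a) : ∃ δ, (δ = 2 ∨ δ = -2) ∧ HasTwist h δ := by
  obtain ⟨w, g, hw, ha, hg, rfl⟩ := hh
  obtain ⟨b, hb⟩ := hg.2.2.2
  refine ⟨_, ?_, (hb.inv.mul ha).mul hb⟩
  have := hw.even_twist ha heven
  clear ha hb
  revert a b
  decide

theorem IsMonodromy.pow_six {h : Equiv.Perm State} {a : ZMod 12} (hh : IsMonodromy h a)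
    (heven : ¬ IsOdd a) (σ : State) : (h ^ 6) σ = σ := by
  obtain ⟨δ, hδ, ht⟩ := hh.hasTwist heven
  exact pow_six_apply hh.mem ht hδ σ

theorem IsMonodromy.six_dvd {h : Equiv.Perm State} {a : ZMod 12} (hh : IsMonodromy h a)
    (heven : ¬ IsOdd a) (σ : State) (k : ℕ) (hk : (h ^ k) σ = σ) : 6 ∣ k := by
  obtain ⟨δ, hδ, ht⟩ := hh.hasTwist heven
  exact six_dvd_of_pow_apply_eq ht hδ σ k hk

theorem eq_one_of_apply_eq {g : Equiv.Perm State} (hg : g ∈ symmetric) {σ τ : State}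
    (hσ : g σ = σ) (hτ : g τ = τ) (hne : altSign σ.2 ≠ altSign τ.2) : g = 1 := by
  obtain ⟨g1, g2, -, -⟩ := hg
  have hfix : ∀ υ υ' : State, g υ = υ → altSign υ.2 = altSign υ'.2 → g υ' = υ' := by
    intro υ υ' h0 h1
    have hr : ∀ k : ℕ, g ((rotate ^ k) υ) = (rotate ^ k) υ := by
      intro k
      induction k with
      | zero => simpa using h0
      | succ k ih => rw [pow_succ', Equiv.Perm.mul_apply, g2, ih]
    have hr2 : ∀ k : ℕ, ((rotate ^ k) υ).2 = υ.2 + 2 * k := by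
      intro k
      induction k with
      | zero => simp
      | succ k ih => rw [pow_succ', Equiv.Perm.mul_apply, rotate_apply, ih]; push_cast; ring
    have hex : ∀ j j' : ZMod 12, altSign j = altSign j' → ∃ k : Fin 6, j' = j + 2 * (k : ℕ) := by
      decide
    obtain ⟨k, hk⟩ := hex _ _ h1
    have e : υ' = translate (υ'.1 - ((rotate ^ (k : ℕ)) υ).1) ((rotate ^ (k : ℕ)) υ) := by
      ext1
      · simp [translate_apply]
      · rw [hk, translate_apply, hr2]
    rw [e, g1, hr]
  ext1 υ
  have : altSign σ.2 = altSign υ.2 ∨ altSign τ.2 = altSign υ.2 := by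
    revert hne
    generalize σ.2 = i, τ.2 = j, υ.2 = k
    rcases altSign_eq i with h1 | h1 <;> rcases altSign_eq j with h2 | h2 <;>
      rcases altSign_eq k with h3 | h3 <;> simp [h1, h2, h3]
  rcases this with h | h
  · exact hfix _ _ hσ h
  · exact hfix _ _ hτ h

theorem IsMonodromy.exists_translate {h : Equiv.Perm State} {a : ZMod 12} (hh : IsMonodromy h a)
    (hodd : IsOdd a) (σ : State) : ∃ d, d ≠ 0 ∧ (h ^ 2) σ = translate d σ := by
  obtain ⟨b, hb⟩ : ∃ b, HasTwist h b := hh.mem.2.2.2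
  have hbo : IsOdd b := by
    obtain ⟨w, g, hw, ha, hg, rfl⟩ := hh
    obtain ⟨c, hc⟩ := hg.2.2.2
    rw [hb.unique ((hc.inv.mul ha).mul hc)]
    clear ha hb hc
    revert a c
    decide
  have h2 : ((h ^ 2) σ).2 = σ.2 := by
    rw [pow_two, Equiv.Perm.mul_apply, hb, hb]
    generalize σ.2 = j
    clear hb
    revert j b
    decide
  refine ⟨((h ^ 2) σ).1 - σ.1, fun h0 => ?_, by ext1 <;> simp [translate_apply, h2]⟩
  have hσ : (h ^ 2) σ = σ := by
    ext1
    · exact sub_eq_zero.mp h0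
    · exact h2
  have hone : h ^ 2 = 1 := by
    refine eq_one_of_apply_eq (pow_mem hh.mem 2) hσ (τ := h σ) ?_ ?_
    · rw [← Equiv.Perm.mul_apply, ← pow_succ, pow_succ', Equiv.Perm.mul_apply, hσ]
    · rw [hb]
      generalize σ.2 = j
      clear hb h2
      revert j b
      decide
  obtain ⟨w, g, hw, ha, hg, rfl⟩ := hh
  refine hw.sq_ne_one ha hodd ?_
  have : g⁻¹ * (w * w) * g = 1 := by rw [← hone, pow_two]; group
  calc w * w = g * (g⁻¹ * (w * w) * g) * g⁻¹ := by group
    _ = 1 := by rw [this]; group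

/-! ### Itineraries of lines, and the Euclidean algorithm -/

/-- `s` records the tiles visited by the plane curve `(α, β)`: its value is multiplied by `x` when
`α` passes an integer and by `y` when `β` does. The curve avoids the lattice points, so that locally
at most one of the two exponents is nonzero and their order is immaterial. -/
structure Itinerary {S : Type*} (x y : Equiv.Perm S) (α β : ℝ → ℝ) (s : ℝ → S) : Prop where
  generic : ∀ t, ¬ ((∃ k : ℤ, α t = k) ∧ ∃ k : ℤ, β t = k)
  step : ∀ t₀, ∀ᶠ t in 𝓝 t₀,
    s t₀ = (x ^ (⌊α t₀⌋ - ⌊α t⌋)) ((y ^ (⌊β t₀⌋ - ⌊β t⌋)) (s t))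

variable {S : Type*} {x y : Equiv.Perm S} {α β : ℝ → ℝ} {s s' : ℝ → S}

/-- An itinerary is determined by its value at one time, because the times at which two itineraries
of the same curve agree form a clopen set. -/
theorem Itinerary.eq_of_eq (h : Itinerary x y α β s) (h' : Itinerary x y α β s') {t₁ : ℝ}
    (ht : s t₁ = s' t₁) : s = s' := by
  have key : ∀ t₀, ∀ᶠ t in 𝓝 t₀, (s t₀ = s' t₀ ↔ s t = s' t) := by
    intro t₀
    filter_upwards [h.step t₀, h'.step t₀] with t h1 h2
    rw [h1, h2]
    simp
  have hclopen : IsClopen {t | s t = s' t} := by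
    constructor
    · rw [← isOpen_compl_iff, isOpen_iff_mem_nhds]
      intro t₀ h0
      filter_upwards [key t₀] with t h1 h2
      exact h0 (h1.mpr h2)
    · rw [isOpen_iff_mem_nhds]
      intro t₀ h0
      filter_upwards [key t₀] with t h1
      exact h1.mp h0
  have := hclopen.eq_univ ⟨t₁, ht⟩
  ext1 t
  exact Set.eq_univ_iff_forall.mp this t

theorem eventually_floor_eq {f : ℝ → ℝ} (hf : Continuous f) {t₀ : ℝ}
    (h : ¬ ∃ k : ℤ, f t₀ = k) : ∀ᶠ t in 𝓝 t₀, ⌊f t⌋ = ⌊f t₀⌋ := by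
  have h1 : (⌊f t₀⌋ : ℝ) < f t₀ :=
    lt_of_le_of_ne (Int.floor_le _) fun h' => h ⟨_, h'.symm⟩
  have h2 := Int.lt_floor_add_one (f t₀)
  filter_upwards [hf.continuousAt.eventually (lt_mem_nhds h1),
    hf.continuousAt.eventually (gt_mem_nhds h2)] with t h3 h4
  rw [Int.floor_eq_iff]
  exact ⟨h3.le, h4⟩

theorem Itinerary.swap (h : Itinerary x y α β s) (hα : Continuous α) (hβ : Continuous β) :
    Itinerary y x β α s := by
  refine ⟨fun t ht => h.generic t ht.symm, fun t₀ => ?_⟩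
  by_cases hβ0 : ∃ k : ℤ, β t₀ = k
  · have hα0 : ¬ ∃ k : ℤ, α t₀ = k := fun h' => h.generic t₀ ⟨h', hβ0⟩
    filter_upwards [h.step t₀, eventually_floor_eq hα hα0] with t h1 h2
    rw [h1, h2]; simp
  · filter_upwards [h.step t₀, eventually_floor_eq hβ hβ0] with t h1 h2
    rw [h1, h2]; simp

/-- Replacing the square tiling by the tiling by the parallelograms spanned by `(1, 0)` and `(1, 1)`.
A sheared tile meets two square tiles; it is labelled by the left one, and crossing its upper edge
amounts to crossing first a vertical and then a horizontal edge of the squares. -/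
theorem Itinerary.shear (h : Itinerary x y α β s) (hα : Continuous α) (hβ : Continuous β) :
    Itinerary x (y * x) (fun t => α t - β t) β
      (fun t => (x ^ (⌊α t - β t⌋ + ⌊β t⌋ - ⌊α t⌋)) (s t)) := by
  refine ⟨?_, fun t₀ => ?_⟩
  · rintro t ⟨⟨k, hk⟩, ⟨l, hl⟩⟩
    refine h.generic t ⟨⟨k + l, ?_⟩, ⟨l, hl⟩⟩
    push_cast
    linarith
  · by_cases hβ0 : ∃ k : ℤ, β t₀ = k
    · have hα0 : ¬ ∃ k : ℤ, α t₀ = k := fun h' => h.generic t₀ ⟨h', hβ0⟩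
      obtain ⟨k, hk⟩ := hβ0
      have hγ0 : ¬ ∃ k : ℤ, α t₀ - β t₀ = k := by
        rintro ⟨l, hl⟩
        exact hα0 ⟨l + k, by push_cast; linarith⟩
      have hb : ∀ᶠ t in 𝓝 t₀, ⌊β t⌋ = k ∨ ⌊β t⌋ = k - 1 := by
        filter_upwards
          [hβ.continuousAt.eventually (lt_mem_nhds (show (k : ℝ) - 1 < β t₀ by linarith)),
          hβ.continuousAt.eventually (gt_mem_nhds (show β t₀ < (k : ℝ) + 1 by linarith))]
          with t h3 h4
        rcases lt_or_ge (β t) k with h5 | h5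
        · right; rw [Int.floor_eq_iff]; push_cast; constructor <;> linarith
        · left; rw [Int.floor_eq_iff]; exact ⟨h5, h4⟩
      filter_upwards [h.step t₀, eventually_floor_eq hα hα0,
        eventually_floor_eq (hα.sub hβ) hγ0, hb] with t h1 h2 h3 h4
      have e0 : ⌊β t₀⌋ = k := by rw [hk]; simp
      have e1 : ⌊α t₀ - β t₀⌋ = ⌊α t₀⌋ - k := by rw [hk]; simp
      have h3' : ⌊α t - β t⌋ = ⌊α t₀ - β t₀⌋ := h3
      simp only [h1, h2, h3', e0, e1]
      rcases h4 with h4 | h4 <;> simp [h4]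
    · have hb := eventually_floor_eq hβ hβ0
      filter_upwards [h.step t₀, hb] with t h1 h2
      simp only [h1, h2, sub_self, zpow_zero, Equiv.Perm.one_apply, ← Equiv.Perm.mul_apply,
        one_mul, ← zpow_add]
      congr 2
      ring

/-- A curve that stays in one row of tiles. -/
theorem Itinerary.const_right (h : Itinerary x y α β s) (hβ : ∀ t t', ⌊β t⌋ = ⌊β t'⌋)
    (t t₁ : ℝ) : s t = (x ^ (⌊α t⌋ - ⌊α t₁⌋)) (s t₁) := by
  have h' : Itinerary x y α β (fun t => (x ^ (⌊α t⌋ - ⌊α t₁⌋)) (s t₁)) := by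
    refine ⟨h.generic, fun t₀ => Eventually.of_forall fun t => ?_⟩
    rw [hβ t t₀, sub_self, zpow_zero, Equiv.Perm.one_apply, ← Equiv.Perm.mul_apply, ← zpow_add]
    congr 2
    ring
  exact congrFun (h.eq_of_eq h' (t₁ := t₁) (by simp)) t

theorem Itinerary.exists_monodromy_of_zero {x y : Equiv.Perm State} {s : ℝ → State} {a b l : ℝ}
    (hl : 0 < l)
    (h : Itinerary x y (fun t => a + l * t) (fun _ => b) s) (t : ℝ) (n : ℕ) :
    s (t + n / l) = (x ^ n) (s t) := by
  rw [h.const_right (fun _ _ => rfl) (t + n / l) t]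
  have : a + l * (t + n / l) = a + l * t + n := by field_simp; ring
  simp [this]

/-- Following a line of primitive integral direction `(q, p)` once through its period acts by a
monodromy. The Euclidean algorithm on `(q, p)` shears the tiling until the direction becomes
that of a coordinate axis, where the itinerary consists of powers of a single element. -/
theorem Itinerary.exists_monodromy (N : ℕ) : ∀ (q p : ℕ), q + p = N → Nat.Coprime q p →
    ∀ {x y : Equiv.Perm State} {s : ℝ → State} {a b l : ℝ}, 0 < l → GeneratingPair x y →
    ∀ (c d : ZMod 12), HasTwist x c → HasTwist y d →
    Itinerary x y (fun t => a + q * l * t) (fun t => b + p * l * t) s →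
    ∀ t, ∃ h e, IsMonodromy h e ∧ altSign e = altSign c ^ q * altSign d ^ p ∧
      ∀ n : ℕ, s (t + n / l) = (h ^ n) (s t) := by
  induction N using Nat.strong_induction_on with
  | _ N ih =>
  intro q p hN hqp x y s a b l hl hB c d hc hd h t
  have hcα : ∀ (a : ℝ) (q : ℕ), Continuous (fun t : ℝ => a + q * l * t) := fun a q => by fun_prop
  rcases Nat.eq_zero_or_pos p with rfl | hp
  · obtain rfl : q = 1 := by simpa using hqp
    refine ⟨x, c, ⟨x, 1, ⟨y, Or.inl hB⟩, hc, one_mem _, by simp⟩, by simp, fun n => ?_⟩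
    refine Itinerary.exists_monodromy_of_zero (y := y) (a := a) (b := b) hl ?_ t n
    simpa using h
  rcases Nat.eq_zero_or_pos q with rfl | hq
  · obtain rfl : p = 1 := by simpa using hqp
    refine ⟨y, d, ⟨y, 1, ⟨x, Or.inr hB⟩, hd, one_mem _, by simp⟩, by simp, fun n => ?_⟩
    refine Itinerary.exists_monodromy_of_zero (y := x) (a := b) (b := a) hl ?_ t n
    simpa using h.swap (hcα _ _) (hcα _ _)
  have hsign : ∀ c d : ZMod 12, altSign (c + altSign c * d) = altSign c * altSign d :=
    altSign_add_altSign_mul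
  -- the exponent of the change of labelling is unchanged after time `n / l`
  have hper : ∀ (a : ℝ) (q n : ℕ), ⌊a + q * l * (t + n / l)⌋ = ⌊a + q * l * t⌋ + (q * n : ℕ) := by
    intro a q n
    have : a + q * l * (t + n / l) = a + q * l * t + (q * n : ℕ) := by
      push_cast; field_simp; ring
    rw [this, Int.floor_add_natCast]
  have hper2 : ∀ (a b : ℝ) (q p n : ℕ),
      ⌊a + q * l * (t + n / l) - (b + p * l * (t + n / l))⌋ + ⌊b + p * l * (t + n / l)⌋ -
        ⌊a + q * l * (t + n / l)⌋ =
      ⌊a + q * l * t - (b + p * l * t)⌋ + ⌊b + p * l * t⌋ - ⌊a + q * l * t⌋ := by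
    intro a b q p n
    have : a + q * l * (t + n / l) - (b + p * l * (t + n / l)) =
        a + q * l * t - (b + p * l * t) + ((q * n : ℕ) : ℤ) - ((p * n : ℕ) : ℤ) := by
      push_cast; field_simp; ring
    rw [this, hper, hper, Int.floor_sub_intCast, Int.floor_add_intCast]
    ring
  rcases le_total p q with hle | hle
  · have h1 := h.shear (hcα _ _) (hcα _ _)
    have e : (fun t : ℝ => a + q * l * t - (b + p * l * t)) =
        fun t => (a - b) + ((q - p : ℕ) : ℝ) * l * t := by
      ext t; push_cast [hle]; ring
    rw [e] at h1
    obtain ⟨g, f, hg, hf, hn⟩ := ih (q - p + p) (by omega) (q - p) p rfl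
      ((Nat.coprime_sub_self_left hle).mpr hqp) hl hB.mul_right c _ hc (hd.mul hc) h1 t
    refine ⟨_, f, hg.conj (zpow_mem hB.left_mem
      (⌊a + q * l * t - (b + p * l * t)⌋ + ⌊b + p * l * t⌋ - ⌊a + q * l * t⌋)), ?_, fun n => ?_⟩
    · rw [hf, hsign, mul_pow, ← mul_assoc, ← pow_add, Nat.sub_add_cancel hle]
    · have h2 := hn n
      rw [hper2] at h2
      set X := x ^ (⌊a + q * l * t - (b + p * l * t)⌋ + ⌊b + p * l * t⌋ - ⌊a + q * l * t⌋)
      have h3 : X⁻¹ * g * X = X⁻¹ * g * X⁻¹⁻¹ := by rw [inv_inv]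
      rw [h3, conj_pow, inv_inv, Equiv.Perm.mul_apply, Equiv.Perm.mul_apply, ← h2, perm_inv_apply]
  · have h1 := ((h.swap (hcα _ _) (hcα _ _)).shear (hcα _ _) (hcα _ _)).swap
      ((hcα _ _).sub (hcα _ _)) (hcα _ _)
    have e : (fun t : ℝ => b + p * l * t - (a + q * l * t)) =
        fun t => (b - a) + ((p - q : ℕ) : ℝ) * l * t := by
      ext t; push_cast [hle]; ring
    rw [e] at h1
    obtain ⟨g, f, hg, hf, hn⟩ := ih (q + (p - q)) (by omega) q (p - q) rfl
      ((Nat.coprime_sub_self_right hle).mpr hqp) hl hB.mul_left _ d (hc.mul hd) hd h1 t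
    refine ⟨_, f, hg.conj (zpow_mem hB.right_mem
      (⌊b + p * l * t - (a + q * l * t)⌋ + ⌊a + q * l * t⌋ - ⌊b + p * l * t⌋)), ?_, fun n => ?_⟩
    · rw [hf, hsign, mul_pow, mul_comm (altSign d ^ q), mul_assoc, ← pow_add,
        Nat.add_sub_cancel' hle]
    · have h2 := hn n
      rw [hper2] at h2
      set X := y ^ (⌊b + p * l * t - (a + q * l * t)⌋ + ⌊a + q * l * t⌋ - ⌊b + p * l * t⌋)
      have h3 : X⁻¹ * g * X = X⁻¹ * g * X⁻¹⁻¹ := by rw [inv_inv]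
      rw [h3, conj_pow, inv_inv, Equiv.Perm.mul_apply, Equiv.Perm.mul_apply, ← h2, perm_inv_apply]

/-! ### Isometric unfoldings are affine -/

theorem inner_sub_eq_of_dist_eq {φ : E3 → E2} {S : Set E3}
    (hφ : ∀ x ∈ S, ∀ y ∈ S, dist (φ x) (φ y) = dist x y) {p x y : E3} (hp : p ∈ S) (hx : x ∈ S)
    (hy : y ∈ S) : ⟪φ x - φ p, φ y - φ p⟫ = ⟪x - p, y - p⟫ := by
  rw [real_inner_eq_norm_mul_self_add_norm_mul_self_sub_norm_sub_mul_self_div_two,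
    real_inner_eq_norm_mul_self_add_norm_mul_self_sub_norm_sub_mul_self_div_two,
    sub_sub_sub_cancel_right, sub_sub_sub_cancel_right, ← dist_eq_norm, ← dist_eq_norm,
    ← dist_eq_norm, ← dist_eq_norm, ← dist_eq_norm, ← dist_eq_norm, hφ x hx p hp, hφ y hy p hp,
    hφ x hx y hy]

theorem plane_decomposition {e f : E2} (he : ⟪e, e⟫ = 1) (hf : ⟪f, f⟫ = 1) (hef : ⟪e, f⟫ = 0)
    (v : E2) : v = ⟪e, v⟫ • e + ⟪f, v⟫ • f := by
  have ho : Orthonormal ℝ ![e, f] := by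
    rw [orthonormal_iff_ite]
    intro i j
    fin_cases i <;> fin_cases j
    · simpa using he
    · simpa using hef
    · simpa [real_inner_comm] using hef
    · simpa using hf
  have hb := ho.linearIndependent.span_eq_top_of_card_eq_finrank (by simp)
  let b := OrthonormalBasis.mk ho hb.ge
  have := b.sum_repr v
  simpa [b.repr_apply_apply, b, Fin.sum_univ_two] using this.symm

/-- A map to the plane that is isometric on a set containing `p`, `p + h • A` and `p + h • B` is
affine on the part of that set that lies in the plane through `p` spanned by `A` and `B`. -/
theorem exists_image_frame {φ : E3 → E2} {S : Set E3}
    (hφ : ∀ x ∈ S, ∀ y ∈ S, dist (φ x) (φ y) = dist x y) {p A B : E3} {h : ℝ} (hh : 0 < h)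
    (hA : ⟪A, A⟫ = 1) (hB : ⟪B, B⟫ = 1) (hAB : ⟪A, B⟫ = 0)
    (hp : p ∈ S) (hpA : p + h • A ∈ S) (hpB : p + h • B ∈ S) :
    ∃ e f : E2, ⟪e, e⟫ = 1 ∧ ⟪f, f⟫ = 1 ∧ ⟪e, f⟫ = 0 ∧
      φ (p + h • A) - φ p = h • e ∧ φ (p + h • B) - φ p = h • f ∧
      ∀ a b : ℝ, p + a • A + b • B ∈ S → φ (p + a • A + b • B) = φ p + a • e + b • f := by
  have hBA : ⟪B, A⟫ = 0 := by rw [real_inner_comm]; exact hAB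
  have hh' := hh.ne'
  have h1 : φ (p + h • A) - φ p = h • (h⁻¹ • (φ (p + h • A) - φ p)) := by
    rw [smul_smul, mul_inv_cancel₀ hh', one_smul]
  have h2 : φ (p + h • B) - φ p = h • (h⁻¹ • (φ (p + h • B) - φ p)) := by
    rw [smul_smul, mul_inv_cancel₀ hh', one_smul]
  set e := h⁻¹ • (φ (p + h • A) - φ p) with he
  set f := h⁻¹ • (φ (p + h • B) - φ p) with hf
  have hee : ⟪e, e⟫ = 1 := by
    rw [he, inner_smul_left, inner_smul_right, inner_sub_eq_of_dist_eq hφ hp hpA hpA]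
    simp only [add_sub_cancel_left, inner_smul_left, inner_smul_right, hA, conj_trivial]
    field_simp
  have hff : ⟪f, f⟫ = 1 := by
    rw [hf, inner_smul_left, inner_smul_right, inner_sub_eq_of_dist_eq hφ hp hpB hpB]
    simp only [add_sub_cancel_left, inner_smul_left, inner_smul_right, hB, conj_trivial]
    field_simp
  have hef : ⟪e, f⟫ = 0 := by
    rw [he, hf, inner_smul_left, inner_smul_right, inner_sub_eq_of_dist_eq hφ hp hpA hpB]
    simp [inner_smul_left, inner_smul_right, hAB]
  refine ⟨e, f, hee, hff, hef, h1, h2, fun a b hab => ?_⟩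
  have h3 := plane_decomposition hee hff hef (φ (p + a • A + b • B) - φ p)
  have h4 : ⟪e, φ (p + a • A + b • B) - φ p⟫ = a := by
    rw [he, inner_smul_left, inner_sub_eq_of_dist_eq hφ hp hpA hab]
    simp only [add_sub_cancel_left, add_assoc, inner_smul_left, inner_smul_right, inner_add_right,
      hA, hAB, conj_trivial]
    field_simp; ring
  have h5 : ⟪f, φ (p + a • A + b • B) - φ p⟫ = b := by
    rw [hf, inner_smul_left, inner_sub_eq_of_dist_eq hφ hp hpB hab]
    simp only [add_sub_cancel_left, add_assoc, inner_smul_left, inner_smul_right, inner_add_right,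
      hB, hBA, conj_trivial]
    field_simp; ring
  rw [h4, h5] at h3
  rw [add_assoc (φ p), ← h3]; abel

theorem smul_add_smul_cancel {e f : E2} (he : ⟪e, e⟫ = 1) (hf : ⟪f, f⟫ = 1) (hef : ⟪e, f⟫ = 0)
    {a b c d : ℝ} (h : a • e + b • f = c • e + d • f) : a = c ∧ b = d := by
  have hfe : ⟪f, e⟫ = 0 := by rw [real_inner_comm]; exact hef
  have h1 := congrArg (fun v => ⟪e, v⟫) h
  have h2 := congrArg (fun v => ⟪f, v⟫) h
  simp only [inner_add_right, inner_smul_right, he, hf, hef, hfe] at h1 h2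
  constructor <;> linarith

theorem sq_add_sq_eq_one {e f u : E2} (he : ⟪e, e⟫ = 1) (hf : ⟪f, f⟫ = 1) (hef : ⟪e, f⟫ = 0)
    (hu : ‖u‖ = 1) : ⟪e, u⟫ ^ 2 + ⟪f, u⟫ ^ 2 = 1 := by
  have hfe : ⟪f, e⟫ = 0 := by rw [real_inner_comm]; exact hef
  have h1 : ⟪u, u⟫ = 1 := by rw [real_inner_self_eq_norm_sq, hu]; norm_num
  have h2 := plane_decomposition he hf hef u
  set a := ⟪e, u⟫
  set b := ⟪f, u⟫
  rw [h2] at h1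
  simp only [inner_add_right, inner_add_left, inner_smul_left, inner_smul_right, he, hf, hef, hfe,
    conj_trivial] at h1
  linarith

/-- A curve that the isometric map `φ` of a planar set straightens is itself straight. -/
theorem straight_inside {γ : ℝ → E3} {s : ℝ} {φ : E3 → E2} {S : Set E3} {u : E2}
    (hφ : ∀ x ∈ S, ∀ y ∈ S, dist (φ x) (φ y) = dist x y) {A B : E3} {h : ℝ} (hh : 0 < h)
    (hA : ⟪A, A⟫ = 1) (hB : ⟪B, B⟫ = 1) (hAB : ⟪A, B⟫ = 0)
    (hp : γ s ∈ S) (hpA : γ s + h • A ∈ S) (hpB : γ s + h • B ∈ S)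
    (hS : ∀ x ∈ S, ∃ a b : ℝ, x = γ s + a • A + b • B) (hu : ‖u‖ = 1)
    (hγ : ∀ᶠ t in 𝓝 s, γ t ∈ S ∧ φ (γ t) = φ (γ s) + (t - s) • u) :
    ∃ a b : ℝ, a ^ 2 + b ^ 2 = 1 ∧
      ∀ᶠ t in 𝓝 s, γ t = γ s + ((t - s) * a) • A + ((t - s) * b) • B := by
  obtain ⟨e, f, he, hf, hef, -, -, hφ'⟩ := exists_image_frame hφ hh hA hB hAB hp hpA hpB
  refine ⟨⟪e, u⟫, ⟪f, u⟫, sq_add_sq_eq_one he hf hef hu, ?_⟩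
  filter_upwards [hγ] with t ⟨h1, h2⟩
  obtain ⟨a, b, hab⟩ := hS _ h1
  rw [hab] at h1 h2
  rw [hφ' a b h1, plane_decomposition he hf hef u, smul_add, smul_smul, smul_smul, add_assoc] at h2
  obtain ⟨rfl, rfl⟩ := smul_add_smul_cancel he hf hef (add_left_cancel h2)
  exact hab

/-- A curve that is straightened by unfolding two half planes with common edge direction `A` and
inward normals `M` and `N` runs straight in each of them, with the same velocity components along
the edge and across it. -/
theorem straight_across {γ : ℝ → E3} {s : ℝ} {φ : E3 → E2} {S₁ S₂ : Set E3} {u : E2}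
    (hφ₁ : ∀ x ∈ S₁, ∀ y ∈ S₁, dist (φ x) (φ y) = dist x y)
    (hφ₂ : ∀ x ∈ S₂, ∀ y ∈ S₂, dist (φ x) (φ y) = dist x y)
    (hinj : Set.InjOn φ (S₁ ∪ S₂)) {A M N : E3} {h : ℝ} (hh : 0 < h)
    (hA : ⟪A, A⟫ = 1) (hM : ⟪M, M⟫ = 1) (hN : ⟪N, N⟫ = 1) (hAM : ⟪A, M⟫ = 0) (hAN : ⟪A, N⟫ = 0)
    (hMN : ⟪M, N⟫ = 0)
    (hp₁ : γ s ∈ S₁) (hp₂ : γ s ∈ S₂) (hpA₁ : γ s + h • A ∈ S₁) (hpA₂ : γ s + h • A ∈ S₂)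
    (hpM : γ s + h • M ∈ S₁) (hpN : γ s + h • N ∈ S₂)
    (hS₁ : ∀ x ∈ S₁, ∃ a b : ℝ, 0 ≤ b ∧ x = γ s + a • A + b • M)
    (hS₂ : ∀ x ∈ S₂, ∃ a b : ℝ, 0 ≤ b ∧ x = γ s + a • A + b • N)
    (hγ : ∀ᶠ t in 𝓝 s, γ t ∈ S₁ ∪ S₂ ∧ φ (γ t) = φ (γ s) + (t - s) • u) :
    ∃ a b : ℝ, ∀ᶠ t in 𝓝 s, γ t = γ s + ((t - s) * a) • A + (max (-((t - s) * b)) 0) • M +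
        (max ((t - s) * b) 0) • N := by
  obtain ⟨e, f, he, hf, hef, he', hf', hφ₂'⟩ := exists_image_frame hφ₂ hh hA hN hAN hp₂ hpA₂ hpN
  obtain ⟨e₁, g, he₁, hg, heg, he₁', hg', hφ₁'⟩ := exists_image_frame hφ₁ hh hA hM hAM hp₁ hpA₁ hpM
  obtain rfl : e = e₁ := smul_right_injective _ hh.ne' (he'.symm.trans he₁')
  -- the two squares lie on opposite sides of the common edge
  have hgf : g = -f := by
    have h1 := plane_decomposition he hf hef g
    rw [heg, zero_smul, zero_add] at h1
    set c := ⟪f, g⟫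
    have h2 : c * c = 1 := by
      rw [h1, inner_smul_left, inner_smul_right, hf, conj_trivial, mul_one] at hg
      exact hg
    rcases mul_self_eq_one_iff.mp h2 with h3 | h3
    · exfalso
      rw [h3, one_smul] at h1
      have h4 : φ (γ s + h • M) = φ (γ s + h • N) := by
        rw [h1, ← hf'] at hg'
        simpa using hg'
      have h5 := hinj (Or.inl hpM) (Or.inr hpN) h4
      have h6 : M = N := smul_right_injective _ hh.ne' (add_left_cancel h5)
      rw [h6, hN] at hMN
      norm_num at hMN
    · rw [h1, h3, neg_one_smul]
  refine ⟨⟪e, u⟫, ⟪f, u⟫, ?_⟩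
  have hu' := plane_decomposition he hf hef u
  set a₀ := ⟪e, u⟫
  set b₀ := ⟪f, u⟫
  filter_upwards [hγ] with t ⟨h1, h2⟩
  rcases h1 with h1 | h1
  · obtain ⟨a, b, hb, hab⟩ := hS₁ _ h1
    rw [hab] at h1 h2
    rw [hφ₁' a b h1, hu', smul_add, smul_smul, smul_smul, add_assoc, hgf, smul_neg,
      ← neg_smul] at h2
    obtain ⟨h3, h4⟩ := smul_add_smul_cancel he hf hef (add_left_cancel h2)
    rw [hab, ← h3, ← h4, neg_neg, max_eq_left hb, max_eq_right (by linarith), zero_smul, add_zero]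
  · obtain ⟨a, b, hb, hab⟩ := hS₂ _ h1
    rw [hab] at h1 h2
    rw [hφ₂' a b h1, hu', smul_add, smul_smul, smul_smul, add_assoc] at h2
    obtain ⟨h3, h4⟩ := smul_add_smul_cancel he hf hef (add_left_cancel h2)
    rw [hab, ← h3, ← h4, max_eq_left hb, max_eq_right (by linarith), zero_smul, add_zero]

theorem IsNonsingularGeodesic.continuous {γ : ℝ → E3} (hγ : IsNonsingularGeodesic γ) :
    Continuous γ := by
  rw [continuous_iff_continuousAt]
  intro s
  obtain ⟨-, -, φ, ⟨hφ, -⟩, u, hu, h⟩ := hγ s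
  rw [ContinuousAt, tendsto_iff_dist_tendsto_zero]
  have h1 : ∀ᶠ t in 𝓝 s, dist (γ t) (γ s) = |t - s| := by
    filter_upwards [h] with t ⟨⟨S, hS, hs, ht⟩, h2⟩
    rw [← hφ S hS hs _ ht _ hs, h2, dist_eq_norm, add_sub_cancel_left, norm_smul, hu, mul_one,
      Real.norm_eq_abs]
  rw [tendsto_congr' h1]
  have : Continuous fun t : ℝ => |t - s| := by fun_prop
  simpa using this.tendsto s

/-- A periodic curve is bounded, a drifting one is not. -/
theorem not_isPeriodic_and_isDriftPeriodic {γ : ℝ → E3} (hc : Continuous γ) (h : IsPeriodic γ) :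
    ¬ IsDriftPeriodic γ := by
  rintro ⟨l, -, x, hx, hl⟩
  obtain ⟨P, hP, hp⟩ := h
  have hper : Function.Periodic γ |P| := by
    have : Function.Periodic γ P := fun t => by rw [add_comm]; exact hp t
    rcases abs_choice P with h | h <;> rw [h]
    · exact this
    · exact this.neg
  have hb : Bornology.IsBounded (Set.range γ) := by
    rw [← hper.image_Icc (abs_pos.mpr hP) 0]
    exact (isCompact_Icc.image hc).isBounded
  obtain ⟨C, hC⟩ := hb.exists_norm_le
  have hn : ∀ n : ℕ, γ (n * l) = n • x + γ 0 := by
    intro n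
    induction n with
    | zero => simp
    | succ n ih =>
      have : ((n + 1 : ℕ) : ℝ) * l = l + n * l := by push_cast; ring
      rw [this, hl, ih, succ_nsmul']
      abel
  obtain ⟨n, hn'⟩ := exists_nat_gt ((C + C) / ‖x‖)
  have hx' := norm_pos_iff.mpr hx
  rw [div_lt_iff₀ hx'] at hn'
  have h1 : (n : ℝ) * ‖x‖ ≤ C + C := by
    calc (n : ℝ) * ‖x‖ = ‖γ (n * l) - γ 0‖ := by
          rw [hn, add_sub_cancel_right, ← Nat.cast_smul_eq_nsmul ℝ, norm_smul]; simp
      _ ≤ ‖γ (n * l)‖ + ‖γ 0‖ := norm_sub_le _ _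
      _ ≤ C + C := add_le_add (hC _ ⟨_, rfl⟩) (hC _ ⟨_, rfl⟩)
  linarith

/-! ### Faces in coordinates -/

/-- The vertices of a unit square lie on three consecutive layers. -/
theorem isConstituent_iff (S : UnitSquare) :
    S.IsConstituent ↔ S.corner 0 + S.corner 1 + S.corner 2 = -1 := by
  obtain ⟨c, a⟩ := S
  simp only [UnitSquare.IsConstituent, UnitSquare.vertices, layers, Set.insert_subset_iff,
    Set.singleton_subset_iff, Set.mem_ofPred_eq, Pi.add_apply]
  fin_cases a <;> simp <;> omega

/-- An integral vector as a point of Euclidean space. -/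
def vec (n : Fin 3 → ℤ) : E3 := WithLp.toLp 2 fun i => (n i : ℝ)

theorem vec_apply (n : Fin 3 → ℤ) (i : Fin 3) : vec n i = n i := rfl

theorem vec_add (m n : Fin 3 → ℤ) : vec (m + n) = vec m + vec n := by
  ext i; simp [vec_apply]

theorem inner_vec (m n : Fin 3 → ℤ) : ⟪vec m, vec n⟫ = ((∑ i, m i * n i : ℤ) : ℝ) := by
  simp [PiLp.inner_apply, vec, mul_comm]

/-- The axis of the faces that carry the `j`-th frame. -/
def frameAxis (j : ZMod 12) : Fin 3 :=
  (![0, 1, 2, 0, 1, 2, 0, 1, 2, 0, 1, 2] : Fin 12 → Fin 3) j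

/-- The point with coordinates `x`, `y` in the frame of a state, with origin at the centre of the
face. The face consists of the points with `|x|, |y| ≤ 1 / 2`. -/
noncomputable def pt (σ : State) (x y : ℝ) : E3 :=
  (1 / 2 : ℝ) • vec σ.1 + x • vec (frameA σ.2) + y • vec (frameB σ.2)

theorem pt_apply (σ : State) (x y : ℝ) (i : Fin 3) :
    pt σ x y i = σ.1 i / 2 + x * frameA σ.2 i + y * frameB σ.2 i := by
  simp [pt, vec_apply]; ring

theorem pt_translate (d : Fin 3 → ℤ) (σ : State) (x y : ℝ) :
    pt (translate d σ) x y = (1 / 2 : ℝ) • vec d + pt σ x y := by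
  simp only [pt, translate_apply, vec_add, smul_add]; abel

/-- The state comes from a constituent square: its centre is a half-integral point on the plane of
coordinate sum zero, the half-integral coordinates being those along the two frame vectors. -/
def IsFace (σ : State) : Prop :=
  σ.1 0 + σ.1 1 + σ.1 2 = 0 ∧ ∀ i, (2 : ℤ) ∣ σ.1 i - (frameA σ.2 i + frameB σ.2 i)

/-- The square underlying a state; the division by `2` is exact if the state satisfies `IsFace`. -/
def face (σ : State) : UnitSquare :=
  ⟨fun i => (σ.1 i - (frameA σ.2 i ^ 2 + frameB σ.2 i ^ 2)) / 2, frameAxis σ.2⟩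

theorem IsFace.two_mul_corner {σ : State} (h : IsFace σ) (i : Fin 3) :
    2 * (face σ).corner i = σ.1 i - (frameA σ.2 i ^ 2 + frameB σ.2 i ^ 2) := by
  have h1 := h.2 i
  have h2 : ∀ j i, (2 : ℤ) ∣ frameA j i + frameB j i - (frameA j i ^ 2 + frameB j i ^ 2) := by
    decide
  have h3 := h2 σ.2 i
  simp only [face]
  omega

theorem IsFace.isConstituent {σ : State} (h : IsFace σ) : (face σ).IsConstituent := by
  rw [isConstituent_iff]
  have h0 := h.two_mul_corner 0
  have h1 := h.two_mul_corner 1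
  have h2 := h.two_mul_corner 2
  have h3 : ∀ j, ∑ i, (frameA j i ^ 2 + frameB j i ^ 2) = 2 := by decide
  have h4 := h3 σ.2
  have h5 := h.1
  rw [Fin.sum_univ_three] at h4
  omega

theorem IsFace.crossA {σ : State} (h : IsFace σ) : IsFace (crossA σ) := by
  constructor
  · have := crossA_mem.2.2.1 σ
    rw [Fin.sum_univ_three, Fin.sum_univ_three, h.1] at this
    exact this
  · intro i
    have h1 := h.2 i
    have h2 := frameB_add σ.2
    simp only [crossA_apply, Pi.add_apply, h2]
    omega

theorem IsFace.crossB {σ : State} (h : IsFace σ) : IsFace (crossB σ) := by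
  constructor
  · have := crossB_mem.2.2.1 σ
    rw [Fin.sum_univ_three, Fin.sum_univ_three, h.1] at this
    exact this
  · intro i
    have h1 := h.2 i
    have h2 := frameA_sub σ.2
    simp only [crossB_apply, Pi.add_apply, h2]
    omega

theorem IsFace.crossA_inv {σ : State} (h : IsFace σ) : IsFace (Necker.crossA⁻¹ σ) := by
  have e : Necker.crossA⁻¹ σ = (σ.1 - frameA σ.2 - frameA (σ.2 + altSign σ.2 * 1),
    σ.2 + altSign σ.2 * 1) := rfl
  constructor
  · have := (inv_mem crossA_mem).2.2.1 σ
    rw [Fin.sum_univ_three, Fin.sum_univ_three, h.1] at this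
    exact this
  · intro i
    have h1 := h.2 i
    have h2 := frameB_add σ.2
    simp only [e, Pi.sub_apply, h2]
    omega

theorem IsFace.crossB_inv {σ : State} (h : IsFace σ) : IsFace (Necker.crossB⁻¹ σ) := by
  have e : Necker.crossB⁻¹ σ = (σ.1 - frameB σ.2 - frameB (σ.2 + altSign σ.2 * -1),
    σ.2 + altSign σ.2 * -1) := rfl
  constructor
  · have := (inv_mem crossB_mem).2.2.1 σ
    rw [Fin.sum_univ_three, Fin.sum_univ_three, h.1] at this
    exact this
  · intro i
    have h1 := h.2 i
    have h2 := frameA_sub σ.2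
    simp only [e, Pi.sub_apply, h2]
    omega

theorem exists_state {S : UnitSquare} (hS : S.IsConstituent) {j : ZMod 12}
    (hj : frameAxis j = S.axis) : ∃ σ : State, IsFace σ ∧ σ.2 = j ∧ face σ = S := by
  rw [isConstituent_iff] at hS
  have h3 : ∀ j, ∑ i, (frameA j i ^ 2 + frameB j i ^ 2) = 2 := by decide
  have h4 := h3 j
  rw [Fin.sum_univ_three] at h4
  refine ⟨(fun i => 2 * S.corner i + (frameA j i ^ 2 + frameB j i ^ 2), j), ⟨?_, fun i => ?_⟩, rfl,
    ?_⟩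
  · dsimp only; omega
  · have h2 : ∀ j i, (2 : ℤ) ∣ frameA j i + frameB j i - (frameA j i ^ 2 + frameB j i ^ 2) := by
      decide
    have := h2 j i
    dsimp only; omega
  · obtain ⟨c, a⟩ := S
    simp only [face, UnitSquare.mk.injEq]
    refine ⟨?_, hj⟩
    ext i
    omega

theorem IsFace.mem_carrier_iff {σ : State} (h : IsFace σ) (p : E3) :
    p ∈ (face σ).carrier ↔ ∃ x y : ℝ, (-1 / 2 ≤ x ∧ x ≤ 1 / 2) ∧ (-1 / 2 ≤ y ∧ y ≤ 1 / 2) ∧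
      p = pt σ x y := by
  obtain ⟨n, j⟩ := σ
  have hc : ∀ i, ((face (n, j)).corner i : ℝ) =
      (n i - (frameA j i ^ 2 + frameB j i ^ 2 : ℤ)) / 2 := by
    intro i
    have := h.two_mul_corner i
    rw [eq_div_iff (by norm_num)]
    rw [mul_comm]
    exact_mod_cast this
  simp only [UnitSquare.carrier, Set.mem_ofPred_eq, Set.mem_Icc, hc]
  have htab : ∀ j, (frameA j (frameAxis j + 2) = 0 ∧ frameB j (frameAxis j + 2) = 0) ∧
      ((frameA j (frameAxis j) = 1 ∧ frameA j (frameAxis j + 1) = 0 ∧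
        frameB j (frameAxis j) = 0 ∧ frameB j (frameAxis j + 1) = 1) ∨
      (frameA j (frameAxis j) = -1 ∧ frameA j (frameAxis j + 1) = 0 ∧
        frameB j (frameAxis j) = 0 ∧ frameB j (frameAxis j + 1) = -1) ∨
      (frameA j (frameAxis j) = 0 ∧ frameA j (frameAxis j + 1) = 1 ∧
        frameB j (frameAxis j) = -1 ∧ frameB j (frameAxis j + 1) = 0) ∨
      (frameA j (frameAxis j) = 0 ∧ frameA j (frameAxis j + 1) = -1 ∧
        frameB j (frameAxis j) = 1 ∧ frameB j (frameAxis j + 1) = 0)) := by decide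
  have hax : (face (n, j)).axis = frameAxis j := rfl
  have hext : ∀ q : E3, p = q ↔ p (frameAxis j) = q (frameAxis j) ∧
      p (frameAxis j + 1) = q (frameAxis j + 1) ∧ p (frameAxis j + 2) = q (frameAxis j + 2) := by
    intro q
    refine ⟨fun h => by rw [h]; exact ⟨rfl, rfl, rfl⟩, fun ⟨h1, h2, h3⟩ => ?_⟩
    ext i
    have : ∀ i a : Fin 3, i = a ∨ i = a + 1 ∨ i = a + 2 := by decide
    rcases this i (frameAxis j) with e | e | e <;> rw [e] <;> assumption
  simp only [hext, hax, pt_apply]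
  obtain ⟨⟨e1, e2⟩, h⟩ := htab j
  rw [e1, e2]
  rcases h with ⟨e3, e4, e5, e6⟩ | ⟨e3, e4, e5, e6⟩ | ⟨e3, e4, e5, e6⟩ | ⟨e3, e4, e5, e6⟩ <;>
    rw [e3, e4, e5, e6] <;> push_cast <;> constructor
  · rintro ⟨⟨h1, h2⟩, ⟨h3, h4⟩, h5⟩
    refine ⟨p (frameAxis j) - n (frameAxis j) / 2, p (frameAxis j + 1) - n (frameAxis j + 1) / 2,
      ⟨?_, ?_⟩, ⟨?_, ?_⟩, ?_, ?_, ?_⟩ <;> linarith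
  · rintro ⟨x, y, ⟨h1, h2⟩, ⟨h3, h4⟩, h5, h6, h7⟩
    refine ⟨⟨?_, ?_⟩, ⟨?_, ?_⟩, ?_⟩ <;> linarith
  · rintro ⟨⟨h1, h2⟩, ⟨h3, h4⟩, h5⟩
    refine ⟨-(p (frameAxis j) - n (frameAxis j) / 2),
      -(p (frameAxis j + 1) - n (frameAxis j + 1) / 2),
      ⟨?_, ?_⟩, ⟨?_, ?_⟩, ?_, ?_, ?_⟩ <;> linarith
  · rintro ⟨x, y, ⟨h1, h2⟩, ⟨h3, h4⟩, h5, h6, h7⟩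
    refine ⟨⟨?_, ?_⟩, ⟨?_, ?_⟩, ?_⟩ <;> linarith
  · rintro ⟨⟨h1, h2⟩, ⟨h3, h4⟩, h5⟩
    refine ⟨p (frameAxis j + 1) - n (frameAxis j + 1) / 2, -(p (frameAxis j) - n (frameAxis j) / 2),
      ⟨?_, ?_⟩, ⟨?_, ?_⟩, ?_, ?_, ?_⟩ <;> linarith
  · rintro ⟨x, y, ⟨h1, h2⟩, ⟨h3, h4⟩, h5, h6, h7⟩
    refine ⟨⟨?_, ?_⟩, ⟨?_, ?_⟩, ?_⟩ <;> linarith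
  · rintro ⟨⟨h1, h2⟩, ⟨h3, h4⟩, h5⟩
    refine ⟨-(p (frameAxis j + 1) - n (frameAxis j + 1) / 2), p (frameAxis j) - n (frameAxis j) / 2,
      ⟨?_, ?_⟩, ⟨?_, ?_⟩, ?_, ?_, ?_⟩ <;> linarith
  · rintro ⟨x, y, ⟨h1, h2⟩, ⟨h3, h4⟩, h5, h6, h7⟩
    refine ⟨⟨?_, ?_⟩, ⟨?_, ?_⟩, ?_⟩ <;> linarith

/-! ### Which faces contain a given point -/

/-- The coordinate along which the vector `frameA j` points. -/
def indexA (j : ZMod 12) : Fin 3 :=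
  (![0, 2, 2, 1, 1, 0, 0, 2, 2, 1, 1, 0] : Fin 12 → Fin 3) j

/-- The coordinate along which the vector `frameB j` points. -/
def indexB (j : ZMod 12) : Fin 3 :=
  (![1, 1, 0, 0, 2, 2, 1, 1, 0, 0, 2, 2] : Fin 12 → Fin 3) j

theorem half_add_ne_int {n e : ℤ} {x : ℝ} (he : e = 1 ∨ e = -1) (hn : (2 : ℤ) ∣ n - e)
    (hx : -1 / 2 < x ∧ x < 1 / 2) (k : ℤ) : (n : ℝ) / 2 + x * e ≠ k := by
  intro h
  obtain ⟨m, hm⟩ := hn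
  obtain rfl : n = 2 * m + e := by omega
  obtain ⟨h1, h2⟩ := hx
  rcases he with rfl | rfl
  · push_cast at h
    have h3 : (m : ℝ) < k := by linarith
    have h4 : (k : ℝ) < m + 1 := by linarith
    norm_cast at h3 h4
    omega
  · push_cast at h
    have h3 : (m : ℝ) - 1 < k := by linarith
    have h4 : (k : ℝ) < m := by linarith
    norm_cast at h4
    have h3' : ((m - 1 : ℤ) : ℝ) < k := by push_cast; linarith
    norm_cast at h3'
    omega

theorem IsFace.pt_indexA_ne {σ : State} (h : IsFace σ) {x : ℝ} (hx : -1 / 2 < x ∧ x < 1 / 2)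
    (y : ℝ) (k : ℤ) : pt σ x y (indexA σ.2) ≠ k := by
  have h1 : ∀ j, (frameA j (indexA j) = 1 ∨ frameA j (indexA j) = -1) ∧
    frameB j (indexA j) = 0 := by decide
  obtain ⟨h2, h3⟩ := h1 σ.2
  have h4 := h.2 (indexA σ.2)
  rw [h3, add_zero] at h4
  rw [pt_apply, h3, Int.cast_zero, mul_zero, add_zero]
  exact half_add_ne_int h2 h4 hx k

theorem IsFace.pt_indexB_ne {σ : State} (h : IsFace σ) {y : ℝ} (hy : -1 / 2 < y ∧ y < 1 / 2)
    (x : ℝ) (k : ℤ) : pt σ x y (indexB σ.2) ≠ k := by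
  have h1 : ∀ j, (frameB j (indexB j) = 1 ∨ frameB j (indexB j) = -1) ∧
    frameA j (indexB j) = 0 := by decide
  obtain ⟨h2, h3⟩ := h1 σ.2
  have h4 := h.2 (indexB σ.2)
  rw [h3, zero_add] at h4
  rw [pt_apply, h3, Int.cast_zero, mul_zero, add_zero]
  exact half_add_ne_int h2 h4 hy k

theorem eq_of_mem_Icc_of_ne {c d : ℤ} {p : ℝ} (hc : p ∈ Set.Icc (c : ℝ) (c + 1))
    (hd : p ∈ Set.Icc (d : ℝ) (d + 1)) (hp : ∀ k : ℤ, p ≠ k) : c = d := by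
  have h1 : (c : ℝ) < p := lt_of_le_of_ne hc.1 (hp c).symm
  have h2 : p < d + 1 := lt_of_le_of_ne hd.2 (by exact_mod_cast hp (d + 1))
  have h3 : (d : ℝ) < p := lt_of_le_of_ne hd.1 (hp d).symm
  have h4 : p < c + 1 := lt_of_le_of_ne hc.2 (by exact_mod_cast hp (c + 1))
  have h5 : (c : ℝ) < d + 1 := by linarith
  have h6 : (d : ℝ) < c + 1 := by linarith
  norm_cast at h5 h6
  omega

/-- Two constituent squares in parallel planes are equal if they share a point with a nonintegral
coordinate: two coordinates of the corner are determined by the point, and the third by the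
coordinate sum. -/
theorem eq_of_mem_carrier {S T : UnitSquare} (hS : S.IsConstituent) (hT : T.IsConstituent)
    (hax : T.axis = S.axis) {p : E3} (hpS : p ∈ S.carrier) (hpT : p ∈ T.carrier) {i : Fin 3}
    (hi : i ≠ S.axis + 2) (hp : ∀ k : ℤ, p i ≠ k) : T = S := by
  rw [isConstituent_iff] at hS hT
  obtain ⟨c, a⟩ := S
  obtain ⟨d, b⟩ := T
  obtain rfl : b = a := hax
  obtain ⟨h1, h2, h3⟩ := hpS
  obtain ⟨h4, h5, h6⟩ := hpT
  dsimp only at *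
  have h7 : c (b + 2) = d (b + 2) := by
    have := h3.symm.trans h6
    exact_mod_cast this
  have h8 : i = b ∨ i = b + 1 := by
    revert hi; clear * -; revert i b; decide
  have h9 : c b = d b ∨ c (b + 1) = d (b + 1) := by
    rcases h8 with rfl | rfl
    · exact Or.inl (eq_of_mem_Icc_of_ne h1 h4 hp)
    · exact Or.inr (eq_of_mem_Icc_of_ne h2 h5 hp)
  have h10 : d = c := by
    clear h1 h2 h3 h4 h5 h6
    ext i
    fin_cases b <;> fin_cases i <;> simp at h7 h9 ⊢ <;> omega
  rw [h10]

theorem IsFace.eq_face_of_inside {σ : State} (h : IsFace σ) {x y : ℝ}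
    (hx : -1 / 2 < x ∧ x < 1 / 2) (hy : -1 / 2 < y ∧ y < 1 / 2) {T : UnitSquare}
    (hT : T.IsConstituent) (hp : pt σ x y ∈ T.carrier) : T = face σ := by
  have h1 : indexA σ.2 ≠ T.axis + 2 := fun e => h.pt_indexA_ne hx y _ (by rw [e]; exact hp.2.2)
  have h2 : indexB σ.2 ≠ T.axis + 2 := fun e => h.pt_indexB_ne hy x _ (by rw [e]; exact hp.2.2)
  have h3 : ∀ j (a : Fin 3), indexA j ≠ a + 2 → indexB j ≠ a + 2 → a = frameAxis j := by decide
  have h4 := h3 _ _ h1 h2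
  refine eq_of_mem_carrier h.isConstituent hT h4 ?_ hp (i := indexA σ.2) ?_ (h.pt_indexA_ne hx y)
  · exact (h.mem_carrier_iff _).mpr ⟨x, y, ⟨hx.1.le, hx.2.le⟩, ⟨hy.1.le, hy.2.le⟩, rfl⟩
  · rw [h4] at h1; exact h1

theorem pt_crossA (σ : State) (y : ℝ) : pt (crossA σ) (-1 / 2) y = pt σ (1 / 2) y := by
  ext i
  simp only [pt_apply, crossA_apply, Pi.add_apply, frameB_add]
  push_cast
  ring

theorem pt_crossB (σ : State) (x : ℝ) : pt (crossB σ) x (-1 / 2) = pt σ x (1 / 2) := by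
  ext i
  simp only [pt_apply, crossB_apply, Pi.add_apply, frameA_sub]
  push_cast
  ring

theorem IsFace.eq_face_of_edgeA {σ : State} (h : IsFace σ) {y : ℝ}
    (hy : -1 / 2 < y ∧ y < 1 / 2) {T : UnitSquare}
    (hT : T.IsConstituent) (hp : pt σ (1 / 2) y ∈ T.carrier) :
    T = face σ ∨ T = face (Necker.crossA σ) := by
  have h2 : indexB σ.2 ≠ T.axis + 2 := fun e =>
    h.pt_indexB_ne hy (1 / 2) _ (by rw [e]; exact hp.2.2)
  have h3 : ∀ j (a : Fin 3), indexB j ≠ a + 2 → a = frameAxis j ∨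
    a = frameAxis (j + altSign j * 1) := by decide
  rcases h3 _ _ h2 with h4 | h4
  · left
    refine eq_of_mem_carrier h.isConstituent hT h4 ?_ hp (i := indexB σ.2) ?_
      (h.pt_indexB_ne hy _)
    · exact (h.mem_carrier_iff _).mpr ⟨_, y, by norm_num, ⟨hy.1.le, hy.2.le⟩, rfl⟩
    · rw [h4] at h2; exact h2
  · right
    refine eq_of_mem_carrier h.crossA.isConstituent hT h4 ?_ hp (i := indexB σ.2) ?_
      (h.pt_indexB_ne hy _)
    · exact (h.crossA.mem_carrier_iff _).mpr
        ⟨_, y, by norm_num, ⟨hy.1.le, hy.2.le⟩, (pt_crossA σ y).symm⟩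
    · rw [h4] at h2; exact h2

theorem IsFace.eq_face_of_edgeB {σ : State} (h : IsFace σ) {x : ℝ}
    (hx : -1 / 2 < x ∧ x < 1 / 2) {T : UnitSquare}
    (hT : T.IsConstituent) (hp : pt σ x (1 / 2) ∈ T.carrier) :
    T = face σ ∨ T = face (Necker.crossB σ) := by
  have h2 : indexA σ.2 ≠ T.axis + 2 := fun e =>
    h.pt_indexA_ne hx (1 / 2) _ (by rw [e]; exact hp.2.2)
  have h3 : ∀ j (a : Fin 3), indexA j ≠ a + 2 → a = frameAxis j ∨
    a = frameAxis (j + altSign j * -1) := by decide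
  rcases h3 _ _ h2 with h4 | h4
  · left
    refine eq_of_mem_carrier h.isConstituent hT h4 ?_ hp (i := indexA σ.2) ?_
      (h.pt_indexA_ne hx _)
    · exact (h.mem_carrier_iff _).mpr ⟨x, _, ⟨hx.1.le, hx.2.le⟩, by norm_num, rfl⟩
    · rw [h4] at h2; exact h2
  · right
    refine eq_of_mem_carrier h.crossB.isConstituent hT h4 ?_ hp (i := indexA σ.2) ?_
      (h.pt_indexA_ne hx _)
    · exact (h.crossB.mem_carrier_iff _).mpr
        ⟨x, _, ⟨hx.1.le, hx.2.le⟩, by norm_num, (pt_crossB σ x).symm⟩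
    · rw [h4] at h2; exact h2

theorem mem_singularities_of_int {S : UnitSquare} (hS : S.IsConstituent) {p : E3}
    (hp : p ∈ S.carrier) (n : Fin 3 → ℤ) (hn : ∀ i, p i = n i) : p ∈ singularities := by
  refine ⟨S, hS, n, ?_, hn⟩
  obtain ⟨⟨h1, h2⟩, ⟨h3, h4⟩, h5⟩ := hp
  rw [hn] at h1 h2 h3 h4 h5
  norm_cast at h1 h2 h3 h4 h5
  obtain ⟨c, a⟩ := S
  dsimp only at *
  have e1 : n a = c a ∨ n a = c a + 1 := by omega
  have e2 : n (a + 1) = c (a + 1) ∨ n (a + 1) = c (a + 1) + 1 := by omega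
  clear h1 h2 h3 h4 hn hS
  simp only [UnitSquare.vertices, Set.mem_insert_iff, Set.mem_singleton_iff, funext_iff,
    Fin.forall_fin_succ, Pi.add_apply, Pi.single_apply]
  fin_cases a <;> simp at e1 e2 h5 ⊢ <;> omega

theorem IsFace.corner_mem_singularities {σ : State} (h : IsFace σ) {x y : ℝ}
    (hx : x = 1 / 2 ∨ x = -1 / 2) (hy : y = 1 / 2 ∨ y = -1 / 2) : pt σ x y ∈ singularities := by
  have hm : pt σ x y ∈ (face σ).carrier := by
    rw [h.mem_carrier_iff]
    refine ⟨x, y, ?_, ?_, rfl⟩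
    · rcases hx with rfl | rfl <;> norm_num
    · rcases hy with rfl | rfl <;> norm_num
  have : ∀ i, ∃ k : ℤ, pt σ x y i = k := by
    intro i
    obtain ⟨m, hm⟩ := h.2 i
    have e : (σ.1 i : ℝ) = 2 * m + (frameA σ.2 i + frameB σ.2 i) := by
      have : σ.1 i = 2 * m + (frameA σ.2 i + frameB σ.2 i) := by omega
      exact_mod_cast this
    rw [pt_apply, e]
    rcases hx with rfl | rfl <;> rcases hy with rfl | rfl
    · exact ⟨m + frameA σ.2 i + frameB σ.2 i, by push_cast; ring⟩
    · exact ⟨m + frameA σ.2 i, by push_cast; ring⟩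
    · exact ⟨m + frameB σ.2 i, by push_cast; ring⟩
    · exact ⟨m, by push_cast; ring⟩
  choose n hn using this
  exact mem_singularities_of_int h.isConstituent hm n hn

/-- Every nonsingular point of the surface is interior to a face or, in a suitable frame, on the edge
of a face towards which the first or the second frame vector points. -/
theorem exists_position {p : E3} (hp : p ∈ surface) (hps : p ∉ singularities) :
    ∃ σ x y, IsFace σ ∧ p = pt σ x y ∧
      ((-1 / 2 < x ∧ x < 1 / 2) ∧ (-1 / 2 < y ∧ y < 1 / 2) ∨ x = 1 / 2 ∧ (-1 / 2 < y ∧ y < 1 / 2) ∨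
        (-1 / 2 < x ∧ x < 1 / 2) ∧ y = 1 / 2) := by
  obtain ⟨S, hS, hpS⟩ := hp
  obtain ⟨j, hj⟩ : ∃ j, frameAxis j = S.axis := by
    have : ∀ a, ∃ j, frameAxis j = a := by decide
    exact this _
  obtain ⟨σ, hσ, -, rfl⟩ := exists_state hS hj
  obtain ⟨x, y, ⟨h1, h2⟩, ⟨h3, h4⟩, rfl⟩ := (hσ.mem_carrier_iff p).mp hpS
  -- a half turn of the frame
  have hA : ∀ j, frameA (j + 6) = -frameA j := by decide
  have hB : ∀ j, frameB (j + 6) = -frameB j := by decide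
  have hσ' : IsFace (σ.1, σ.2 + 6) := by
    refine ⟨hσ.1, fun i => ?_⟩
    have := hσ.2 i
    simp only [hA, hB, Pi.neg_apply]
    omega
  have hpt : pt σ x y = pt (σ.1, σ.2 + 6) (-x) (-y) := by
    ext i
    simp only [pt_apply, hA, hB, Pi.neg_apply]
    push_cast; ring
  have hns := fun hx hy => hps (hσ.corner_mem_singularities (x := x) (y := y) hx hy)
  rcases h1.eq_or_lt with e1 | e1
  · have h5 : -1 / 2 < y := lt_of_le_of_ne h3 fun e => hns (Or.inr e1.symm) (Or.inr e.symm)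
    have h6 : y < 1 / 2 := lt_of_le_of_ne h4 fun e => hns (Or.inr e1.symm) (Or.inl e)
    exact ⟨_, _, _, hσ', hpt, Or.inr (Or.inl ⟨by linarith, by constructor <;> linarith⟩)⟩
  rcases h2.eq_or_lt with e2 | e2
  · have h5 : -1 / 2 < y := lt_of_le_of_ne h3 fun e => hns (Or.inl e2) (Or.inr e.symm)
    have h6 : y < 1 / 2 := lt_of_le_of_ne h4 fun e => hns (Or.inl e2) (Or.inl e)
    exact ⟨_, _, _, hσ, rfl, Or.inr (Or.inl ⟨e2, h5, h6⟩)⟩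
  rcases h3.eq_or_lt with e3 | e3
  · exact ⟨_, _, _, hσ', hpt, Or.inr (Or.inr ⟨by constructor <;> linarith, by linarith⟩)⟩
  rcases h4.eq_or_lt with e4 | e4
  · exact ⟨_, _, _, hσ, rfl, Or.inr (Or.inr ⟨⟨e1, e2⟩, e4⟩)⟩
  exact ⟨_, _, _, hσ, rfl, Or.inl ⟨⟨e1, e2⟩, ⟨e3, e4⟩⟩⟩

/-! ### Velocities and frames -/

/-- The index of the frame can be read off from a velocity vector in the open first quadrant of the
frame; on the boundary of the quadrant, the plane of the face is needed as well. -/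
theorem eq_of_velocity_eq {i j : ZMod 12} {u₁ u₂ : ℝ} (hu₁ : 0 < u₁) (hu₂ : 0 ≤ u₂)
    (h : ∀ k, u₁ * frameA i k + u₂ * frameB i k = u₁ * frameA j k + u₂ * frameB j k)
    (hij : frameAxis i = frameAxis j ∨ 0 < u₂) : i = j := by
  have hcases : ∀ j k, (frameA j k = 0 ∧ frameB j k = 0) ∨ (frameA j k = 1 ∧ frameB j k = 0) ∨
    (frameA j k = -1 ∧ frameB j k = 0) ∨ (frameA j k = 0 ∧ frameB j k = 1) ∨
    (frameA j k = 0 ∧ frameB j k = -1) := by decide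
  rcases hu₂.eq_or_lt with h0 | hpos
  · have h1 : frameA i = frameA j := by
      ext k
      have := h k
      rw [← h0, zero_mul, zero_mul, add_zero, add_zero] at this
      exact_mod_cast mul_left_cancel₀ hu₁.ne' this
    have h2 : frameAxis i = frameAxis j := hij.resolve_right (by rw [← h0]; exact lt_irrefl _)
    have : ∀ i j, frameA i = frameA j → frameAxis i = frameAxis j → i = j := by decide
    exact this i j h1 h2
  · have h1 : frameA i + frameB i = frameA j + frameB j := by
      ext k
      have hk := h k
      rw [Pi.add_apply, Pi.add_apply]
      rcases hcases i k with ⟨e1, e2⟩ | ⟨e1, e2⟩ | ⟨e1, e2⟩ | ⟨e1, e2⟩ | ⟨e1, e2⟩ <;>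
      rcases hcases j k with ⟨e3, e4⟩ | ⟨e3, e4⟩ | ⟨e3, e4⟩ | ⟨e3, e4⟩ | ⟨e3, e4⟩ <;>
      rw [e1, e2, e3, e4] at hk ⊢ <;> first | rfl | (exfalso; push_cast at hk; linarith)
    have : ∀ i j, frameA i + frameB i = frameA j + frameB j → i = j := by decide
    exact this i j h1

/-- Each nonzero vector in a coordinate plane lies in the half-open first quadrant of exactly one of
the four frames of that plane. If the frame is turned by a quarter turn against the coordinate
axes, the slope is that of the vector turned likewise. -/
theorem exists_frame (a : Fin 3) {v : E3} (hv : v ≠ 0) (hva : v (a + 2) = 0) :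
    ∃ j, frameAxis j = a ∧ ∃ u₁ u₂ : ℝ, 0 < u₁ ∧ 0 ≤ u₂ ∧
      v = u₁ • vec (frameA j) + u₂ • vec (frameB j) ∧
      (planarSlope (v a) (v (a + 1)) = planarSlope u₁ u₂ ∨
        planarSlope (v a) (v (a + 1)) = planarSlope u₂ (-u₁)) := by
  have hneg : ∀ x y : ℝ, planarSlope (-x) (-y) = planarSlope x y := by
    intro x y; simp [planarSlope]
  have hv' : v a ≠ 0 ∨ v (a + 1) ≠ 0 := by
    by_contra hcon
    push Not at hcon
    apply hv
    ext i
    have : i = a ∨ i = a + 1 ∨ i = a + 2 := by clear * -; revert i a; decide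
    rcases this with rfl | rfl | rfl
    exacts [hcon.1, hcon.2, hva]
  have htab : ∀ a : Fin 3, ∃ j₀ j₁ : ZMod 12, (frameAxis j₀ = a ∧ frameAxis (j₀ + 6) = a ∧
      frameAxis j₁ = a ∧ frameAxis (j₁ + 6) = a) ∧
      (frameA j₀ = Pi.single a 1 ∧ frameB j₀ = Pi.single (a + 1) 1 ∧
        frameA j₁ = Pi.single (a + 1) 1 ∧ frameB j₁ = -Pi.single a 1) ∧
      (frameA (j₀ + 6) = -Pi.single a 1 ∧ frameB (j₀ + 6) = -Pi.single (a + 1) 1 ∧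
        frameA (j₁ + 6) = -Pi.single (a + 1) 1 ∧ frameB (j₁ + 6) = Pi.single a 1) := by decide
  have hdec : ∀ x y : ℝ, x = v a → y = v (a + 1) →
      v = x • vec (Pi.single a 1) + y • vec (Pi.single (a + 1) 1) := by
    rintro x y rfl rfl
    ext i
    have : i = a ∨ i = a + 1 ∨ i = a + 2 := by clear * -; revert i a; decide
    have h01 : a + 1 ≠ a := by clear * -; revert a; decide
    have h02 : a + 2 ≠ a := by clear * -; revert a; decide
    have h12 : a + 2 ≠ a + 1 := by clear * -; revert a; decide
    rcases this with rfl | rfl | rfl <;> simp [vec_apply, hva, h01, h02, h12, h01.symm]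
  have hvneg : ∀ n, vec (-n) = -vec n := by intro n; ext i; simp [vec_apply]
  obtain ⟨j₀, j₁, ⟨a1, a2, a3, a4⟩, ⟨f1, f2, f3, f4⟩, f5, f6, f7, f8⟩ := htab a
  have hd := hdec _ _ rfl rfl
  set x := v a
  set y := v (a + 1)
  by_cases h1 : 0 < x ∧ 0 ≤ y
  · refine ⟨j₀, a1, x, y, h1.1, h1.2, ?_, Or.inl rfl⟩
    rw [f1, f2]; exact hd
  by_cases h2 : x < 0 ∧ y ≤ 0
  · refine ⟨j₀ + 6, a2, -x, -y, by linarith, by linarith, ?_, Or.inl (hneg _ _).symm⟩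
    rw [f5, f6, hvneg, hvneg, smul_neg, smul_neg, neg_smul, neg_smul, neg_neg, neg_neg]; exact hd
  by_cases h3 : x ≤ 0 ∧ 0 < y
  · refine ⟨j₁, a3, y, -x, h3.2, by linarith, ?_, Or.inr ?_⟩
    · rw [f3, f4, hvneg, smul_neg, neg_smul, neg_neg, add_comm]; exact hd
    · rw [hneg]
  · have h4 : 0 ≤ x ∧ y < 0 := by
      rcases lt_trichotomy x 0 with hx | hx | hx <;> rcases lt_trichotomy y 0 with hy | hy | hy
      all_goals first
        | exact ⟨by linarith, by linarith⟩
        | exact absurd (⟨by linarith, by linarith⟩ : x < 0 ∧ y ≤ 0) h2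
        | exact absurd (⟨by linarith, by linarith⟩ : 0 < x ∧ 0 ≤ y) h1
        | exact absurd (⟨by linarith, by linarith⟩ : x ≤ 0 ∧ 0 < y) h3
        | exact absurd hv' (by simp [hx, hy])
    refine ⟨j₁ + 6, a4, -y, x, by linarith, h4.1, ?_, Or.inr ?_⟩
    · rw [f7, f8, hvneg, smul_neg, neg_smul, neg_neg, add_comm]; exact hd
    · rw [neg_neg]

/-! ### Geodesics near a point -/

theorem pt_add (σ : State) (x y p q : ℝ) :
    pt σ (x + p) (y + q) = pt σ x y + p • vec (frameA σ.2) + q • vec (frameB σ.2) := by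
  simp only [pt, add_smul]; abel

theorem inner_frameA (j : ZMod 12) : ⟪vec (frameA j), vec (frameA j)⟫ = 1 := by
  rw [inner_vec]
  have : ∀ j, ∑ i, frameA j i * frameA j i = 1 := by decide
  rw [this]; simp

theorem inner_frameB (j : ZMod 12) : ⟪vec (frameB j), vec (frameB j)⟫ = 1 := by
  rw [inner_vec]
  have : ∀ j, ∑ i, frameB j i * frameB j i = 1 := by decide
  rw [this]; simp

theorem inner_frameA_frameB (j : ZMod 12) : ⟪vec (frameA j), vec (frameB j)⟫ = 0 := by
  rw [inner_vec]
  have : ∀ j, ∑ i, frameA j i * frameB j i = 0 := by decide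
  rw [this]; simp

theorem inner_frameA_cross (j : ZMod 12) :
    ⟪vec (frameA j), vec (frameA (j + altSign j * 1))⟫ = 0 := by
  rw [inner_vec]
  have : ∀ j, ∑ i, frameA j i * frameA (j + altSign j * 1) i = 0 := by decide
  rw [this]; simp

theorem inner_frameB_cross (j : ZMod 12) :
    ⟪vec (frameB j), vec (frameB (j + altSign j * -1))⟫ = 0 := by
  rw [inner_vec]
  have : ∀ j, ∑ i, frameB j i * frameB (j + altSign j * -1) i = 0 := by decide
  rw [this]; simp

section Local

variable {γ : ℝ → E3} {s : ℝ} {σ : State}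

/-- Near a point interior to a face, a geodesic is a unit-speed straight line. -/
theorem IsNonsingularGeodesic.eventually_inside (hγ : IsNonsingularGeodesic γ) (hσ : IsFace σ)
    {x y : ℝ} (hs : γ s = pt σ x y) (hx : -1 / 2 < x ∧ x < 1 / 2) (hy : -1 / 2 < y ∧ y < 1 / 2) :
    ∃ a b : ℝ, a ^ 2 + b ^ 2 = 1 ∧ ∀ᶠ t in 𝓝 s, γ t = γ s +
      ((t - s) * a) • vec (frameA σ.2) + ((t - s) * b) • vec (frameB σ.2) := by
  obtain ⟨-, -, φ, ⟨hφ, -⟩, u, hu, h⟩ := hγ s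
  have hps : γ s ∈ (face σ).carrier := by
    rw [hs, hσ.mem_carrier_iff]
    exact ⟨x, y, ⟨hx.1.le, hx.2.le⟩, ⟨hy.1.le, hy.2.le⟩, rfl⟩
  have hm : 0 < min (1 / 2 - x) (1 / 2 - y) := lt_min (by linarith [hx.2]) (by linarith [hy.2])
  have h1 := min_le_left (1 / 2 - x) (1 / 2 - y)
  have h2 := min_le_right (1 / 2 - x) (1 / 2 - y)
  refine straight_inside (S := (face σ).carrier) (hφ _ hσ.isConstituent hps) hm (inner_frameA _)
    (inner_frameB _) (inner_frameA_frameB _) hps ?_ ?_ ?_ hu ?_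
  · rw [hs, hσ.mem_carrier_iff]
    refine ⟨x + min (1 / 2 - x) (1 / 2 - y), y + 0, ⟨by linarith [hx.1], by linarith⟩,
      ⟨by linarith [hy.1], by linarith [hy.2]⟩, ?_⟩
    rw [pt_add, zero_smul, add_zero]
  · rw [hs, hσ.mem_carrier_iff]
    refine ⟨x + 0, y + min (1 / 2 - x) (1 / 2 - y), ⟨by linarith [hx.1], by linarith [hx.2]⟩,
      ⟨by linarith [hy.1], by linarith⟩, ?_⟩
    rw [pt_add, zero_smul, add_zero]
  · intro q hq
    obtain ⟨x', y', -, -, rfl⟩ := (hσ.mem_carrier_iff q).mp hq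
    refine ⟨x' - x, y' - y, ?_⟩
    rw [hs, ← pt_add]
    congr 1 <;> ring
  · filter_upwards [h] with t ⟨⟨T, hT, hsT, htT⟩, h4⟩
    rw [hs] at hsT
    rw [hσ.eq_face_of_inside hx hy hT hsT] at htT
    exact ⟨htT, h4⟩

/-- Near a point interior to an edge, a geodesic is a straight line in the union of the two faces
unfolded along that edge. Here `Q` is the midpoint of the edge and `e` its direction, `M` is the
outward normal of the first face and `N` the inward normal of the second. -/
theorem IsNonsingularGeodesic.eventually_across (hγ : IsNonsingularGeodesic γ)
    {S₁ S₂ : UnitSquare} (h₁ : S₁.IsConstituent) (h₂ : S₂.IsConstituent) {Q M N e : E3}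
    (hM : ⟪M, M⟫ = 1) (hN : ⟪N, N⟫ = 1) (he : ⟪e, e⟫ = 1) (heM : ⟪e, M⟫ = 0) (heN : ⟪e, N⟫ = 0)
    (hMN : ⟪M, N⟫ = 0) {y : ℝ} (hy : -1 / 2 < y ∧ y < 1 / 2) (hs : γ s = Q + y • e)
    (hS₁ : ∀ p, p ∈ S₁.carrier ↔ ∃ a b : ℝ, (0 ≤ a ∧ a ≤ 1) ∧ (-1 / 2 ≤ b ∧ b ≤ 1 / 2) ∧
      p = Q + a • -M + b • e)
    (hS₂ : ∀ p, p ∈ S₂.carrier ↔ ∃ a b : ℝ, (0 ≤ a ∧ a ≤ 1) ∧ (-1 / 2 ≤ b ∧ b ≤ 1 / 2) ∧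
      p = Q + a • N + b • e)
    (hT : ∀ T : UnitSquare, T.IsConstituent → γ s ∈ T.carrier → T = S₁ ∨ T = S₂) :
    ∃ a b : ℝ, ∀ᶠ t in 𝓝 s, γ t = γ s + ((t - s) * a) • e +
      (max (-((t - s) * b)) 0) • -M + (max ((t - s) * b) 0) • N := by
  obtain ⟨-, -, φ, ⟨hφ, hinj⟩, u, -, h⟩ := hγ s
  have hp₁ : γ s ∈ S₁.carrier :=
    (hS₁ _).mpr ⟨0, y, by norm_num, ⟨hy.1.le, hy.2.le⟩, by rw [hs]; simp⟩
  have hp₂ : γ s ∈ S₂.carrier :=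
    (hS₂ _).mpr ⟨0, y, by norm_num, ⟨hy.1.le, hy.2.le⟩, by rw [hs]; simp⟩
  have hm : 0 < 1 / 2 - y := by linarith [hy.2]
  have hm1 : 1 / 2 - y ≤ 1 := by linarith [hy.1]
  refine straight_across (u := u) (S₁ := S₁.carrier) (S₂ := S₂.carrier) (hφ _ h₁ hp₁) (hφ _ h₂ hp₂)
    (hinj.mono ?_) hm he ?_ hN ?_ heN ?_ hp₁ hp₂ ?_ ?_ ?_ ?_ ?_ ?_ ?_
  · rintro q (hq | hq)
    exacts [⟨S₁, h₁, hp₁, hq⟩, ⟨S₂, h₂, hp₂, hq⟩]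
  · rw [inner_neg_neg, hM]
  · rw [inner_neg_right, heM, neg_zero]
  · rw [inner_neg_left, hMN, neg_zero]
  · refine (hS₁ _).mpr ⟨0, 1 / 2, by norm_num, by norm_num, ?_⟩
    rw [hs, zero_smul, add_zero, add_assoc, ← add_smul]; congr 2; ring
  · refine (hS₂ _).mpr ⟨0, 1 / 2, by norm_num, by norm_num, ?_⟩
    rw [hs, zero_smul, add_zero, add_assoc, ← add_smul]; congr 2; ring
  · refine (hS₁ _).mpr ⟨1 / 2 - y, y, ⟨hm.le, hm1⟩, ⟨hy.1.le, hy.2.le⟩, ?_⟩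
    rw [hs]; abel
  · refine (hS₂ _).mpr ⟨1 / 2 - y, y, ⟨hm.le, hm1⟩, ⟨hy.1.le, hy.2.le⟩, ?_⟩
    rw [hs]; abel
  · intro q hq
    obtain ⟨a, b, ha, -, rfl⟩ := (hS₁ q).mp hq
    refine ⟨b - y, a, ha.1, ?_⟩
    rw [hs, sub_smul]; abel
  · intro q hq
    obtain ⟨a, b, ha, -, rfl⟩ := (hS₂ q).mp hq
    refine ⟨b - y, a, ha.1, ?_⟩
    rw [hs, sub_smul]; abel
  · filter_upwards [h] with t ⟨⟨T, hT', hsT, htT⟩, h4⟩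
    refine ⟨?_, h4⟩
    rcases hT T hT' hsT with rfl | rfl
    exacts [Or.inl htT, Or.inr htT]

theorem IsNonsingularGeodesic.eventually_crossA (hγ : IsNonsingularGeodesic γ) (hσ : IsFace σ)
    {y : ℝ} (hs : γ s = pt σ (1 / 2) y) (hy : -1 / 2 < y ∧ y < 1 / 2) :
    ∃ a b : ℝ, ∀ᶠ t in 𝓝 s, γ t = γ s + ((t - s) * a) • vec (frameB σ.2) +
      (max (-((t - s) * b)) 0) • -vec (frameA σ.2) +
      (max ((t - s) * b) 0) • vec (frameA (crossA σ).2) := by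
  have hB : frameB (crossA σ).2 = frameB σ.2 := frameB_add _
  refine hγ.eventually_across hσ.isConstituent hσ.crossA.isConstituent (Q := pt σ (1 / 2) 0)
    (inner_frameA _) (inner_frameA _) (inner_frameB _) ?_ ?_ (inner_frameA_cross _) hy ?_ ?_ ?_ ?_
  · rw [real_inner_comm]; exact inner_frameA_frameB _
  · rw [real_inner_comm, ← hB]; exact inner_frameA_frameB _
  · rw [hs]
    have := pt_add σ (1 / 2) 0 0 y
    rw [add_zero, zero_add, zero_smul, add_zero] at this
    exact this
  · intro p
    rw [hσ.mem_carrier_iff]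
    have key : ∀ x z : ℝ, pt σ (1 / 2 - x) z = pt σ (1 / 2) 0 + x • -vec (frameA σ.2) +
        z • vec (frameB σ.2) := by
      intro x z
      have := pt_add σ (1 / 2) 0 (-x) z
      rw [zero_add, ← sub_eq_add_neg, neg_smul, ← smul_neg] at this
      exact this
    constructor
    · rintro ⟨x, z, hx, hz, rfl⟩
      refine ⟨1 / 2 - x, z, ⟨by linarith, by linarith⟩, hz, ?_⟩
      rw [← key, sub_sub_cancel]
    · rintro ⟨x, z, hx, hz, rfl⟩
      exact ⟨1 / 2 - x, z, ⟨by linarith, by linarith⟩, hz, (key x z).symm⟩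
  · intro p
    rw [hσ.crossA.mem_carrier_iff]
    have key : ∀ x z : ℝ, pt (crossA σ) (-1 / 2 + x) z = pt σ (1 / 2) 0 +
        x • vec (frameA (crossA σ).2) + z • vec (frameB σ.2) := by
      intro x z
      have := pt_add (crossA σ) (-1 / 2) 0 x z
      rw [zero_add, pt_crossA, hB] at this
      exact this
    constructor
    · rintro ⟨x, z, hx, hz, rfl⟩
      refine ⟨x + 1 / 2, z, ⟨by linarith, by linarith⟩, hz, ?_⟩
      rw [← key]; congr 1; ring
    · rintro ⟨x, z, hx, hz, rfl⟩
      exact ⟨-1 / 2 + x, z, ⟨by linarith, by linarith⟩, hz, (key x z).symm⟩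
  · intro T hT hsT
    rw [hs] at hsT
    exact hσ.eq_face_of_edgeA hy hT hsT

theorem IsNonsingularGeodesic.eventually_crossB (hγ : IsNonsingularGeodesic γ) (hσ : IsFace σ)
    {x : ℝ} (hs : γ s = pt σ x (1 / 2)) (hx : -1 / 2 < x ∧ x < 1 / 2) :
    ∃ a b : ℝ, ∀ᶠ t in 𝓝 s, γ t = γ s + ((t - s) * a) • vec (frameA σ.2) +
      (max (-((t - s) * b)) 0) • -vec (frameB σ.2) +
      (max ((t - s) * b) 0) • vec (frameB (crossB σ).2) := by
  have hA : frameA (crossB σ).2 = frameA σ.2 := frameA_sub _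
  refine hγ.eventually_across hσ.isConstituent hσ.crossB.isConstituent (Q := pt σ 0 (1 / 2))
    (inner_frameB _) (inner_frameB _) (inner_frameA _) (inner_frameA_frameB _) ?_
    (inner_frameB_cross _) hx ?_ ?_ ?_ ?_
  · rw [← hA]; exact inner_frameA_frameB _
  · rw [hs]
    have := pt_add σ 0 (1 / 2) x 0
    rw [add_zero, zero_add, zero_smul, add_zero] at this
    exact this
  · intro p
    rw [hσ.mem_carrier_iff]
    have key : ∀ x z : ℝ, pt σ z (1 / 2 - x) = pt σ 0 (1 / 2) + x • -vec (frameB σ.2) +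
        z • vec (frameA σ.2) := by
      intro x z
      have := pt_add σ 0 (1 / 2) z (-x)
      rw [zero_add, ← sub_eq_add_neg, neg_smul, ← smul_neg, add_right_comm] at this
      exact this
    constructor
    · rintro ⟨x, z, hx, hz, rfl⟩
      refine ⟨1 / 2 - z, x, ⟨by linarith, by linarith⟩, hx, ?_⟩
      rw [← key, sub_sub_cancel]
    · rintro ⟨x, z, hx, hz, rfl⟩
      exact ⟨z, 1 / 2 - x, hz, ⟨by linarith, by linarith⟩, (key x z).symm⟩
  · intro p
    rw [hσ.crossB.mem_carrier_iff]
    have key : ∀ x z : ℝ, pt (crossB σ) z (-1 / 2 + x) = pt σ 0 (1 / 2) +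
        x • vec (frameB (crossB σ).2) + z • vec (frameA σ.2) := by
      intro x z
      have := pt_add (crossB σ) 0 (-1 / 2) z x
      rw [zero_add, pt_crossB, hA, add_right_comm] at this
      exact this
    constructor
    · rintro ⟨x, z, hx, hz, rfl⟩
      refine ⟨z + 1 / 2, x, ⟨by linarith, by linarith⟩, hx, ?_⟩
      rw [← key]; congr 1; ring
    · rintro ⟨x, z, hx, hz, rfl⟩
      exact ⟨z, -1 / 2 + x, hz, ⟨by linarith, by linarith⟩, (key x z).symm⟩
  · intro T hT hsT
    rw [hs] at hsT
    exact hσ.eq_face_of_edgeB hx hT hsT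

/-- For a straight line, a velocity before time `s` is the same as a velocity after it. -/
theorem eventually_lt_iff_eventually_ge_of_inside {A B : E3} (hA : ⟪A, A⟫ = 1) (hB : ⟪B, B⟫ = 1)
    (hAB : ⟪A, B⟫ = 0) {a b : ℝ}
    (h : ∀ᶠ t in 𝓝 s, γ t = γ s + ((t - s) * a) • A + ((t - s) * b) • B) (u₁ u₂ : ℝ) :
    (∀ᶠ t in 𝓝[<] s, γ t = γ s + ((t - s) * u₁) • A + ((t - s) * u₂) • B) ↔
      ∀ᶠ t in 𝓝[≥] s, γ t = γ s + ((t - s) * u₁) • A + ((t - s) * u₂) • B := by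
  have hBA : ⟪B, A⟫ = 0 := by rw [real_inner_comm]; exact hAB
  have key : ∀ t, t ≠ s → γ t = γ s + ((t - s) * a) • A + ((t - s) * b) • B →
      γ t = γ s + ((t - s) * u₁) • A + ((t - s) * u₂) • B → a = u₁ ∧ b = u₂ := by
    intro t ht h1 h2
    rw [h1, add_assoc, add_assoc] at h2
    have h3 := add_left_cancel h2
    have h4 := congrArg (fun v => ⟪A, v⟫) h3
    have h5 := congrArg (fun v => ⟪B, v⟫) h3
    simp only [inner_add_right, inner_smul_right, hA, hB, hAB, hBA, mul_one, mul_zero, add_zero,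
      zero_add] at h4 h5
    have h6 := sub_ne_zero.mpr ht
    exact ⟨mul_left_cancel₀ h6 h4, mul_left_cancel₀ h6 h5⟩
  constructor
  · intro h1
    obtain ⟨t, ⟨ht1, ht2⟩, ht3⟩ := ((h1.and (h.filter_mono nhdsWithin_le_nhds)).and
      self_mem_nhdsWithin).exists
    obtain ⟨rfl, rfl⟩ := key t (ne_of_lt ht3) ht2 ht1
    exact h.filter_mono nhdsWithin_le_nhds
  · intro h1
    have h1' := h1.filter_mono (nhdsWithin_mono s Set.Ioi_subset_Ici_self)
    obtain ⟨t, ⟨ht1, ht2⟩, ht3⟩ := ((h1'.and (h.filter_mono nhdsWithin_le_nhds)).and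
      self_mem_nhdsWithin).exists
    obtain ⟨rfl, rfl⟩ := key t (ne_of_gt ht3) ht2 ht1
    exact h.filter_mono nhdsWithin_le_nhds

/-- A geodesic reaches an edge through the first face with velocity `u₁ • M + u₂ • e` if and only if
it leaves it through the second face with velocity `u₁ • N + u₂ • e`. -/
theorem eventually_lt_iff_eventually_ge_of_across {M N e : E3} (hM : ⟪M, M⟫ = 1) (hN : ⟪N, N⟫ = 1)
    (he : ⟪e, e⟫ = 1) (heM : ⟪e, M⟫ = 0) (heN : ⟪e, N⟫ = 0) (hMN : ⟪M, N⟫ = 0) {a b : ℝ}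
    (h : ∀ᶠ t in 𝓝 s, γ t = γ s + ((t - s) * a) • e +
      (max (-((t - s) * b)) 0) • -M + (max ((t - s) * b) 0) • N) {u₁ : ℝ} (hu₁ : 0 < u₁) (u₂ : ℝ) :
    (∀ᶠ t in 𝓝[<] s, γ t = γ s + ((t - s) * u₁) • M + ((t - s) * u₂) • e) ↔
      ∀ᶠ t in 𝓝[≥] s, γ t = γ s + ((t - s) * u₁) • N + ((t - s) * u₂) • e := by
  have hMe : ⟪M, e⟫ = 0 := by rw [real_inner_comm]; exact heM
  have hNe : ⟪N, e⟫ = 0 := by rw [real_inner_comm]; exact heN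
  have hNM : ⟪N, M⟫ = 0 := by rw [real_inner_comm]; exact hMN
  constructor
  · intro h1
    obtain ⟨t, ⟨h1, h2⟩, h3⟩ := ((h1.and (h.filter_mono nhdsWithin_le_nhds)).and
      self_mem_nhdsWithin).exists
    have ht : t - s < 0 := sub_neg.mpr h3
    rw [h1, add_assoc, add_assoc, add_assoc] at h2
    have h2 := add_left_cancel h2
    have h4 := congrArg (fun v => ⟪M, v⟫) h2
    have h5 := congrArg (fun v => ⟪N, v⟫) h2
    have h6 := congrArg (fun v => ⟪e, v⟫) h2
    simp only [inner_add_right, inner_smul_right, inner_neg_right, hM, hN, he, heM, heN, hMN, hMe,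
      hNe, hNM, mul_one, mul_zero, add_zero, zero_add, neg_zero, mul_neg] at h4 h5 h6
    obtain rfl : u₂ = a := mul_left_cancel₀ ht.ne h6
    have h7 : (t - s) * b ≤ 0 := by rw [h5]; exact le_max_left _ _
    rw [max_eq_left (by linarith), neg_neg] at h4
    obtain rfl : u₁ = b := mul_left_cancel₀ ht.ne h4
    filter_upwards [h.filter_mono nhdsWithin_le_nhds, self_mem_nhdsWithin] with r hr hr'
    have h8 : 0 ≤ (r - s) * u₁ := mul_nonneg (sub_nonneg.mpr hr') hu₁.le
    rw [hr, max_eq_right (by linarith), max_eq_left h8, zero_smul, add_zero]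
    abel
  · intro h1
    have h1 := h1.filter_mono (nhdsWithin_mono s Set.Ioi_subset_Ici_self)
    obtain ⟨t, ⟨h1, h2⟩, h3⟩ := ((h1.and (h.filter_mono nhdsWithin_le_nhds)).and
      self_mem_nhdsWithin).exists
    have ht : 0 < t - s := sub_pos.mpr h3
    rw [h1, add_assoc, add_assoc, add_assoc] at h2
    have h2 := add_left_cancel h2
    have h4 := congrArg (fun v => ⟪M, v⟫) h2
    have h5 := congrArg (fun v => ⟪N, v⟫) h2
    have h6 := congrArg (fun v => ⟪e, v⟫) h2
    simp only [inner_add_right, inner_smul_right, inner_neg_right, hM, hN, he, heM, heN, hMN, hMe,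
      hNe, hNM, mul_one, mul_zero, add_zero, zero_add, neg_zero, mul_neg] at h4 h5 h6
    obtain rfl : u₂ = a := mul_left_cancel₀ ht.ne' h6
    have h7 : -((t - s) * b) ≤ 0 := by
      have := le_max_left (-((t - s) * b)) 0
      linarith
    rw [max_eq_left (by linarith)] at h5
    obtain rfl : u₁ = b := mul_left_cancel₀ ht.ne' h5
    filter_upwards [h.filter_mono nhdsWithin_le_nhds, self_mem_nhdsWithin] with r hr hr'
    have h8 : (r - s) * u₁ ≤ 0 :=
      mul_nonpos_of_nonpos_of_nonneg (sub_nonpos.mpr (le_of_lt hr')) hu₁.le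
    rw [hr, max_eq_left (by linarith), max_eq_right h8, zero_smul, add_zero, neg_smul, smul_neg,
      neg_neg]
    abel

theorem exists_affine_of_across {M N e : E3} {a b : ℝ}
    (h : ∀ᶠ t in 𝓝 s, γ t = γ s + ((t - s) * a) • e +
      (max (-((t - s) * b)) 0) • -M + (max ((t - s) * b) 0) • N) :
    (∃ w, ∀ᶠ t in 𝓝[<] s, γ t = γ s + (t - s) • w) ∧
      ∃ w, ∀ᶠ t in 𝓝[>] s, γ t = γ s + (t - s) • w := by
  constructor
  · refine ⟨a • e + (-max b 0) • -M + (-max (-b) 0) • N, ?_⟩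
    filter_upwards [h.filter_mono nhdsWithin_le_nhds, self_mem_nhdsWithin] with t h1 h2
    have h3 : 0 ≤ s - t := sub_nonneg.mpr (le_of_lt h2)
    have e1 : max (-((t - s) * b)) 0 = (t - s) * -max b 0 := by
      rw [show -((t - s) * b) = (s - t) * b by ring,
        show (t - s) * -max b 0 = (s - t) * max b 0 by ring,
        mul_max_of_nonneg _ _ h3, mul_zero]
    have e2 : max ((t - s) * b) 0 = (t - s) * -max (-b) 0 := by
      rw [show (t - s) * b = (s - t) * -b by ring,
        show (t - s) * -max (-b) 0 = (s - t) * max (-b) 0 by ring,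
        mul_max_of_nonneg _ _ h3, mul_zero]
    rw [h1, e1, e2, smul_add, smul_add, smul_smul, smul_smul, smul_smul]
    abel
  · refine ⟨a • e + (max (-b) 0) • -M + (max b 0) • N, ?_⟩
    filter_upwards [h.filter_mono nhdsWithin_le_nhds, self_mem_nhdsWithin] with t h1 h2
    have h3 : 0 ≤ t - s := sub_nonneg.mpr (le_of_lt h2)
    have e1 : max (-((t - s) * b)) 0 = (t - s) * max (-b) 0 := by
      rw [mul_max_of_nonneg _ _ h3, mul_zero, mul_neg]
    have e2 : max ((t - s) * b) 0 = (t - s) * max b 0 := by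
      rw [mul_max_of_nonneg _ _ h3, mul_zero]
    rw [h1, e1, e2, smul_add, smul_add, smul_smul, smul_smul, smul_smul]
    abel

/-- A geodesic is straight on both sides of each time. -/
theorem IsNonsingularGeodesic.exists_affine (hγ : IsNonsingularGeodesic γ) (s : ℝ) :
    (∃ w, ∀ᶠ t in 𝓝[<] s, γ t = γ s + (t - s) • w) ∧
      ∃ w, ∀ᶠ t in 𝓝[>] s, γ t = γ s + (t - s) • w := by
  obtain ⟨h1, h2, -⟩ := hγ s
  obtain ⟨σ, x, y, hσ, hp, ⟨hx, hy⟩ | ⟨rfl, hy⟩ | ⟨hx, rfl⟩⟩ := exists_position h1 h2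
  · obtain ⟨a, b, -, h⟩ := hγ.eventually_inside hσ hp hx hy
    have : ∀ᶠ t in 𝓝 s, γ t = γ s + (t - s) • (a • vec (frameA σ.2) + b • vec (frameB σ.2)) := by
      filter_upwards [h] with t ht
      rw [ht, smul_add, smul_smul, smul_smul, add_assoc]
    exact ⟨⟨_, this.filter_mono nhdsWithin_le_nhds⟩, ⟨_, this.filter_mono nhdsWithin_le_nhds⟩⟩
  · obtain ⟨a, b, h⟩ := hγ.eventually_crossA hσ hp hy
    exact exists_affine_of_across h
  · obtain ⟨a, b, h⟩ := hγ.eventually_crossB hσ hp hx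
    exact exists_affine_of_across h

end Local

/-! ### Fractional parts along a line -/

section Floor

variable {a u s : ℝ}

theorem eventually_floor_ge (hu : 0 ≤ u) : ∀ᶠ t in 𝓝[≥] s, ⌊a + u * t⌋ = ⌊a + u * s⌋ := by
  have hc : Continuous fun t : ℝ => a + u * t := by fun_prop
  have h2 := Int.lt_floor_add_one (a + u * s)
  filter_upwards [(hc.continuousAt.eventually (gt_mem_nhds h2)).filter_mono nhdsWithin_le_nhds,
    self_mem_nhdsWithin] with t h3 h4
  rw [Int.floor_eq_iff]
  refine ⟨(Int.floor_le _).trans ?_, h3⟩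
  have := mul_le_mul_of_nonneg_left (show s ≤ t from h4) hu
  linarith

theorem eventually_floor_lt (hu : 0 < u) {k : ℤ} (hk : a + u * s = k) :
    ∀ᶠ t in 𝓝[<] s, ⌊a + u * t⌋ = ⌊a + u * s⌋ - 1 := by
  have hc : Continuous fun t : ℝ => a + u * t := by fun_prop
  have h2 : (k : ℝ) - 1 < a + u * s := by linarith
  filter_upwards [(hc.continuousAt.eventually (lt_mem_nhds h2)).filter_mono nhdsWithin_le_nhds,
    self_mem_nhdsWithin] with t h3 h4
  rw [hk, Int.floor_intCast, Int.floor_eq_iff]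
  have := mul_lt_mul_of_pos_left (show t < s from h4) hu
  push_cast
  exact ⟨h3.le, by linarith⟩

theorem eventually_floor_of_not_int (hs : ¬ ∃ k : ℤ, a + u * s = k) :
    ∀ᶠ t in 𝓝 s, ⌊a + u * t⌋ = ⌊a + u * s⌋ :=
  eventually_floor_eq (by fun_prop) hs

theorem eventually_fract_ge (hu : 0 ≤ u) :
    ∀ᶠ t in 𝓝[≥] s, Int.fract (a + u * t) = Int.fract (a + u * s) + (t - s) * u := by
  filter_upwards [eventually_floor_ge (a := a) hu] with t ht
  rw [← Int.self_sub_floor, ← Int.self_sub_floor, ht]; ring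

theorem eventually_fract_of_not_int (hs : ¬ ∃ k : ℤ, a + u * s = k) :
    ∀ᶠ t in 𝓝 s, Int.fract (a + u * t) = Int.fract (a + u * s) + (t - s) * u := by
  filter_upwards [eventually_floor_of_not_int hs] with t ht
  rw [← Int.self_sub_floor, ← Int.self_sub_floor, ht]; ring

theorem eventually_fract_lt (hu : 0 < u) {k : ℤ} (hk : a + u * s = k) :
    ∀ᶠ t in 𝓝[<] s, Int.fract (a + u * t) = 1 + (t - s) * u := by
  filter_upwards [eventually_floor_lt hu hk] with t ht
  rw [← Int.self_sub_floor, ht, hk, Int.floor_intCast]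
  push_cast
  rw [← hk]; ring

theorem exists_eventually_fract_lt (a s : ℝ) (hu : 0 ≤ u) :
    ∃ c, ∀ᶠ t in 𝓝[<] s, Int.fract (a + u * t) = c + (t - s) * u := by
  by_cases hs : ∃ k : ℤ, a + u * s = k
  · rcases hu.eq_or_lt with rfl | hpos
    · exact ⟨Int.fract a, Eventually.of_forall fun t => by simp⟩
    · obtain ⟨k, hk⟩ := hs
      exact ⟨1, eventually_fract_lt hpos hk⟩
  · exact ⟨_, (eventually_fract_of_not_int hs).filter_mono nhdsWithin_le_nhds⟩

theorem fract_sub_half_mem {r : ℝ} (hr : ¬ ∃ k : ℤ, r = k) :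
    -1 / 2 < Int.fract r - 1 / 2 ∧ Int.fract r - 1 / 2 < 1 / 2 := by
  have h1 : 0 < Int.fract r := by
    refine lt_of_le_of_ne (Int.fract_nonneg r) fun h => hr ⟨⌊r⌋, ?_⟩
    rw [← Int.self_sub_floor] at h; linarith
  have h2 := Int.fract_lt_one r
  constructor <;> linarith

end Floor

/-! ### Developing a geodesic onto a line -/

/-- The point of the face of `σ` that unfolds to `(α, β)`, the face being unfolded to the unit square
with integral vertices that contains `(α, β)`. -/
noncomputable def tilePoint (σ : State) (α β : ℝ) : E3 :=
  pt σ (Int.fract α - 1 / 2) (Int.fract β - 1 / 2)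

/-- From time `s` on, `γ` runs for a while in the face of `σ` and unfolds there to the line
`t ↦ (a + u₁ * t, b + u₂ * t)`. -/
def RightGerm (γ : ℝ → E3) (a u₁ b u₂ : ℝ) (σ : State) (s : ℝ) : Prop :=
  IsFace σ ∧ ∀ᶠ t in 𝓝[≥] s, γ t = tilePoint σ (a + u₁ * t) (b + u₂ * t)

/-- For a while before time `s`, `γ` runs in the face of `σ` and unfolds there to the line
`t ↦ (a + u₁ * t, b + u₂ * t)`. -/
def LeftGerm (γ : ℝ → E3) (a u₁ b u₂ : ℝ) (σ : State) (s : ℝ) : Prop :=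
  IsFace σ ∧ ∀ᶠ t in 𝓝[<] s, γ t = tilePoint σ (a + u₁ * t) (b + u₂ * t)

/-- The change of state at the point `(α, β)` of the developed line, which is not a lattice point. -/
noncomputable def crossing (α β : ℝ) : Equiv.Perm State :=
  open Classical in
  if ∃ k : ℤ, α = k then crossA else if ∃ k : ℤ, β = k then crossB else 1

/-- The direction `(u₁, u₂)` lies in the half-open first quadrant, and a horizontal line does not run
along the edges of the tiling. -/
structure Transversal (u₁ b u₂ : ℝ) : Prop where
  pos : 0 < u₁
  nonneg : 0 ≤ u₂
  avoid : 0 < u₂ ∨ ¬ ∃ k : ℤ, b = k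

section Germs

variable {γ : ℝ → E3} {a u₁ b u₂ s : ℝ} {σ τ : State}

theorem Transversal.pos_of_int (h : Transversal u₁ b u₂) (hs : ∃ k : ℤ, b + u₂ * s = k) :
    0 < u₂ := by
  rcases h.avoid with h1 | h1
  · exact h1
  · rcases h.nonneg.eq_or_lt with h2 | h2
    · rw [← h2] at hs
      exact absurd (by simpa using hs) h1
    · exact h2

theorem IsNonsingularGeodesic.eq_of_eventually_lt (hγ : IsNonsingularGeodesic γ) {P A B : E3}
    (h : ∀ᶠ t in 𝓝[<] s, γ t = P + ((t - s) * u₁) • A + ((t - s) * u₂) • B) : γ s = P := by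
  have h1 : Tendsto γ (𝓝[<] s) (𝓝 (γ s)) := hγ.continuous.continuousAt.mono_left nhdsWithin_le_nhds
  have hc : Continuous fun t : ℝ => P + ((t - s) * u₁) • A + ((t - s) * u₂) • B := by fun_prop
  have h2 : Tendsto (fun t : ℝ => P + ((t - s) * u₁) • A + ((t - s) * u₂) • B) (𝓝[<] s)
      (𝓝 (P + ((s - s) * u₁) • A + ((s - s) * u₂) • B)) :=
    hc.continuousAt.mono_left nhdsWithin_le_nhds
  have h3 := tendsto_nhds_unique (h1.congr' h) h2
  simpa using h3

theorem eq_of_eventually_ge {P A B : E3}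
    (h : ∀ᶠ t in 𝓝[≥] s, γ t = P + ((t - s) * u₁) • A + ((t - s) * u₂) • B) : γ s = P := by
  simpa using h.self_of_nhdsWithin (Set.self_mem_Ici)

/-- A germ of the development written as an affine function of time; `x` and `y` are the one-sided
limits at `s` of the coordinates in the frame. -/
theorem eventually_germ_iff {l : Filter ℝ} {x y : ℝ}
    (h₁ : ∀ᶠ t in l, Int.fract (a + u₁ * t) = x + 1 / 2 + (t - s) * u₁)
    (h₂ : ∀ᶠ t in l, Int.fract (b + u₂ * t) = y + 1 / 2 + (t - s) * u₂) :
    (∀ᶠ t in l, γ t = tilePoint σ (a + u₁ * t) (b + u₂ * t)) ↔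
      ∀ᶠ t in l, γ t = pt σ x y + ((t - s) * u₁) • vec (frameA σ.2) +
        ((t - s) * u₂) • vec (frameB σ.2) := by
  refine eventually_congr ?_
  filter_upwards [h₁, h₂] with t h3 h4
  rw [tilePoint, h3, h4, ← pt_add]
  have e : ∀ z w : ℝ, z + 1 / 2 + w - 1 / 2 = z + w := fun z w => by ring
  rw [e, e]

theorem rightGerm_iff (hT : Transversal u₁ b u₂) :
    RightGerm γ a u₁ b u₂ σ s ↔ IsFace σ ∧ ∀ᶠ t in 𝓝[≥] s, γ t =
      tilePoint σ (a + u₁ * s) (b + u₂ * s) + ((t - s) * u₁) • vec (frameA σ.2) +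
        ((t - s) * u₂) • vec (frameB σ.2) := by
  refine and_congr Iff.rfl (eventually_germ_iff ?_ ?_)
  · simpa using eventually_fract_ge hT.pos.le
  · simpa using eventually_fract_ge hT.nonneg

theorem not_int_of_rightGerm (hγ : IsNonsingularGeodesic γ) (hT : Transversal u₁ b u₂)
    (h : RightGerm γ a u₁ b u₂ σ s) :
    ¬ ((∃ k : ℤ, a + u₁ * s = k) ∧ ∃ k : ℤ, b + u₂ * s = k) := by
  rintro ⟨⟨k, hk⟩, l, hl⟩
  have h1 := eq_of_eventually_ge ((rightGerm_iff hT).mp h).2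
  rw [tilePoint, hk, hl, Int.fract_intCast, Int.fract_intCast] at h1
  refine (hγ s).2.1 ?_
  rw [h1]
  exact h.1.corner_mem_singularities (Or.inr (by norm_num)) (Or.inr (by norm_num))

theorem not_int_of_leftGerm (hγ : IsNonsingularGeodesic γ) (hT : Transversal u₁ b u₂)
    (h : LeftGerm γ a u₁ b u₂ σ s) :
    ¬ ((∃ k : ℤ, a + u₁ * s = k) ∧ ∃ k : ℤ, b + u₂ * s = k) := by
  rintro ⟨⟨k, hk⟩, l, hl⟩
  have h0 := (eventually_germ_iff (s := s) (x := 1 / 2) (y := 1 / 2) (γ := γ) (σ := σ) (by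
      filter_upwards [eventually_fract_lt hT.pos hk] with t ht
      rw [ht]; norm_num) (by
      filter_upwards [eventually_fract_lt (hT.pos_of_int ⟨l, hl⟩) hl] with t ht
      rw [ht]; norm_num)).mp h.2
  have h1 := hγ.eq_of_eventually_lt h0
  refine (hγ s).2.1 ?_
  rw [h1]
  exact h.1.corner_mem_singularities (Or.inl rfl) (Or.inl rfl)

theorem isFace_crossA_iff : IsFace (crossA σ) ↔ IsFace σ :=
  ⟨fun h => by simpa [perm_inv_apply] using h.crossA_inv, IsFace.crossA⟩

theorem isFace_crossB_iff : IsFace (crossB σ) ↔ IsFace σ :=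
  ⟨fun h => by simpa [perm_inv_apply] using h.crossB_inv, IsFace.crossB⟩

/-- The development continues through each point that is not a lattice point. -/
theorem leftGerm_iff_rightGerm (hγ : IsNonsingularGeodesic γ) (hT : Transversal u₁ b u₂)
    (hs : ¬ ((∃ k : ℤ, a + u₁ * s = k) ∧ ∃ k : ℤ, b + u₂ * s = k)) :
    LeftGerm γ a u₁ b u₂ σ s ↔
      RightGerm γ a u₁ b u₂ (crossing (a + u₁ * s) (b + u₂ * s) σ) s := by
  rw [rightGerm_iff hT, LeftGerm]
  by_cases h1 : ∃ k : ℤ, a + u₁ * s = k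
  · have h2 : ¬ ∃ k : ℤ, b + u₂ * s = k := fun h => hs ⟨h1, h⟩
    have hcr : crossing (a + u₁ * s) (b + u₂ * s) = crossA := by rw [crossing, if_pos h1]
    rw [hcr, isFace_crossA_iff]
    refine and_congr_right fun hσ => ?_
    obtain ⟨k, hk⟩ := h1
    have hy := fract_sub_half_mem h2
    set y := Int.fract (b + u₂ * s) - 1 / 2 with hydef
    have hQ : tilePoint (crossA σ) (a + u₁ * s) (b + u₂ * s) = pt σ (1 / 2) y := by
      rw [tilePoint, hk, Int.fract_intCast, ← pt_crossA]; norm_num [hydef]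
    have hB : frameB (crossA σ).2 = frameB σ.2 := frameB_add _
    rw [hQ, hB, eventually_germ_iff (s := s) (x := 1 / 2) (y := y) (by
      filter_upwards [eventually_fract_lt hT.pos hk] with t ht
      rw [ht]; norm_num) (by
      filter_upwards [(eventually_fract_of_not_int h2).filter_mono nhdsWithin_le_nhds] with t ht
      rw [ht, hydef]; ring)]
    have key : γ s = pt σ (1 / 2) y → ((∀ᶠ t in 𝓝[<] s, γ t = pt σ (1 / 2) y +
        ((t - s) * u₁) • vec (frameA σ.2) + ((t - s) * u₂) • vec (frameB σ.2)) ↔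
        ∀ᶠ t in 𝓝[≥] s, γ t = pt σ (1 / 2) y +
        ((t - s) * u₁) • vec (frameA (crossA σ).2) + ((t - s) * u₂) • vec (frameB σ.2)) := by
      intro hp
      obtain ⟨c, d, h⟩ := hγ.eventually_crossA hσ hp hy
      rw [← hp]
      refine eventually_lt_iff_eventually_ge_of_across (inner_frameA _) (inner_frameA _)
        (inner_frameB _) ?_ ?_ (inner_frameA_cross _) h hT.pos u₂
      · rw [real_inner_comm]; exact inner_frameA_frameB _
      · rw [real_inner_comm, ← hB]; exact inner_frameA_frameB _
    exact ⟨fun h => (key (hγ.eq_of_eventually_lt h)).mp h,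
      fun h => (key (eq_of_eventually_ge h)).mpr h⟩
  by_cases h2 : ∃ k : ℤ, b + u₂ * s = k
  · have hcr : crossing (a + u₁ * s) (b + u₂ * s) = crossB := by
      rw [crossing, if_neg h1, if_pos h2]
    rw [hcr, isFace_crossB_iff]
    refine and_congr_right fun hσ => ?_
    have hu₂ := hT.pos_of_int h2
    obtain ⟨k, hk⟩ := h2
    have hx := fract_sub_half_mem h1
    set x := Int.fract (a + u₁ * s) - 1 / 2 with hxdef
    have hQ : tilePoint (crossB σ) (a + u₁ * s) (b + u₂ * s) = pt σ x (1 / 2) := by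
      rw [tilePoint, hk, Int.fract_intCast, ← pt_crossB]; norm_num [hxdef]
    have hA : frameA (crossB σ).2 = frameA σ.2 := frameA_sub _
    rw [hQ, hA, eventually_germ_iff (s := s) (x := x) (y := 1 / 2) (by
      filter_upwards [(eventually_fract_of_not_int h1).filter_mono nhdsWithin_le_nhds] with t ht
      rw [ht, hxdef]; ring) (by
      filter_upwards [eventually_fract_lt hu₂ hk] with t ht
      rw [ht]; norm_num)]
    have key : γ s = pt σ x (1 / 2) → ((∀ᶠ t in 𝓝[<] s, γ t = pt σ x (1 / 2) +
        ((t - s) * u₁) • vec (frameA σ.2) + ((t - s) * u₂) • vec (frameB σ.2)) ↔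
        ∀ᶠ t in 𝓝[≥] s, γ t = pt σ x (1 / 2) +
        ((t - s) * u₁) • vec (frameA σ.2) + ((t - s) * u₂) • vec (frameB (crossB σ).2)) := by
      intro hp
      obtain ⟨c, d, h⟩ := hγ.eventually_crossB hσ hp hx
      rw [← hp]
      simp only [add_right_comm _ ((_ * u₁) • _)]
      refine eventually_lt_iff_eventually_ge_of_across (inner_frameB _) (inner_frameB _)
        (inner_frameA _) (inner_frameA_frameB _) ?_ (inner_frameB_cross _) h hu₂ u₁
      rw [← hA]; exact inner_frameA_frameB _
    exact ⟨fun h => (key (hγ.eq_of_eventually_lt h)).mp h,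
      fun h => (key (eq_of_eventually_ge h)).mpr h⟩
  · have hcr : crossing (a + u₁ * s) (b + u₂ * s) = 1 := by rw [crossing, if_neg h1, if_neg h2]
    rw [hcr, Equiv.Perm.one_apply]
    refine and_congr_right fun hσ => ?_
    have hx := fract_sub_half_mem h1
    have hy := fract_sub_half_mem h2
    rw [tilePoint]
    set x := Int.fract (a + u₁ * s) - 1 / 2 with hxdef
    set y := Int.fract (b + u₂ * s) - 1 / 2 with hydef
    rw [eventually_germ_iff (s := s) (x := x) (y := y) (by
      filter_upwards [(eventually_fract_of_not_int h1).filter_mono nhdsWithin_le_nhds] with t ht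
      rw [ht, hxdef]; ring) (by
      filter_upwards [(eventually_fract_of_not_int h2).filter_mono nhdsWithin_le_nhds] with t ht
      rw [ht, hydef]; ring)]
    have key : γ s = pt σ x y → ((∀ᶠ t in 𝓝[<] s, γ t = pt σ x y +
        ((t - s) * u₁) • vec (frameA σ.2) + ((t - s) * u₂) • vec (frameB σ.2)) ↔
        ∀ᶠ t in 𝓝[≥] s, γ t = pt σ x y +
        ((t - s) * u₁) • vec (frameA σ.2) + ((t - s) * u₂) • vec (frameB σ.2)) := by
      intro hp
      obtain ⟨c, d, -, h⟩ := hγ.eventually_inside hσ hp hx hy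
      rw [← hp]
      exact eventually_lt_iff_eventually_ge_of_inside (inner_frameA _) (inner_frameB _)
        (inner_frameA_frameB _) h u₁ u₂
    exact ⟨fun h => (key (hγ.eq_of_eventually_lt h)).mp h,
      fun h => (key (eq_of_eventually_ge h)).mpr h⟩

theorem RightGerm.eventually_ge (h : RightGerm γ a u₁ b u₂ σ s) :
    ∀ᶠ t in 𝓝[≥] s, RightGerm γ a u₁ b u₂ σ t := by
  filter_upwards [eventually_eventually_nhdsWithin.mpr h.2, self_mem_nhdsWithin] with t h1 h2
  exact ⟨h.1, h1.filter_mono (nhdsWithin_mono t (Set.Ici_subset_Ici.mpr h2))⟩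

theorem LeftGerm.eventually_lt (h : LeftGerm γ a u₁ b u₂ σ s) :
    ∀ᶠ t in 𝓝[<] s, RightGerm γ a u₁ b u₂ σ t := by
  filter_upwards [eventually_eventually_nhdsWithin.mpr h.2, self_mem_nhdsWithin] with t h1 h2
  refine ⟨h.1, ?_⟩
  rw [IsOpen.nhdsWithin_eq isOpen_Iio h2] at h1
  exact h1.filter_mono nhdsWithin_le_nhds

theorem eq_and_eq_of_affine_eq {P P' w w' : E3} {t₁ t₂ : ℝ} (ht : t₁ ≠ t₂)
    (h₁ : P + (t₁ - s) • w = P' + (t₁ - s) • w') (h₂ : P + (t₂ - s) • w = P' + (t₂ - s) • w') :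
    P = P' ∧ w = w' := by
  have h3 : (t₁ - t₂) • (w - w') = 0 := by
    have : (t₁ - t₂) • (w - w') = (P + (t₁ - s) • w - (P' + (t₁ - s) • w')) -
        (P + (t₂ - s) • w - (P' + (t₂ - s) • w')) := by module
    rw [this, h₁, h₂]; simp
  have h4 : w = w' := by
    rcases smul_eq_zero.mp h3 with h | h
    · exact absurd (sub_eq_zero.mp h) ht
    · exact sub_eq_zero.mp h
  rw [h4] at h₁
  exact ⟨add_right_cancel h₁, h4⟩

theorem affine_rearrange (P A B : E3) (r : ℝ) :
    P + (r * u₁) • A + (r * u₂) • B = P + r • (u₁ • A + u₂ • B) := by module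

/-- A development that is valid shortly before time `s` extends up to `s`: both the geodesic and its
development are affine there, and they agree on an open interval of times. -/
theorem eventually_rightGerm_imp_leftGerm (hγ : IsNonsingularGeodesic γ)
    (hT : Transversal u₁ b u₂) (s : ℝ) :
    ∀ᶠ t in 𝓝[<] s, ∀ σ, RightGerm γ a u₁ b u₂ σ t → LeftGerm γ a u₁ b u₂ σ s := by
  obtain ⟨⟨w, hw⟩, -⟩ := hγ.exists_affine s
  obtain ⟨x, hx⟩ := exists_eventually_fract_lt a s hT.pos.le
  obtain ⟨y, hy⟩ := exists_eventually_fract_lt b s hT.nonneg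
  filter_upwards [eventually_eventually_nhdsWithin.mpr hw, eventually_eventually_nhdsWithin.mpr hx,
    eventually_eventually_nhdsWithin.mpr hy, self_mem_nhdsWithin] with t h1 h2 h3 hts σ h
  rw [IsOpen.nhdsWithin_eq isOpen_Iio hts] at h1 h2 h3
  refine ⟨h.1, ?_⟩
  have hG : ∀ r, Int.fract (a + u₁ * r) = x + (r - s) * u₁ →
      Int.fract (b + u₂ * r) = y + (r - s) * u₂ → tilePoint σ (a + u₁ * r) (b + u₂ * r) =
      pt σ (x - 1 / 2) (y - 1 / 2) + (r - s) • (u₁ • vec (frameA σ.2) + u₂ • vec (frameB σ.2)) := by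
    intro r e1 e2
    rw [tilePoint, e1, e2, ← affine_rearrange, ← pt_add]
    congr 1 <;> ring
  have hF : ∀ᶠ r in 𝓝[≥] t, γ s + (r - s) • w = pt σ (x - 1 / 2) (y - 1 / 2) +
      (r - s) • (u₁ • vec (frameA σ.2) + u₂ • vec (frameB σ.2)) := by
    filter_upwards [h1.filter_mono nhdsWithin_le_nhds, h2.filter_mono nhdsWithin_le_nhds,
      h3.filter_mono nhdsWithin_le_nhds, h.2] with r e1 e2 e3 e4
    rw [← e1, e4, hG r e2 e3]
  obtain ⟨r, hr1, hr2⟩ := ((hF.filter_mono (nhdsWithin_mono t Set.Ioi_subset_Ici_self)).and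
    self_mem_nhdsWithin).exists
  obtain ⟨e5, e6⟩ := eq_and_eq_of_affine_eq (ne_of_gt hr2) hr1
    (hF.self_of_nhdsWithin Set.self_mem_Ici)
  filter_upwards [hw, hx, hy] with r e1 e2 e3
  rw [e1, hG r e2 e3, e5, e6]

/-- A development that is valid shortly after time `s` extends back to `s`. -/
theorem eventually_rightGerm_imp_rightGerm (hγ : IsNonsingularGeodesic γ)
    (hT : Transversal u₁ b u₂) (s : ℝ) :
    ∀ᶠ t in 𝓝[>] s, ∀ σ, RightGerm γ a u₁ b u₂ σ t → RightGerm γ a u₁ b u₂ σ s := by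
  obtain ⟨-, ⟨w, hw⟩⟩ := hγ.exists_affine s
  have hx := eventually_fract_ge (a := a) (s := s) hT.pos.le
  have hy := eventually_fract_ge (a := b) (s := s) hT.nonneg
  have hx' := hx.filter_mono (nhdsWithin_mono s Set.Ioi_subset_Ici_self)
  have hy' := hy.filter_mono (nhdsWithin_mono s Set.Ioi_subset_Ici_self)
  set x := Int.fract (a + u₁ * s) with hxdef
  set y := Int.fract (b + u₂ * s) with hydef
  filter_upwards [eventually_eventually_nhdsWithin.mpr hw, eventually_eventually_nhdsWithin.mpr hx',
    eventually_eventually_nhdsWithin.mpr hy', self_mem_nhdsWithin] with t h1 h2 h3 hts σ h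
  rw [IsOpen.nhdsWithin_eq isOpen_Ioi hts] at h1 h2 h3
  have hG : ∀ r, Int.fract (a + u₁ * r) = x + (r - s) * u₁ →
      Int.fract (b + u₂ * r) = y + (r - s) * u₂ → tilePoint σ (a + u₁ * r) (b + u₂ * r) =
      pt σ (x - 1 / 2) (y - 1 / 2) + (r - s) • (u₁ • vec (frameA σ.2) + u₂ • vec (frameB σ.2)) := by
    intro r e1 e2
    rw [tilePoint, e1, e2, ← affine_rearrange, ← pt_add]
    congr 1 <;> ring
  have hF : ∀ᶠ r in 𝓝[≥] t, γ s + (r - s) • w = pt σ (x - 1 / 2) (y - 1 / 2) +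
      (r - s) • (u₁ • vec (frameA σ.2) + u₂ • vec (frameB σ.2)) := by
    filter_upwards [h1.filter_mono nhdsWithin_le_nhds, h2.filter_mono nhdsWithin_le_nhds,
      h3.filter_mono nhdsWithin_le_nhds, h.2] with r e1 e2 e3 e4
    rw [← e1, e4, hG r e2 e3]
  obtain ⟨r, hr1, hr2⟩ := ((hF.filter_mono (nhdsWithin_mono t Set.Ioi_subset_Ici_self)).and
    self_mem_nhdsWithin).exists
  obtain ⟨e5, e6⟩ := eq_and_eq_of_affine_eq (ne_of_gt hr2) hr1
    (hF.self_of_nhdsWithin Set.self_mem_Ici)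
  rw [rightGerm_iff hT]
  refine ⟨h.1, ?_⟩
  rw [← Set.Ioi_insert, nhdsWithin_insert, eventually_sup]
  refine ⟨?_, ?_⟩
  · simpa [tilePoint] using e5
  · filter_upwards [hw] with r e1
    rw [e1, e5, e6, affine_rearrange]
    rfl

/-- The germ of the geodesic determines the face and the frame. -/
theorem RightGerm.unique (hT : Transversal u₁ b u₂) (h : RightGerm γ a u₁ b u₂ σ s)
    (h' : RightGerm γ a u₁ b u₂ τ s) : σ = τ := by
  have hF : ∀ᶠ r in 𝓝[≥] s, tilePoint σ (a + u₁ * s) (b + u₂ * s) +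
      (r - s) • (u₁ • vec (frameA σ.2) + u₂ • vec (frameB σ.2)) =
      tilePoint τ (a + u₁ * s) (b + u₂ * s) +
      (r - s) • (u₁ • vec (frameA τ.2) + u₂ • vec (frameB τ.2)) := by
    filter_upwards [((rightGerm_iff hT).mp h).2, ((rightGerm_iff hT).mp h').2] with r e1 e2
    rw [← affine_rearrange, ← affine_rearrange, ← e1, e2]
  -- at a slightly later time the point lies in the interior of a face
  have hint : ∀ᶠ r in 𝓝[>] s, (¬ ∃ k : ℤ, a + u₁ * r = k) ∧ ¬ ∃ k : ℤ, b + u₂ * r = k := by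
    have key : ∀ a u : ℝ, 0 < u → ∀ᶠ r in 𝓝[>] s, ¬ ∃ k : ℤ, a + u * r = k := by
      intro a u hu
      filter_upwards [(eventually_fract_ge (a := a) (s := s) hu.le).filter_mono
        (nhdsWithin_mono s Set.Ioi_subset_Ici_self), self_mem_nhdsWithin] with r h1 h2
      rintro ⟨k, hk⟩
      rw [hk, Int.fract_intCast] at h1
      have h3 := Int.fract_nonneg (a + u * s)
      have h4 : 0 < (r - s) * u := mul_pos (sub_pos.mpr h2) hu
      linarith
    refine (key a u₁ hT.pos).and ?_
    rcases hT.nonneg.eq_or_lt with h0 | h0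
    · refine Eventually.of_forall fun r => ?_
      rw [← h0, zero_mul, add_zero]
      exact hT.avoid.resolve_left (by rw [← h0]; exact lt_irrefl _)
    · exact key b u₂ h0
  obtain ⟨r, ⟨⟨hr1, hr2, hr3⟩, hr4, hr5⟩, hr6⟩ :=
    ((((hF.and (h.2.and h'.2)).filter_mono
    (nhdsWithin_mono s Set.Ioi_subset_Ici_self)).and hint).and self_mem_nhdsWithin).exists
  obtain ⟨e1, e2⟩ := eq_and_eq_of_affine_eq (ne_of_gt hr6) hr1
    (hF.self_of_nhdsWithin Set.self_mem_Ici)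
  have hface : face τ = face σ := by
    have hx := fract_sub_half_mem hr4
    have hy := fract_sub_half_mem hr5
    refine h.1.eq_face_of_inside hx hy h'.1.isConstituent ?_
    rw [h'.1.mem_carrier_iff]
    exact ⟨_, _, ⟨hx.1.le, hx.2.le⟩, ⟨hy.1.le, hy.2.le⟩, hr2.symm.trans hr3⟩
  have hj : σ.2 = τ.2 := by
    refine eq_of_velocity_eq hT.pos hT.nonneg (fun k => ?_)
      (Or.inl (congrArg UnitSquare.axis hface).symm)
    have := congrArg (fun v : E3 => v k) e2
    simpa [vec_apply] using this
  ext1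
  · ext i
    have := congrArg (fun v : E3 => v i) e1
    simp only [tilePoint, pt_apply, hj] at this
    have h2 : (σ.1 i : ℝ) = τ.1 i := by linarith
    exact_mod_cast h2
  · exact hj

theorem eventually_nhds_of_lt_of_ge {p : ℝ → Prop} (h₁ : ∀ᶠ t in 𝓝[<] s, p t)
    (h₂ : ∀ᶠ t in 𝓝[≥] s, p t) : ∀ᶠ t in 𝓝 s, p t := by
  rw [← nhdsLT_sup_nhdsGE]
  exact eventually_sup.mpr ⟨h₁, h₂⟩

theorem RightGerm.leftGerm (hγ : IsNonsingularGeodesic γ) (hT : Transversal u₁ b u₂)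
    (h : RightGerm γ a u₁ b u₂ σ s) :
    LeftGerm γ a u₁ b u₂ ((crossing (a + u₁ * s) (b + u₂ * s))⁻¹ σ) s := by
  rw [leftGerm_iff_rightGerm hγ hT (not_int_of_rightGerm hγ hT h), perm_apply_inv]
  exact h

/-- The times at which the geodesic unfolds to the given line form a clopen set, so the development
is defined at all times. -/
theorem exists_rightGerm (hγ : IsNonsingularGeodesic γ) (hT : Transversal u₁ b u₂)
    (h : RightGerm γ a u₁ b u₂ σ s) (t : ℝ) : ∃ τ, RightGerm γ a u₁ b u₂ τ t := by
  have hclopen : IsClopen {t | ∃ τ, RightGerm γ a u₁ b u₂ τ t} := by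
    constructor
    · rw [← isOpen_compl_iff, isOpen_iff_mem_nhds]
      intro t ht
      refine eventually_nhds_of_lt_of_ge ?_ ?_
      · filter_upwards [eventually_rightGerm_imp_leftGerm (a := a) hγ hT t] with r hr
        rintro ⟨τ, hτ⟩
        have hl := hr τ hτ
        exact ht ⟨_, (leftGerm_iff_rightGerm hγ hT (not_int_of_leftGerm hγ hT hl)).mp hl⟩
      · rw [← Set.Ioi_insert, nhdsWithin_insert, eventually_sup]
        refine ⟨by simpa using ht, ?_⟩
        filter_upwards [eventually_rightGerm_imp_rightGerm (a := a) hγ hT t] with r hr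
        rintro ⟨τ, hτ⟩
        exact ht ⟨_, hr τ hτ⟩
    · rw [isOpen_iff_mem_nhds]
      rintro t ⟨τ, hτ⟩
      refine eventually_nhds_of_lt_of_ge ?_ ?_
      · filter_upwards [(hτ.leftGerm hγ hT).eventually_lt] with r hr
        exact ⟨_, hr⟩
      · filter_upwards [hτ.eventually_ge] with r hr
        exact ⟨_, hr⟩
  exact Set.eq_univ_iff_forall.mp (hclopen.eq_univ ⟨s, σ, h⟩) t

/-- The states along a geodesic form an itinerary of the developed line. -/
theorem exists_itinerary (hγ : IsNonsingularGeodesic γ) (hT : Transversal u₁ b u₂)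
    (h : RightGerm γ a u₁ b u₂ σ s) : ∃ S : ℝ → State, (∀ t, RightGerm γ a u₁ b u₂ (S t) t) ∧
      Itinerary crossA crossB (fun t => a + u₁ * t) (fun t => b + u₂ * t) S := by
  choose S hS using exists_rightGerm hγ hT h
  refine ⟨S, hS, fun t => not_int_of_rightGerm hγ hT (hS t), fun t₀ => ?_⟩
  have hns := not_int_of_rightGerm hγ hT (hS t₀)
  refine eventually_nhds_of_lt_of_ge ?_ ?_
  · have hlt : ∀ᶠ t in 𝓝[<] t₀, S t₀ = crossing (a + u₁ * t₀) (b + u₂ * t₀) (S t) := by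
      filter_upwards [((hS t₀).leftGerm hγ hT).eventually_lt] with t ht
      rw [(hS t).unique hT ht, perm_apply_inv]
    by_cases h1 : ∃ k : ℤ, a + u₁ * t₀ = k
    · have h2 : ¬ ∃ k : ℤ, b + u₂ * t₀ = k := fun h => hns ⟨h1, h⟩
      obtain ⟨k, hk⟩ := id h1
      filter_upwards [hlt, eventually_floor_lt hT.pos hk,
        (eventually_floor_of_not_int h2).filter_mono nhdsWithin_le_nhds] with t e1 e2 e3
      rw [e1, e2, e3, crossing, if_pos h1]
      simp
    by_cases h2 : ∃ k : ℤ, b + u₂ * t₀ = k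
    · obtain ⟨k, hk⟩ := id h2
      filter_upwards [hlt, eventually_floor_lt (hT.pos_of_int h2) hk,
        (eventually_floor_of_not_int h1).filter_mono nhdsWithin_le_nhds] with t e1 e2 e3
      rw [e1, e2, e3, crossing, if_neg h1, if_pos h2]
      simp
    · filter_upwards [hlt, (eventually_floor_of_not_int h1).filter_mono nhdsWithin_le_nhds,
        (eventually_floor_of_not_int h2).filter_mono nhdsWithin_le_nhds] with t e1 e2 e3
      rw [e1, e2, e3, crossing, if_neg h1, if_neg h2]
      simp
  · filter_upwards [(hS t₀).eventually_ge, eventually_floor_ge (a := a) (s := t₀) hT.pos.le,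
      eventually_floor_ge (a := b) (s := t₀) hT.nonneg] with t e1 e2 e3
    rw [e2, e3, (hS t).unique hT e1]
    simp

end Germs

/-! ### The development of a geodesic of given slope -/

theorem mem_carrier_of_mem_inside {S : UnitSquare} {p : E3} (hp : p ∈ S.inside) : p ∈ S.carrier :=
  ⟨Set.Ioo_subset_Icc_self hp.1, Set.Ioo_subset_Icc_self hp.2.1, hp.2.2⟩

theorem ne_int_of_mem_Ioo {c k : ℤ} {x : ℝ} (hx : x ∈ Set.Ioo (c : ℝ) (c + 1)) : x ≠ k := by
  rintro rfl
  obtain ⟨h1, h2⟩ := hx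
  norm_cast at h1 h2
  omega

theorem IsFace.exists_of_mem_inside {σ : State} (h : IsFace σ) {p : E3}
    (hp : p ∈ (face σ).inside) :
    ∃ x y, p = pt σ x y ∧ (-1 / 2 < x ∧ x < 1 / 2) ∧ (-1 / 2 < y ∧ y < 1 / 2) := by
  obtain ⟨x, y, hx, hy, rfl⟩ := (h.mem_carrier_iff p).mp (mem_carrier_of_mem_inside hp)
  have hne : ∀ i, i ≠ frameAxis σ.2 + 2 → ∀ k : ℤ, pt σ x y i ≠ k := by
    intro i hi k
    have : ∀ i a : Fin 3, i ≠ a + 2 → i = a ∨ i = a + 1 := by decide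
    rcases this _ _ hi with rfl | rfl
    · exact ne_int_of_mem_Ioo hp.1
    · exact ne_int_of_mem_Ioo hp.2.1
  have h1 : ∀ j, indexA j ≠ frameAxis j + 2 ∧ indexB j ≠ frameAxis j + 2 ∧
      frameB j (indexA j) = 0 ∧ frameA j (indexB j) = 0 := by decide
  obtain ⟨hA, hB, hBA, hAB⟩ := h1 σ.2
  obtain ⟨k, hk⟩ := h.2 (indexA σ.2)
  obtain ⟨l, hl⟩ := h.2 (indexB σ.2)
  rw [hBA, add_zero] at hk
  rw [hAB, zero_add] at hl
  have ek : (σ.1 (indexA σ.2) : ℝ) = 2 * k + frameA σ.2 (indexA σ.2) := by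
    exact_mod_cast (by omega : σ.1 (indexA σ.2) = 2 * k + frameA σ.2 (indexA σ.2))
  have el : (σ.1 (indexB σ.2) : ℝ) = 2 * l + frameB σ.2 (indexB σ.2) := by
    exact_mod_cast (by omega : σ.1 (indexB σ.2) = 2 * l + frameB σ.2 (indexB σ.2))
  have hA' := hne _ hA
  have hB' := hne _ hB
  simp only [pt_apply, hBA, ek] at hA'
  simp only [pt_apply, hAB, el] at hB'
  refine ⟨x, y, rfl, ⟨lt_of_le_of_ne hx.1 ?_, lt_of_le_of_ne hx.2 ?_⟩,
    ⟨lt_of_le_of_ne hy.1 ?_, lt_of_le_of_ne hy.2 ?_⟩⟩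
  · rintro rfl; exact hA' k (by push_cast; ring)
  · rintro rfl; exact hA' (k + frameA σ.2 (indexA σ.2)) (by push_cast; ring)
  · rintro rfl; exact hB' l (by push_cast; ring)
  · rintro rfl; exact hB' (l + frameB σ.2 (indexB σ.2)) (by push_cast; ring)

theorem norm_sq_frame (j : ZMod 12) (c d : ℝ) :
    ‖c • vec (frameA j) + d • vec (frameB j)‖ ^ 2 = c ^ 2 + d ^ 2 := by
  have h : inner ℝ (vec (frameB j)) (vec (frameA j)) = 0 := by
    rw [real_inner_comm]; exact inner_frameA_frameB j
  rw [← real_inner_self_eq_norm_sq]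
  simp only [inner_add_right, inner_add_left, inner_smul_left, inner_smul_right, conj_trivial,
    inner_frameA, inner_frameB, inner_frameA_frameB, h]
  ring

/-- A geodesic with slope `m` at some time unfolds to a line of unit direction `(u₁, u₂)` in the first
quadrant. The initial frame may be turned by a quarter turn against the coordinates of the face,
whence the two alternatives for `m`. -/
theorem exists_development {γ : ℝ → E3} (hγ : IsNonsingularGeodesic γ) {t₀ : ℝ} {m : OnePoint ℝ}
    (hm : HasSlopeAt γ t₀ m) : ∃ a u₁ b u₂ : ℝ, ∃ S : ℝ → State, Transversal u₁ b u₂ ∧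
      u₁ ^ 2 + u₂ ^ 2 = 1 ∧ (m = planarSlope u₁ u₂ ∨ m = planarSlope u₂ (-u₁)) ∧
      (∀ t, RightGerm γ a u₁ b u₂ (S t) t) ∧
      Itinerary crossA crossB (fun t => a + u₁ * t) (fun t => b + u₂ * t) S := by
  obtain ⟨Q, hQ, hin, v, hv, rfl⟩ := hm
  obtain ⟨j₀, hj₀⟩ : ∃ j, frameAxis j = Q.axis := by
    have : ∀ a, ∃ j, frameAxis j = a := by decide
    exact this _
  obtain ⟨σ₀, hσ₀, rfl, rfl⟩ := exists_state hQ hj₀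
  obtain ⟨x₀, y₀, hp₀, hx₀, hy₀⟩ := hσ₀.exists_of_mem_inside hin
  obtain ⟨c, d, hcd, hev⟩ := hγ.eventually_inside hσ₀ hp₀ hx₀ hy₀
  have hv' : v = c • vec (frameA σ₀.2) + d • vec (frameB σ₀.2) := by
    refine hv.unique ?_
    have h1 : HasDerivAt (fun t : ℝ => γ t₀ + (t - t₀) •
        (c • vec (frameA σ₀.2) + d • vec (frameB σ₀.2)))
        (c • vec (frameA σ₀.2) + d • vec (frameB σ₀.2)) t₀ := by
      have := (((hasDerivAt_id t₀).sub_const t₀).smul_const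
        (c • vec (frameA σ₀.2) + d • vec (frameB σ₀.2))).const_add (γ t₀)
      simpa using this
    refine h1.congr_of_eventuallyEq ?_
    filter_upwards [hev] with t ht
    rw [ht, affine_rearrange]
  have hnorm : ‖v‖ ^ 2 = 1 := by rw [hv', norm_sq_frame, hcd]
  have hv0 : v ≠ 0 := by rintro rfl; simp at hnorm
  have hva : v ((face σ₀).axis + 2) = 0 := by
    have h1 : ∀ j, frameA j (frameAxis j + 2) = 0 ∧ frameB j (frameAxis j + 2) = 0 := by decide
    have h2 := h1 σ₀.2
    have h3 : (face σ₀).axis = frameAxis σ₀.2 := rfl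
    rw [hv', h3]
    simp [vec_apply, h2.1, h2.2]
  obtain ⟨j, hj, u₁, u₂, hu₁, hu₂, hvu, hslope⟩ := exists_frame _ hv0 hva
  obtain ⟨σ, hσ, rfl, hface⟩ := exists_state hσ₀.isConstituent hj
  rw [← hface] at hin
  obtain ⟨x, y, hp, hx, hy⟩ := hσ.exists_of_mem_inside hin
  have hT : Transversal u₁ (y + 1 / 2 - u₂ * t₀) u₂ := by
    refine ⟨hu₁, hu₂, ?_⟩
    rcases hu₂.eq_or_lt with rfl | h
    · right
      rintro ⟨k, hk⟩
      refine ne_int_of_mem_Ioo (c := 0) (k := k) (x := y + 1 / 2) ⟨?_, ?_⟩ (by linarith)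
      · push_cast; linarith [hy.1]
      · push_cast; linarith [hy.2]
    · exact Or.inl h
  have hgerm : RightGerm γ (x + 1 / 2 - u₁ * t₀) u₁ (y + 1 / 2 - u₂ * t₀) u₂ σ t₀ := by
    rw [rightGerm_iff hT]
    refine ⟨hσ, ?_⟩
    have h1 : tilePoint σ (x + 1 / 2 - u₁ * t₀ + u₁ * t₀) (y + 1 / 2 - u₂ * t₀ + u₂ * t₀) =
        γ t₀ := by
      rw [hp, tilePoint, sub_add_cancel, sub_add_cancel,
        Int.fract_eq_self.mpr ⟨by linarith [hx.1], by linarith [hx.2]⟩,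
        Int.fract_eq_self.mpr ⟨by linarith [hy.1], by linarith [hy.2]⟩]
      congr 1 <;> ring
    rw [h1]
    filter_upwards [hev.filter_mono nhdsWithin_le_nhds] with t ht
    rw [ht, affine_rearrange, affine_rearrange, ← hv', hvu]
  obtain ⟨S, hS, hI⟩ := exists_itinerary hγ hT hgerm
  refine ⟨_, u₁, _, u₂, S, hT, ?_, hslope, hS, hI⟩
  rw [← norm_sq_frame σ.2, ← hvu, hnorm]

/-! ### Periods -/

section Shift

variable {X : Type*} {x y : Equiv.Perm X} {α β : ℝ → ℝ} {S : ℝ → X}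

theorem Itinerary.shift (h : Itinerary x y α β S) {T : ℝ} {k l : ℤ}
    (hα : ∀ t, α (t + T) = α t + k) (hβ : ∀ t, β (t + T) = β t + l) :
    Itinerary x y α β fun t => S (t + T) := by
  refine ⟨h.generic, fun t₀ => ?_⟩
  have hc : Tendsto (fun t : ℝ => t + T) (𝓝 t₀) (𝓝 (t₀ + T)) :=
    (continuous_id.add continuous_const).tendsto t₀
  filter_upwards [hc.eventually (h.step (t₀ + T))] with t ht
  rw [ht, hα, hα, hβ, hβ]
  simp only [Int.floor_add_intCast, add_sub_add_right_eq_sub]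

theorem Itinerary.map (h : Itinerary x y α β S) {g : Equiv.Perm X} (hx : Commute g x)
    (hy : Commute g y) : Itinerary x y α β fun t => g (S t) := by
  refine ⟨h.generic, fun t₀ => ?_⟩
  filter_upwards [h.step t₀] with t ht
  rw [ht, ← Equiv.Perm.mul_apply g, (hx.zpow_right _).eq, Equiv.Perm.mul_apply,
    ← Equiv.Perm.mul_apply g, (hy.zpow_right _).eq, Equiv.Perm.mul_apply]

end Shift

theorem commute_translate {g : Equiv.Perm State} (hg : g ∈ symmetric) (d : Fin 3 → ℤ) :
    Commute (translate d) g := by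
  refine Equiv.ext fun σ => ?_
  exact (hg.1 d σ).symm

/-- If the index of the frame is invariant under the time shift by `l`, then so are the times at
which the first coordinate of the line passes an integer, since at such times the index changes by
a step that no crossing of the other kind produces. -/
theorem Itinerary.exists_int_of_frame_eq {x y : Equiv.Perm State} {S : ℝ → State}
    {a u b v l : ℝ} (h : Itinerary x y (fun t => a + u * t) (fun t => b + v * t) S) (hu : 0 < u)
    (hv : 0 < v) {c : ZMod 12} (hx : HasTwist x c) (hy : HasTwist y (-c)) (hc : c = 1 ∨ c = -1)
    (hl : ∀ t, (S (l + t)).2 = (S t).2) : ∃ k : ℤ, l * u = k := by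
  by_contra hcon
  set t₁ := -a / u with ht₁
  have e1 : a + u * t₁ = (0 : ℤ) := by rw [ht₁]; field_simp; simp
  have hβ1 : ¬ ∃ k : ℤ, b + v * t₁ = k := fun h' => h.generic t₁ ⟨⟨0, e1⟩, h'⟩
  have e2 : ¬ ∃ k : ℤ, a + u * (l + t₁) = k := by
    rintro ⟨k, hk⟩
    refine hcon ⟨k, ?_⟩
    push_cast at e1
    linarith
  have hc' : Tendsto (fun t : ℝ => l + t) (𝓝[<] t₁) (𝓝[<] (l + t₁)) := by
    refine tendsto_nhdsWithin_iff.mpr ⟨?_, ?_⟩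
    · exact ((continuous_const.add continuous_id).tendsto t₁).mono_left nhdsWithin_le_nhds
    · filter_upwards [self_mem_nhdsWithin] with t ht
      exact add_lt_add_right (show t < t₁ from ht) l
  have h1 : ∀ᶠ t in 𝓝[<] t₁, S t₁ = x (S t) := by
    filter_upwards [(h.step t₁).filter_mono nhdsWithin_le_nhds, eventually_floor_lt hu e1,
      (eventually_floor_of_not_int hβ1).filter_mono nhdsWithin_le_nhds] with t f1 f2 f3
    rw [f1, f2, f3]; simp
  have h2 : ∀ᶠ t in 𝓝[<] (l + t₁), S (l + t₁) = S t ∨ S (l + t₁) = y (S t) := by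
    by_cases h3 : ∃ k : ℤ, b + v * (l + t₁) = k
    · obtain ⟨k, hk⟩ := h3
      filter_upwards [(h.step (l + t₁)).filter_mono nhdsWithin_le_nhds, eventually_floor_lt hv hk,
        (eventually_floor_of_not_int e2).filter_mono nhdsWithin_le_nhds] with t f1 f2 f3
      right
      rw [f1, f2, f3]; simp
    · filter_upwards [(h.step (l + t₁)).filter_mono nhdsWithin_le_nhds,
        (eventually_floor_of_not_int h3).filter_mono nhdsWithin_le_nhds,
        (eventually_floor_of_not_int e2).filter_mono nhdsWithin_le_nhds] with t f1 f2 f3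
      left
      rw [f1, f2, f3]; simp
  obtain ⟨t, ht1, ht2⟩ := (h1.and (hc'.eventually h2)).exists
  have h4 := congrArg Prod.snd ht1
  rw [hx] at h4
  have h5 := hl t₁
  have h6 := hl t
  have key : ∀ j c : ZMod 12, (c = 1 ∨ c = -1) → j + altSign j * c ≠ j ∧
      j + altSign j * c ≠ j + altSign j * -c := by decide
  obtain ⟨k1, k2⟩ := key (S t).2 c hc
  rcases ht2 with ht2 | ht2
  · rw [ht2, h6, h4] at h5
    exact k1 h5.symm
  · have h7 := congrArg Prod.snd ht2
    rw [hy, h6, h5, h4] at h7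
    exact k2 h7

section Development

variable {γ : ℝ → E3} {a u₁ b u₂ : ℝ} {S : ℝ → State}

theorem eq_tilePoint (hS : ∀ t, RightGerm γ a u₁ b u₂ (S t) t) (t : ℝ) :
    γ t = tilePoint (S t) (a + u₁ * t) (b + u₂ * t) :=
  (hS t).2.self_of_nhdsWithin Set.self_mem_Ici

/-- Translations preserve velocities, which determine the frame. -/
theorem frame_eq_of_translate (hT : Transversal u₁ b u₂) (hu₂ : 0 < u₂)
    (hS : ∀ t, RightGerm γ a u₁ b u₂ (S t) t) {l : ℝ} {D : E3} (hl : ∀ t, γ (l + t) = D + γ t)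
    (t : ℝ) : (S (l + t)).2 = (S t).2 := by
  have h1 := ((rightGerm_iff hT).mp (hS t)).2
  have hc' : Tendsto (fun r : ℝ => l + r) (𝓝[≥] t) (𝓝[≥] (l + t)) := by
    refine tendsto_nhdsWithin_iff.mpr ⟨?_, ?_⟩
    · exact ((continuous_const.add continuous_id).tendsto t).mono_left nhdsWithin_le_nhds
    · filter_upwards [self_mem_nhdsWithin] with r hr
      exact add_le_add_right (show t ≤ r from hr) l
  have h2 := hc'.eventually ((rightGerm_iff hT).mp (hS (l + t))).2
  have hF := h1.and h2
  obtain ⟨r, ⟨hr1, hr2⟩, hr3⟩ := ((hF.filter_mono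
    (nhdsWithin_mono t Set.Ioi_subset_Ici_self)).and self_mem_nhdsWithin).exists
  obtain ⟨ht1, ht2⟩ := hF.self_of_nhdsWithin Set.self_mem_Ici
  rw [affine_rearrange] at hr1 hr2 ht1 ht2
  rw [hl, add_sub_add_left_eq_sub] at hr2 ht2
  rw [hr1, ← add_assoc] at hr2
  rw [ht1, ← add_assoc] at ht2
  obtain ⟨-, e⟩ := eq_and_eq_of_affine_eq (ne_of_gt hr3) hr2 ht2
  refine (eq_of_velocity_eq hT.pos hT.nonneg (fun k => ?_) (Or.inr hu₂)).symm
  have := congrArg (fun v : E3 => v k) e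
  simpa [vec_apply] using this

theorem exists_int_of_translate (hT : Transversal u₁ b u₂) (hu₂ : 0 < u₂)
    (hS : ∀ t, RightGerm γ a u₁ b u₂ (S t) t)
    (hI : Itinerary crossA crossB (fun t => a + u₁ * t) (fun t => b + u₂ * t) S)
    {l : ℝ} {D : E3} (hl : ∀ t, γ (l + t) = D + γ t) :
    (∃ k : ℤ, l * u₁ = k) ∧ ∃ k : ℤ, l * u₂ = k := by
  have hfr := frame_eq_of_translate hT hu₂ hS hl
  refine ⟨hI.exists_int_of_frame_eq hT.pos hu₂ hasTwist_crossA hasTwist_crossB (Or.inl rfl) hfr,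
    ?_⟩
  refine (hI.swap (by fun_prop) (by fun_prop)).exists_int_of_frame_eq hu₂ hT.pos hasTwist_crossB
    ?_ (Or.inr rfl) hfr
  rw [neg_neg]; exact hasTwist_crossA

theorem tilePoint_add_int (σ : State) (α β : ℝ) (k l : ℤ) :
    tilePoint σ (α + k) (β + l) = tilePoint σ α β := by
  simp [tilePoint]

/-- The vector `(u₁, u₂)` is `r` times the primitive integral vector `(q, p)`. The developed line then
passes through a period of the square lattice in time `1 / r`. -/
structure RationalDirection (u₁ u₂ : ℝ) (q p : ℕ) (r : ℝ) : Prop where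
  pos : 0 < r
  coprime : Nat.Coprime q p
  fst : u₁ = q * r
  snd : u₂ = p * r

theorem RationalDirection.shift {q p : ℕ} {r : ℝ} (h : RationalDirection u₁ u₂ q p r) (n : ℕ)
    (a b t : ℝ) : a + u₁ * (t + n / r) = a + u₁ * t + (q * n : ℤ) ∧
      b + u₂ * (t + n / r) = b + u₂ * t + (p * n : ℤ) := by
  have := h.pos.ne'
  rw [h.fst, h.snd]
  push_cast
  constructor <;> field_simp <;> ring

theorem RationalDirection.exists_monodromy {q p : ℕ} {r : ℝ}
    (h : RationalDirection u₁ u₂ q p r)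
    (hI : Itinerary crossA crossB (fun t => a + u₁ * t) (fun t => b + u₂ * t) S) :
    ∃ g e, IsMonodromy g e ∧ altSign e = (-1) ^ (q + p) ∧
      ∀ n : ℕ, S (0 + n / r) = (g ^ n) (S 0) := by
  rw [h.fst, h.snd] at hI
  obtain ⟨g, e, h1, h2, h3⟩ :=
    Itinerary.exists_monodromy _ q p rfl h.coprime h.pos generatingPair_cross _ _
    hasTwist_crossA hasTwist_crossB hI 0
  refine ⟨g, e, h1, ?_, h3⟩
  have e1 : altSign 1 = -1 := by decide
  have e2 : altSign (-1) = -1 := by decide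
  rw [h2, e1, e2, pow_add]

/-- If `q + p` is odd, the square of the monodromy is a nonzero translation. -/
theorem RationalDirection.isDriftPeriodic {q p : ℕ} {r : ℝ}
    (h : RationalDirection u₁ u₂ q p r) (hqp : Odd (q + p))
    (hS : ∀ t, RightGerm γ a u₁ b u₂ (S t) t)
    (hI : Itinerary crossA crossB (fun t => a + u₁ * t) (fun t => b + u₂ * t) S) :
    IsDriftPeriodic γ := by
  obtain ⟨g, e, hg, he, hn⟩ := h.exists_monodromy hI
  rw [hqp.neg_one_pow] at he
  obtain ⟨d, hd, hgd⟩ := hg.exists_translate he (S 0)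
  have hshift := hI.shift (T := (2 : ℕ) / r) (fun t => (h.shift 2 a b t).1)
    (fun t => (h.shift 2 a b t).2)
  have hmap := hI.map (commute_translate crossA_mem d) (commute_translate crossB_mem d)
  have heq := hshift.eq_of_eq hmap (t₁ := 0) (by rw [hn 2, hgd])
  refine ⟨(2 : ℕ) / r, ?_, (1 / 2 : ℝ) • vec d, ?_, fun t => ?_⟩
  · have := h.pos
    positivity
  · intro h0
    apply hd
    ext i
    have := congrArg (fun v : E3 => v i) h0
    simpa [vec_apply] using this
  · rw [eq_tilePoint hS, eq_tilePoint hS t, add_comm _ t, (h.shift 2 a b t).1, (h.shift 2 a b t).2,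
      tilePoint_add_int, congrFun heq t, tilePoint, tilePoint, pt_translate]

/-- If `q + p` is even, the monodromy has order six, and so has its action on frames; hence no
period is shorter than six lattice periods. -/
theorem RationalDirection.hasLength {q p : ℕ} {r : ℝ}
    (h : RationalDirection u₁ u₂ q p r) (hqp : Even (q + p)) (hT : Transversal u₁ b u₂)
    (hu₂ : 0 < u₂) (hS : ∀ t, RightGerm γ a u₁ b u₂ (S t) t)
    (hI : Itinerary crossA crossB (fun t => a + u₁ * t) (fun t => b + u₂ * t) S) :
    HasLength γ (6 / r) := by
  have hr := h.pos
  obtain ⟨g, e, hg, he, hn⟩ := h.exists_monodromy hI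
  rw [hqp.neg_one_pow] at he
  have he' : ¬ IsOdd e := by rw [IsOdd, he]; decide
  constructor
  · have hshift := hI.shift (T := (6 : ℕ) / r) (fun t => (h.shift 6 a b t).1)
      (fun t => (h.shift 6 a b t).2)
    have heq := hshift.eq_of_eq hI (t₁ := 0) (by rw [hn 6, hg.pow_six he'])
    refine ⟨by positivity, fun t => ?_⟩
    rw [eq_tilePoint hS, eq_tilePoint hS t, add_comm _ t]
    have e6 : (6 : ℝ) = (6 : ℕ) := by norm_num
    rw [e6, (h.shift 6 a b t).1, (h.shift 6 a b t).2, tilePoint_add_int, congrFun heq t]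
  · rintro P ⟨hP, hper⟩
    obtain ⟨⟨k, hk⟩, l, hl⟩ := exists_int_of_translate hT hu₂ hS hI (l := P) (D := 0)
      (fun t => by rw [hper, zero_add])
    rw [h.fst] at hk
    rw [h.snd] at hl
    -- the period is an integral multiple of the time `1 / r` by Bézout
    obtain ⟨n, hnP⟩ : ∃ n : ℤ, P * r = n := by
      obtain ⟨x, y, hxy⟩ := Nat.isCoprime_iff_coprime.mpr h.coprime
      refine ⟨x * k + y * l, ?_⟩
      have hxy' : (x : ℝ) * q + y * p = 1 := by exact_mod_cast hxy
      push_cast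
      linear_combination (-(P * r)) * hxy' + (x : ℝ) * hk + (y : ℝ) * hl
    have hn0 : 0 < n := by
      have : (0 : ℝ) < n := by rw [← hnP]; positivity
      exact_mod_cast this
    lift n to ℕ using hn0.le
    have hPn : P = n / r := by rw [eq_div_iff hr.ne']; exact_mod_cast hnP
    have hSP : S (0 + n / r) = S 0 := by
      refine RightGerm.unique hT (s := 0) ⟨(hS _).1, ?_⟩ (hS 0)
      have hc' : Tendsto (fun r : ℝ => r + P) (𝓝[≥] 0) (𝓝[≥] (0 + P)) := by
        refine tendsto_nhdsWithin_iff.mpr ⟨?_, ?_⟩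
        · exact ((continuous_id.add continuous_const).tendsto 0).mono_left nhdsWithin_le_nhds
        · filter_upwards [self_mem_nhdsWithin] with r hr
          exact add_le_add_left (show 0 ≤ r from hr) P
      filter_upwards [hc'.eventually (hS (0 + P)).2] with t ht
      rw [hPn, (h.shift n a b t).1, (h.shift n a b t).2, tilePoint_add_int, ← hPn, add_comm, hper]
        at ht
      rw [ht, hPn]
    rw [hn n] at hSP
    have h6 := Nat.le_of_dvd (by exact_mod_cast hn0) (hg.six_dvd he' _ _ hSP)
    rw [hPn]
    gcongr
    exact_mod_cast h6

theorem exists_rationalDirection_of_isCoprime {u₁ u₂ l : ℝ} (hu₁ : 0 < u₁) (hu₂ : 0 ≤ u₂)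
    (hl : l ≠ 0) {k₁ k₂ : ℤ} (h₁ : l * u₁ = k₁) (h₂ : l * u₂ = k₂) (hk : IsCoprime k₁ k₂) :
    RationalDirection u₁ u₂ k₁.natAbs k₂.natAbs (1 / |l|) := by
  have habs := abs_pos.mpr hl
  refine ⟨by positivity, Int.isCoprime_iff_nat_coprime.mp hk, ?_, ?_⟩
  · rw [Nat.cast_natAbs, Int.cast_abs, ← h₁, abs_mul, abs_of_pos hu₁]; field_simp
  · rw [Nat.cast_natAbs, Int.cast_abs, ← h₂, abs_mul, abs_of_nonneg hu₂]; field_simp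

theorem exists_rationalDirection {u₁ u₂ l : ℝ} (hu₁ : 0 < u₁) (hu₂ : 0 ≤ u₂)
    (hl : l ≠ 0) {k₁ k₂ : ℤ} (h₁ : l * u₁ = k₁) (h₂ : l * u₂ = k₂) :
    ∃ q p r, RationalDirection u₁ u₂ q p r := by
  have hk : k₁ ≠ 0 := by
    rintro rfl
    rw [Int.cast_zero] at h₁
    exact (mul_ne_zero hl hu₁.ne') h₁
  obtain ⟨g, m₁, m₂, hg, hm, rfl, rfl⟩ := Int.exists_gcd_one' (Int.gcd_pos_of_ne_zero_left k₂ hk)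
  have hg' : (g : ℝ) ≠ 0 := by positivity
  refine ⟨_, _, _, exists_rationalDirection_of_isCoprime (l := l / g) hu₁ hu₂ (div_ne_zero hl hg')
    (k₁ := m₁) (k₂ := m₂) ?_ ?_ (Int.isCoprime_iff_gcd_eq_one.mpr hm)⟩
  · push_cast at h₁; field_simp; linarith
  · push_cast at h₂; field_simp; linarith

/-- A geodesic that is periodic up to a translation, possibly zero, has a rational direction. -/
theorem exists_rationalDirection_of_translate (hT : Transversal u₁ b u₂)
    (hS : ∀ t, RightGerm γ a u₁ b u₂ (S t) t)
    (hI : Itinerary crossA crossB (fun t => a + u₁ * t) (fun t => b + u₂ * t) S)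
    {l : ℝ} (hl0 : l ≠ 0) {D : E3} (hl : ∀ t, γ (l + t) = D + γ t) :
    ∃ q p r, RationalDirection u₁ u₂ q p r := by
  rcases hT.nonneg.eq_or_lt with h0 | h0
  · exact ⟨1, 0, u₁, hT.pos, by simp, by simp, by simp [← h0]⟩
  · obtain ⟨⟨k, hk⟩, k', hk'⟩ := exists_int_of_translate hT h0 hS hI hl
    exact exists_rationalDirection hT.pos h0.le hl0 hk hk'

end Development

/-! ### Slopes and directions -/

section Slope

variable {u₁ u₂ : ℝ} {m : OnePoint ℝ}

theorem exists_rationalDirection_of_slope (hu₁ : 0 < u₁) (hu₂ : 0 ≤ u₂)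
    (hm : m = planarSlope u₁ u₂ ∨ m = planarSlope u₂ (-u₁)) {P Q : ℤ} (hQ : Q ≠ 0)
    (hPQ : IsCoprime P Q) (h : m = (((P : ℝ) / (Q : ℝ) : ℝ) : OnePoint ℝ)) :
    ∃ r, RationalDirection u₁ u₂ Q.natAbs P.natAbs r ∨
      RationalDirection u₁ u₂ P.natAbs Q.natAbs r := by
  have hQ' : (Q : ℝ) ≠ 0 := by exact_mod_cast hQ
  rcases hm with hm | hm
  · rw [h, planarSlope, if_neg hu₁.ne', OnePoint.coe_eq_coe] at hm
    refine ⟨_, Or.inl (exists_rationalDirection_of_isCoprime hu₁ hu₂ (div_ne_zero hQ' hu₁.ne')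
      ?_ ?_ hPQ.symm)⟩
    · field_simp
    · field_simp at hm ⊢; linarith
  · by_cases h0 : u₂ = 0
    · rw [h, planarSlope, if_pos h0] at hm
      exact absurd hm (OnePoint.coe_ne_infty _)
    · rw [h, planarSlope, if_neg h0, OnePoint.coe_eq_coe] at hm
      refine ⟨1 / |Q / u₂|, Or.inr ?_⟩
      rw [← Int.natAbs_neg P]
      refine exists_rationalDirection_of_isCoprime hu₁ hu₂ (div_ne_zero hQ' h0)
        ?_ ?_ hPQ.neg_left
      · push_cast; field_simp at hm ⊢; linarith
      · field_simp

theorem RationalDirection.slope {q p : ℕ} {r : ℝ} (h : RationalDirection u₁ u₂ q p r)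
    (hu₁ : 0 < u₁) (hm : m = planarSlope u₁ u₂ ∨ m = planarSlope u₂ (-u₁)) :
    (m = OnePoint.infty ∧ p = 0) ∨ ∃ P Q : ℤ, Q ≠ 0 ∧ IsCoprime P Q ∧
      m = (((P : ℝ) / (Q : ℝ) : ℝ) : OnePoint ℝ) ∧
      (P = p ∧ Q = q ∨ P = -q ∧ Q = p) := by
  have hr := h.pos.ne'
  have hc := Nat.isCoprime_iff_coprime.mpr h.coprime
  rcases hm with hm | hm
  · right
    have hq : (q : ℤ) ≠ 0 := by
      rintro hq
      have hq' : (q : ℝ) = 0 := by exact_mod_cast hq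
      rw [h.fst, hq', zero_mul] at hu₁
      exact lt_irrefl _ hu₁
    have hq' : (q : ℝ) ≠ 0 := by exact_mod_cast hq
    refine ⟨p, q, hq, hc.symm, ?_, Or.inl ⟨rfl, rfl⟩⟩
    rw [hm, planarSlope, if_neg hu₁.ne', OnePoint.coe_eq_coe, h.fst, h.snd]
    push_cast; field_simp
  · by_cases hp : p = 0
    · left
      refine ⟨?_, hp⟩
      rw [hm, planarSlope, if_pos (by rw [h.snd, hp]; simp)]
    · right
      have hp' : (p : ℝ) ≠ 0 := by exact_mod_cast hp
      refine ⟨-q, p, by exact_mod_cast hp, hc.neg_left, ?_, Or.inr ⟨rfl, rfl⟩⟩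
      rw [hm, planarSlope, if_neg (by rw [h.snd]; exact mul_ne_zero hp' hr), OnePoint.coe_eq_coe,
        h.fst, h.snd]
      push_cast; field_simp

/-- The lattice period in terms of `q` and `p`, for unit direction. -/
theorem RationalDirection.inv_eq_sqrt {q p : ℕ} {r : ℝ} (h : RationalDirection u₁ u₂ q p r)
    (hu : u₁ ^ 2 + u₂ ^ 2 = 1) : 6 / r = 6 * Real.sqrt ((q : ℝ) ^ 2 + (p : ℝ) ^ 2) := by
  have hr := h.pos
  rw [h.fst, h.snd] at hu
  have h1 : (q : ℝ) ^ 2 + (p : ℝ) ^ 2 = (1 / r) ^ 2 := by field_simp; linarith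
  rw [h1, Real.sqrt_sq (by positivity)]
  ring

end Slope

end Necker

theorem theorem1p1 (γ : ℝ → Necker.E3) (hγ : Necker.IsNonsingularGeodesic γ)
    (t₀ : ℝ) (m : OnePoint ℝ) (hm : Necker.HasSlopeAt γ t₀ m) :
    (Necker.IsPeriodic γ ↔
      ∃ p q : ℤ, Odd p ∧ Odd q ∧ m = (((p : ℝ) / (q : ℝ) : ℝ) : OnePoint ℝ)) ∧
    (∀ p q : ℤ, Odd p → Odd q → IsCoprime p q →
      m = (((p : ℝ) / (q : ℝ) : ℝ) : OnePoint ℝ) →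
      Necker.HasLength γ (6 * Real.sqrt ((p : ℝ) ^ 2 + (q : ℝ) ^ 2))) ∧
    (Necker.IsDriftPeriodic γ ↔
      m = OnePoint.infty ∨
      ∃ p q : ℤ, q ≠ 0 ∧ IsCoprime p q ∧ (Even p ∨ Even q) ∧
        m = (((p : ℝ) / (q : ℝ) : ℝ) : OnePoint ℝ)) := by
  obtain ⟨a, u₁, b, u₂, S, hT, hu, hslope, hS, hI⟩ := Necker.exists_development hγ hm
  have hclosed : ∀ q p : ℕ, ∀ r, Odd q → Odd p → Necker.RationalDirection u₁ u₂ q p r →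
      Necker.HasLength γ (6 * Real.sqrt ((q : ℝ) ^ 2 + (p : ℝ) ^ 2)) := by
    intro q p r hq hp h
    rw [← h.inv_eq_sqrt hu]
    refine h.hasLength (hq.add_odd hp) hT ?_ hS hI
    rw [h.snd]
    have := hp.pos
    have := h.pos
    positivity
  have hlength : ∀ p q : ℤ, Odd p → Odd q → IsCoprime p q →
      m = (((p : ℝ) / (q : ℝ) : ℝ) : OnePoint ℝ) →
      Necker.HasLength γ (6 * Real.sqrt ((p : ℝ) ^ 2 + (q : ℝ) ^ 2)) := by
    intro p q hp hq hpq hmpq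
    have hsq : ∀ k : ℤ, (k.natAbs : ℝ) ^ 2 = (k : ℝ) ^ 2 := by
      intro k; rw [Nat.cast_natAbs, Int.cast_abs, sq_abs]
    have hq0 : q ≠ 0 := by rintro rfl; simp at hq
    obtain ⟨r, h | h⟩ :=
      Necker.exists_rationalDirection_of_slope hT.pos hT.nonneg hslope hq0 hpq hmpq
    · have := hclosed _ _ r (Int.natAbs_odd.mpr hq) (Int.natAbs_odd.mpr hp) h
      rwa [hsq, hsq, add_comm] at this
    · have := hclosed _ _ r (Int.natAbs_odd.mpr hp) (Int.natAbs_odd.mpr hq) h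
      rwa [hsq, hsq] at this
  have hperiodic : ∀ L, 0 < L → Necker.HasLength γ L → Necker.IsPeriodic γ :=
    fun L hL h => ⟨L, hL.ne', h.1.2⟩
  have hdrift : ∀ q p : ℕ, ∀ r, Odd (q + p) → Necker.RationalDirection u₁ u₂ q p r →
      Necker.IsDriftPeriodic γ := fun q p r hqp h => h.isDriftPeriodic hqp hS hI
  have hexcl := Necker.not_isPeriodic_and_isDriftPeriodic hγ.continuous
  -- a primitive direction with odd coordinates is closed, any other one drifts
  have hodd : ∀ q p : ℕ, Even (q + p) → Nat.Coprime q p → Odd q ∧ Odd p := by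
    intro q p h hc
    have h1 : ¬ Even q := fun hq => by
      have hp := (Nat.even_add.mp h).mp hq
      exact Nat.not_coprime_of_dvd_of_dvd one_lt_two hq.two_dvd hp.two_dvd hc
    rw [Nat.even_add] at h
    exact ⟨Nat.not_even_iff_odd.mp h1, Nat.not_even_iff_odd.mp (fun hp => h1 (h.mpr hp))⟩
  refine ⟨⟨?_, ?_⟩, hlength, ⟨?_, ?_⟩⟩
  · intro hP
    obtain ⟨l, hl0, hl⟩ := id hP
    obtain ⟨q, p, r, h⟩ := Necker.exists_rationalDirection_of_translate hT hS hI hl0 (D := 0)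
      (fun t => by rw [hl, zero_add])
    have heven : Even (q + p) := by
      by_contra hcon
      exact hexcl hP (hdrift q p r (Nat.not_even_iff_odd.mp hcon) h)
    obtain ⟨hq, hp⟩ := hodd q p heven h.coprime
    rcases h.slope hT.pos hslope with ⟨-, rfl⟩ | ⟨P, Q, -, -, hmPQ, hcase⟩
    · simp at hp
    · refine ⟨P, Q, ?_, ?_, hmPQ⟩ <;> rcases hcase with ⟨rfl, rfl⟩ | ⟨rfl, rfl⟩ <;>
        simpa using by assumption
  · rintro ⟨p, q, hp, hq, hmpq⟩
    have hq0 : q ≠ 0 := by rintro rfl; simp at hq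
    obtain ⟨g, p', q', hg, hc, rfl, rfl⟩ :=
      Int.exists_gcd_one' (Int.gcd_pos_of_ne_zero_right p hq0)
    have hp' := Int.Odd.of_mul_left hp
    have hq' := Int.Odd.of_mul_left hq
    refine hperiodic _ ?_ (hlength p' q' hp' hq' (Int.isCoprime_iff_gcd_eq_one.mpr hc) ?_)
    · have : p' ≠ 0 := by rintro rfl; simp at hp'
      have : (p' : ℝ) ≠ 0 := by exact_mod_cast this
      positivity
    · rw [hmpq, OnePoint.coe_eq_coe]
      have hg' : (g : ℝ) ≠ 0 := by positivity
      push_cast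
      exact mul_div_mul_right _ _ hg'
  · rintro hD
    obtain ⟨l, hl0, x, -, hl⟩ := id hD
    obtain ⟨q, p, r, h⟩ := Necker.exists_rationalDirection_of_translate hT hS hI hl0 hl
    have hqp : Odd (q + p) := by
      by_contra hcon
      obtain ⟨hq, hp⟩ := hodd q p (Nat.not_odd_iff_even.mp hcon) h.coprime
      refine hexcl (hperiodic _ ?_ (hclosed q p r hq hp h)) hD
      have := hq.pos
      positivity
    rcases h.slope hT.pos hslope with ⟨hinf, -⟩ | ⟨P, Q, hQ, hPQ, hmPQ, hcase⟩
    · exact Or.inl hinf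
    · refine Or.inr ⟨P, Q, hQ, hPQ, ?_, hmPQ⟩
      rw [Nat.odd_add] at hqp
      by_contra hcon
      push Not at hcon
      rcases hcase with ⟨rfl, rfl⟩ | ⟨rfl, rfl⟩
      · simp only [Int.even_coe_nat] at hcon
        exact hcon.1 (hqp.mp (Nat.not_even_iff_odd.mp hcon.2))
      · simp only [even_neg, Int.even_coe_nat] at hcon
        exact hcon.2 (hqp.mp (Nat.not_even_iff_odd.mp hcon.1))
  · rintro (hinf | ⟨p, q, hq0, hpq, heven, hmpq⟩)
    · have h0 : u₂ = 0 := by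
        by_contra h0
        rcases hslope with h | h
        · rw [hinf, Necker.planarSlope, if_neg hT.pos.ne'] at h
          exact OnePoint.infty_ne_coe _ h
        · rw [hinf, Necker.planarSlope, if_neg h0] at h
          exact OnePoint.infty_ne_coe _ h
      exact hdrift 1 0 u₁ (by norm_num) ⟨hT.pos, by simp, by simp, by simp [h0]⟩
    · have hsum : Odd (q.natAbs + p.natAbs) := by
        by_contra hcon
        obtain ⟨h1, h2⟩ := hodd _ _ (Nat.not_odd_iff_even.mp hcon)
          (Int.isCoprime_iff_nat_coprime.mp hpq).symm
        rw [Int.natAbs_odd] at h1 h2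
        rcases heven with h | h
        · exact (Int.not_even_iff_odd.mpr h2) h
        · exact (Int.not_even_iff_odd.mpr h1) h
      obtain ⟨r, h | h⟩ :=
        Necker.exists_rationalDirection_of_slope hT.pos hT.nonneg hslope hq0 hpq hmpq
      · exact hdrift _ _ r hsum h
      · exact hdrift _ _ r (by rwa [add_comm]) h
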